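/- **Setting.** Let $X\subseteq\mathbb R^n$ be open, $X_T$ a nonempty target set, $\varepsilon>0$, $\mathcal N_\varepsilon\subseteq X$ the set of points of $X$ at distance at most $\varepsilon$ from $X_T$, and $X_1=X\setminus\mathcal N_\varepsilon$. Let $X_u$ be a measurable obstacle set disjoint from $\mathcal N_\varepsilon$, let $f,g_1,\dots,g_m\in C^1(X,\mathbb R^n)$, $g=(g_1,\dots,g_m)$, and let $b\ge 0$ be a measurable traversability function. Let $\alpha,\beta>0$, $\gamma\ge0$, $L_j\ge 0$, and let $d\mu_0=h_0\,dx$ be an initial measure on $X$ with $0\le h_0\in L^1(X)$. Consider $\dot x=f(x)+g(x)u$ on $X$, and assume that under measurable controls with $|u_j|\le L_j$ no solution leaves all compact subsets of $X$ in finite time. *Navigation problem.* Over all controls $u(t)$ (measurable functions of the time $t\geq 0$ and of the initial state $x(0)$) with trajectories $x(t)\in X$, minimize $$\int_X\int_0^\infty \mathbf 1_{X_1}(x(t))\,\big(\alpha b(x(t))+\beta b(x(t))\|u(t)\|_1\big)\,dt\,d\mu_0$$ subject to $\int_X \mathbf 1_{X_u}(x(t))\,d\mu_0=0$ for all $t\ge0$,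 $\int_X\int_0^\infty \mathbf 1_{X_1}(x(t))\,b(x(t))\,dt\,d\mu_0\le\gamma$, and, for $\mu_0$-almost every initial state, $\dot x=f(x)+g(x)u$, $|u_j(t)|\le L_j$ for all $t\ge 0$ and all $j$, and $\operatorname{dist}(x(t),X_T)\to0$ as $t\to\infty$. *Convex program.* Over $0\le\rho\in L^1(X_1)\cap C^1(X_1)$ and $\bar\rho\in C^1(X_1,\mathbb R^m)$, minimize $\int_{X_1}\alpha b\rho+\beta b\|\bar\rho\|_1\,dx$ subject to $\int_{X_1}\mathbf 1_{X_u}\rho\,dx=0$, $\int_{X_1}b\rho\,dx\le\gamma$, $|\bar\rho_j|\le L_j\rho$ on $X_1$ for all $j$, and $\nabla\cdot(f\rho+g\bar\rho)=h_0$ a.e. on $X_1$. *Feedbacks.* For a feedback $k\in C^1(X,\mathbb R^m)$ whose closed loop $\dot x=f(x)+g(x)k(x)$ has a global flow $(s_t)_{t\in\mathbb R}$ on $X$, let $[P_th_0](x)=h_0(s_{-t}(x))\,|\det \partial s_{-t}(x)/\partial x|$ be the Perron–Frobenius operator and $\rho_k=\int_0^\infty P_th_0\,dt$ on $X_1$.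 Call $k$ *regular* if 1. in closed loop the target is locally stable with domain of attraction containing $\mathcal N_\varepsilon$ (trajectories starting in $\mathcal N_\varepsilon$ stay there and converge to $X_T$), and $|k_j|\le L_j$ on $\mathcal N_\varepsilon$; 2. $k$ has finite cost, and either $b$ is bounded below on $X_1$ by a positive constant or the mean time $\int_X\int_0^\infty\mathbf 1_{X_1}(s_t(x))\,dt\,d\mu_0$ is finite; 3. $\rho_k$ agrees a.e. on $X_1$ with a nonnegative $C^1$ function, again denoted $\rho_k$. **Theorem.** Assume that the navigation problem has an optimal control that is a regular $C^1$ feedback $u=k(x)$. Then: 1. The program is convex (convex feasible set, convex objective). Its optimal value equals that of the navigation problem, and it is attained at $(\rho_k,\rho_kk)$, where $\rho_k=\int_0^\infty P_th_0\,dt$. 2. If $(\rho^*,\bar\rho^*)$ is any solution of the program, then the feedback $k^*$ that equals $\bar\rho^*/\rho^*$ on $X_1$ (and the local feedback $k$ on $\mathcal N_\varepsilon$) is optimal: it generates, for $\mu_0$-almost every initial state, trajectories that together solve the navigation problem and along which $\rho^*>0$ while they are in $X_1$; the target is almost everywhere stable with respect to $\mu_0$ under $k^*$, i.e. the set of initial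 states from which the trajectory does not converge to $X_T$ has $\mu_0$-measure zero. 3. For every regular $C^1$ feedback $k'$, optimal or not, the target is almost everywhere stable with respect to $\mu_0$, $k'$ satisfies the constraints of the navigation problem if and only if $(\rho_{k'},\rho_{k'}k')$ is feasible for the program, and the two costs coincide. 4. For every $C^1$ feedback with a global closed-loop flow, $\int_0^\infty\int_X\mathbf 1_{X_u}(s_t(x))\,d\mu_0\,dt=0$ implies $\int_X\mathbf 1_{X_u}(s_t(x))\,d\mu_0=0$ for all $t\ge0$. -/

import Mathlib

open MeasureTheory Set Filter Topology
open scoped ENNReal NNReal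

/-- The state space `ℝⁿ` with its Euclidean norm. -/
abbrev State (n : ℕ) : Type := EuclideanSpace ℝ (Fin n)

/-- The data of the off-road navigation problem for `ẋ = f(x) + ∑ⱼ uⱼ gⱼ(x)` on `X ⊆ ℝⁿ`. -/
structure NavData (n m : ℕ) where
  /-- state space -/
  X : Set (State n)
  /-- target set -/
  XT : Set (State n)
  /-- obstacle set -/
  Xu : Set (State n)
  /-- drift -/
  f : State n → State n
  /-- control vector fields, the columns of `g` -/
  g : Fin m → State n → State n
  /-- traversability function -/
  b : State n → ℝ
  /-- density of the initial measure -/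
  h0 : State n → ℝ
  /-- radius of the neighbourhood of the target -/
  ε : ℝ
  /-- weight of the traversability -/
  α : ℝ
  /-- weight of traversability times control effort -/
  β : ℝ
  /-- threshold for the traversability cost -/
  γ : ℝ
  /-- bounds of the control components -/
  L : Fin m → ℝ

/-- The divergence `∑ᵢ ∂Vᵢ/∂xᵢ` of a vector field on `ℝⁿ`. -/
noncomputable def divergence {n : ℕ} (V : State n → State n) (x : State n) : ℝ :=
  ∑ i, (fderiv ℝ V x (EuclideanSpace.single i 1)) i

/-- `s` is the (two-sided, global) flow on `X` of the vector field `F`. -/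
def IsFlowOn {n : ℕ} (F : State n → State n) (X : Set (State n))
    (s : ℝ → State n → State n) : Prop :=
  ∀ x ∈ X, s 0 x = x ∧ ∀ t, s t x ∈ X ∧ HasDerivAt (fun τ => s τ x) (F (s t x)) t

/-- The Perron-Frobenius operator `[P_t φ](x) = φ(s_{-t}(x)) |det ∂s_{-t}(x)/∂x|` of a flow. -/
noncomputable def perronFrobenius {n : ℕ} (s : ℝ → State n → State n) (t : ℝ)
    (φ : State n → ℝ) (x : State n) : ℝ :=
  φ (s (-t) x) * |(fderiv ℝ (s (-t)) x).det|

namespace NavData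

variable {n m : ℕ} (P : NavData n m)

/-- The `ε`-neighbourhood of the target set (closed, within `X`). -/
def nbhd : Set (State n) := P.X ∩ Metric.cthickening P.ε P.XT

/-- `X₁`: the state space minus the `ε`-neighbourhood of the target. -/
def X1 : Set (State n) := P.X \ P.nbhd

/-- The initial measure `dμ₀ = h₀ dx` on `X`. -/
noncomputable def μ0 : Measure (State n) :=
  (volume.restrict P.X).withDensity (fun x => ENNReal.ofReal (P.h0 x))

/-- The right-hand side `f(x) + g(x) u`. -/
noncomputable def field (x : State n) (u : Fin m → ℝ) : State n :=
  P.f x + ∑ j, u j • P.g j x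

/-- Running cost `α b(x) + β b(x) ‖u‖₁`. -/
noncomputable def runningCost (x : State n) (u : Fin m → ℝ) : ℝ :=
  P.α * P.b x + P.β * P.b x * ∑ j, |u j|

/-- For controls within the bounds, solutions have no finite escape time: on a bounded
time interval they stay in a compact part of `X`. -/
def NoFiniteEscape : Prop :=
  ∀ T > 0, ∀ (u : ℝ → Fin m → ℝ) (x : ℝ → State n),
    Measurable u → (∀ t ∈ Ico 0 T, ∀ j, |u t j| ≤ P.L j) →
    ContinuousOn x (Ico 0 T) → (∀ t ∈ Ico 0 T, x t ∈ P.X) →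
    (∀ t ∈ Ico 0 T, x t = x 0 + ∫ τ in (0 : ℝ)..t, P.field (x τ) (u τ)) →
    ∃ K : Set (State n), IsCompact K ∧ K ⊆ P.X ∧ ∀ t ∈ Ico 0 T, x t ∈ K

/-! ### The navigation problem

A control is a function `u t ξ` of the time and of the initial state, with trajectories `x t ξ`
(for feedback `k` with closed-loop flow `s`: `x = s` and `u t ξ = k (s t ξ)`). -/

/-- Cost to be minimized: `∫∫ α b(x(t)) + β b(x(t)) ‖u(t)‖₁ dt dμ₀`, where running costs are
incurred outside the `ε`-neighbourhood of the target. -/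
noncomputable def cost (x : ℝ → State n → State n) (u : ℝ → State n → Fin m → ℝ) : ℝ≥0∞ :=
  ∫⁻ ξ, (∫⁻ t in Ici (0 : ℝ),
    P.X1.indicator (fun y => ENNReal.ofReal (P.runningCost y (u t ξ))) (x t ξ)) ∂P.μ0

/-- Traversability cost `∫∫ b(x(t)) dt dμ₀`, incurred outside the neighbourhood of the target. -/
noncomputable def traversal (x : ℝ → State n → State n) : ℝ≥0∞ :=
  ∫⁻ ξ, (∫⁻ t in Ici (0 : ℝ), P.X1.indicator (fun y => ENNReal.ofReal (P.b y)) (x t ξ)) ∂P.μ0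

/-- Mean time spent outside the neighbourhood of the target. -/
noncomputable def meanTime (x : ℝ → State n → State n) : ℝ≥0∞ :=
  ∫⁻ ξ, (∫⁻ t in Ici (0 : ℝ), P.X1.indicator (fun _ => (1 : ℝ≥0∞)) (x t ξ)) ∂P.μ0

/-- `∫ 1_{X_u}(x(t)) dμ₀`, the part of the initial mass that is in the obstacle at time `t`. -/
noncomputable def obstacleMass (x : ℝ → State n → State n) (t : ℝ) : ℝ≥0∞ :=
  ∫⁻ ξ, P.Xu.indicator (fun _ => (1 : ℝ≥0∞)) (x t ξ) ∂P.μ0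

/-- The target is almost everywhere stable with respect to `μ₀`: the set of initial states from
which the trajectory does not converge to the target has `μ₀`-measure zero. -/
def AEStable (x : ℝ → State n → State n) : Prop :=
  ∀ᵐ ξ ∂P.μ0, Tendsto (fun t => Metric.infDist (x t ξ) P.XT) atTop (𝓝 0)

/-- The constraints of the navigation problem. -/
structure Admissible (x : ℝ → State n → State n) (u : ℝ → State n → Fin m → ℝ) : Prop where
  measurable_x : AEMeasurable (fun p : ℝ × State n => x p.1 p.2)
    ((volume.restrict (Ici (0 : ℝ))).prod P.μ0)
  measurable_u : AEMeasurable (fun p : ℝ × State n => u p.1 p.2)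
    ((volume.restrict (Ici (0 : ℝ))).prod P.μ0)
  dynamics : ∀ᵐ ξ ∂P.μ0, ContinuousOn (fun t => x t ξ) (Ici 0) ∧
    ∀ t, 0 ≤ t → x t ξ ∈ P.X ∧ x t ξ = ξ + ∫ τ in (0 : ℝ)..t, P.field (x τ ξ) (u τ ξ)
  obstacle : ∀ t, 0 ≤ t → P.obstacleMass x t = 0
  traversal_le : P.traversal x ≤ ENNReal.ofReal P.γ
  control_le : ∀ᵐ ξ ∂P.μ0, ∀ t, 0 ≤ t → ∀ j, |u t ξ j| ≤ P.L j
  stable : P.AEStable x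

/-- `(x, u)` is a solution of the navigation problem. -/
def IsOptimal (x : ℝ → State n → State n) (u : ℝ → State n → Fin m → ℝ) : Prop :=
  P.Admissible x u ∧ ∀ x' u', P.Admissible x' u' → P.cost x u ≤ P.cost x' u'

/-- The optimal value of the navigation problem. -/
noncomputable def value : ℝ≥0∞ :=
  ⨅ (x : ℝ → State n → State n) (u : ℝ → State n → Fin m → ℝ) (_ : P.Admissible x u), P.cost x u

/-! ### Feedback -/

/-- `k` is a `C¹` feedback with closed-loop flow `s` on `X`. -/
def IsFeedback (k : State n → Fin m → ℝ) (s : ℝ → State n → State n) : Prop :=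
  ContDiffOn ℝ 1 k P.X ∧ IsFlowOn (fun x => P.field x (k x)) P.X s

/-- In closed loop the target is locally stable with domain of attraction containing its
`ε`-neighbourhood: trajectories there remain there, respect the control bounds, and converge
to the target. -/
def LocallyStable (k : State n → Fin m → ℝ) (s : ℝ → State n → State n) : Prop :=
  ∀ x ∈ P.nbhd, (∀ j, |k x j| ≤ P.L j) ∧ (∀ t, 0 ≤ t → s t x ∈ P.nbhd) ∧
    Tendsto (fun t => Metric.infDist (s t x) P.XT) atTop (𝓝 0)

/-- `ρ(x) = ∫₀^∞ [P_t h₀](x) dt` for almost every `x ∈ X₁`. -/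
def IsOccupationDensity (s : ℝ → State n → State n) (ρ : State n → ℝ) : Prop :=
  ∀ᵐ x ∂(volume.restrict P.X1), ENNReal.ofReal (ρ x) =
    ∫⁻ t in Ici (0 : ℝ), ENNReal.ofReal (perronFrobenius s t P.h0 x)

/-- The feedback that equals `ρ̄ / ρ` on `X₁`, and the local feedback `k` near the target. -/
noncomputable def recovered (k : State n → Fin m → ℝ)
    (q : (State n → ℝ) × (State n → Fin m → ℝ)) (x : State n) : Fin m → ℝ :=
  open Classical in if x ∈ P.X1 then fun j => q.2 x j / q.1 x else k x

/-! ### The convex program, in the variables `q = (ρ, ρ̄)` -/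

/-- Objective `∫_{X₁} α b ρ + β b ‖ρ̄‖₁ dx`. -/
noncomputable def programCost (q : (State n → ℝ) × (State n → Fin m → ℝ)) : ℝ≥0∞ :=
  ∫⁻ x in P.X1, ENNReal.ofReal (P.α * P.b x * q.1 x + P.β * P.b x * ∑ j, |q.2 x j|)

/-- Constraints of the program, including the function spaces of `ρ` and `ρ̄`. -/
structure Feasible (q : (State n → ℝ) × (State n → Fin m → ℝ)) : Prop where
  contDiff_fst : ContDiffOn ℝ 1 q.1 P.X1
  contDiff_snd : ContDiffOn ℝ 1 q.2 P.X1
  integrable : IntegrableOn q.1 P.X1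
  nonneg : ∀ x ∈ P.X1, 0 ≤ q.1 x
  obstacle : ∫⁻ x in P.X1, P.Xu.indicator (fun y => ENNReal.ofReal (q.1 y)) x = 0
  traversal_le : ∫⁻ x in P.X1, ENNReal.ofReal (P.b x * q.1 x) ≤ ENNReal.ofReal P.γ
  control_le : ∀ x ∈ P.X1, ∀ j, |q.2 x j| ≤ P.L j * q.1 x
  liouville : ∀ᵐ x ∂(volume.restrict P.X1),
    divergence (fun y => q.1 y • P.f y + ∑ j, q.2 y j • P.g j y) x = P.h0 x

/-- `q` is a solution of the program. -/
def IsProgramOptimal (q : (State n → ℝ) × (State n → Fin m → ℝ)) : Prop :=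
  P.Feasible q ∧ ∀ q', P.Feasible q' → P.programCost q ≤ P.programCost q'

/-- The optimal value of the program. -/
noncomputable def programValue : ℝ≥0∞ :=
  ⨅ (q : (State n → ℝ) × (State n → Fin m → ℝ)) (_ : P.Feasible q), P.programCost q

end NavData

/-! ### Flows of bounded Lipschitz vector fields -/

/-! The link between controls and densities is the occupation measure, the image of μ₀ ⊗ dt under
(ξ, t) ↦ x(t). For a regular feedback it has density ρ on X₁, so costs and traversal times are
linear in (ρ, ρ k). It remains to match the constraints and to realize every feasible pair by
trajectories at no greater cost.

From feedbacks to densities. A change of variables along the flow (`lintegral_occupation`) turns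
time integrals along trajectories into integrals against ρ. Finite mean time in X₁ forces almost
every trajectory into the positively invariant neighbourhood of the target, whence stability. For a
test function φ supported in X₁, integrating d/dt φ(s_t ξ) over [0, ∞) gives -φ(ξ); integration over
μ₀ and by parts yields div(ρ(f + g k)) = h₀. Vanishing total time in the obstacle gives vanishing
mass at every time by a recurrence argument (`ae_notMem_of_ae_ae_notMem`), and control bounds
transfer because ρ and k are continuous.

From densities to trajectories. The flux V = ρ f + g ρ̄ is C¹ with div V = h₀, but the feedback ρ̄/ρ
is meaningless where ρ = 0 and its field need not be complete. So V is multiplied by a function χ,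
positive on X₁ and zero elsewhere, that makes χV bounded and Lipschitz; θ is its global flow. The
key estimate (`lintegral_occupation_le`) is that the occupation measure of h₀ under θ is at most
dx/χ: for ψ ≥ 0 and Φ = ∫₀ᵀ ψ∘θ_t, the derivative of Φ along χV is ψ∘θ_T - ψ ≥ -ψ, so ∫ h₀Φ = ∫ Φ
div V = -∫ ∇Φ·V ≤ ∫ ψ/χ.

Three choices of ψ suffice. With ψ = χ 1_C, C compact, almost no orbit converges to a point of X₁;
in particular orbits avoid the zeros of ρ, which are equilibria. With ψ = χρ, the physical time, dt
= χρ dr, is finite along almost every orbit. Since solutions cannot escape from X in finite time,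
the orbit then has a limit in X, which must lie in the neighbourhood of the target, where the local
feedback takes over. With ψ = χρ times the running cost, the cost of these trajectories is at most
that of the program.

Hence the optimal cost is a lower bound for the program, and (ρ, ρ k) attains it. -/

theorem IsFlowOn.reverse {n : ℕ} {F : State n → State n} {X : Set (State n)}
    {s : ℝ → State n → State n} (h : IsFlowOn F X s) :
    IsFlowOn (fun x => -F x) X (fun t => s (-t)) := fun x hx => by
  refine ⟨by simpa using (h x hx).1, fun t => ⟨((h x hx).2 (-t)).1, ?_⟩⟩
  have := HasDerivAt.scomp t ((h x hx).2 (-t)).2 (hasDerivAt_neg t)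
  simpa [Function.comp_def] using this

theorem IsFlowOn.continuous_left {n : ℕ} {F : State n → State n} {X : Set (State n)}
    {s : ℝ → State n → State n} (h : IsFlowOn F X s) {x : State n} (hx : x ∈ X) :
    Continuous fun t => s t x :=
  continuous_iff_continuousAt.2 fun t => ((h x hx).2 t).2.continuousAt

theorem LipschitzWith.neg_field {n : ℕ} {Y : State n → State n} {K : ℝ≥0}
    (hK : LipschitzWith K Y) : LipschitzWith K fun x => -Y x := by
  simpa [one_mul, Function.comp_def] using LipschitzWith.id.neg.comp hK

/-- A bounded Lipschitz vector field has a global flow. -/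
theorem exists_isFlowOn_univ {n : ℕ} {Y : State n → State n} {K M : ℝ≥0}
    (hK : LipschitzWith K Y) (hM : ∀ x, ‖Y x‖ ≤ M) :
    ∃ θ : ℝ → State n → State n, IsFlowOn Y univ θ := by
  have key : ∀ (x : State n) (N : ℕ), ∃ α : ℝ → State n, α 0 = x ∧
      ∀ t ∈ Ioo (-(N + 1 : ℝ)) (N + 1), HasDerivAt α (Y (α t)) t := by
    intro x N
    have h0 : (0 : ℝ) ∈ Icc (-(N + 1 : ℝ)) (N + 1) := ⟨by linarith, by positivity⟩
    -- A field bounded by M moves a point by at most M (N + 1) during a time N + 1, so a ball of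
    -- this radius makes Picard–Lindelöf valid on the whole interval.
    have hPL : IsPicardLindelof (fun _ => Y) (⟨0, h0⟩ : Icc (-(N + 1 : ℝ)) (N + 1)) x
        (M * (N + 1)) 0 M K :=
      IsPicardLindelof.of_time_independent (fun y _ => hM y) hK.lipschitzOnWith (by simp)
    obtain ⟨α, hα0, hα⟩ := hPL.exists_eq_forall_mem_Icc_hasDerivWithinAt₀
    exact ⟨α, hα0, fun t ht => (hα t (Ioo_subset_Icc_self ht)).hasDerivAt (Icc_mem_nhds ht.1 ht.2)⟩
  choose α hα0 hα using key
  have agree : ∀ x (N M' : ℕ), N ≤ M' → EqOn (α x N) (α x M') (Ioo (-(N + 1 : ℝ)) (N + 1)) := by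
    intro x N M' hNM
    have hc : (N : ℝ) ≤ M' := by exact_mod_cast hNM
    refine ODE_solution_unique_of_mem_Ioo (v := fun _ => Y) (s := fun _ => univ) (K := K) (t₀ := 0)
      (fun _ _ => hK.lipschitzOnWith) ⟨by linarith [Nat.cast_nonneg (α := ℝ) N], by positivity⟩
      (fun t ht => ⟨hα x N t ht, trivial⟩) (fun t ht => ⟨hα x M' t ⟨?_, ?_⟩, trivial⟩)
      (by rw [hα0, hα0])
    · linarith [ht.1]
    · linarith [ht.2]
  -- The local solutions are glued by using at time t the one with index ⌈|t|⌉; `agree` makes the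
  -- choice of a larger index irrelevant.
  refine ⟨fun t x => α x ⌈|t|⌉₊ t, fun x _ => ⟨by simp [hα0], fun t => ⟨trivial, ?_⟩⟩⟩
  have hmem : ∀ τ : ℝ, ∀ N : ℕ, ⌈|τ|⌉₊ ≤ N → τ ∈ Ioo (-(N + 1 : ℝ)) (N + 1) := by
    intro τ N hN
    have : |τ| ≤ N := (Nat.le_ceil _).trans (by exact_mod_cast hN)
    rw [abs_le] at this
    constructor <;> linarith
  refine (hα x ⌈|t|⌉₊ t (hmem t _ le_rfl)).congr_of_eventuallyEq ?_
  filter_upwards [Ioo_mem_nhds (hmem t _ le_rfl).1 (hmem t _ le_rfl).2] with τ hτ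
  rcases le_total ⌈|τ|⌉₊ ⌈|t|⌉₊ with h | h
  · exact agree x _ _ h (hmem τ _ le_rfl)
  · exact (agree x _ _ h hτ).symm

/-- A solution curve of a Lipschitz vector field follows its global flow. -/
theorem IsFlowOn.eq_of_solution {n : ℕ} {Y : State n → State n} {K : ℝ≥0}
    {θ : ℝ → State n → State n} (hθ : IsFlowOn Y univ θ) (hK : LipschitzWith K Y)
    {c : ℝ → State n} {T : ℝ} (hc : ContinuousOn c (Icc 0 T))
    (hc' : ∀ t ∈ Ico 0 T, HasDerivWithinAt c (Y (c t)) (Ici t) t) {t : ℝ} (ht : t ∈ Icc 0 T) :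
    c t = θ t (c 0) :=
  ODE_solution_unique (v := fun _ => Y) (fun _ => hK) hc hc'
    (hθ.continuous_left trivial).continuousOn
    (fun t _ => ((hθ (c 0) trivial).2 t).2.hasDerivWithinAt) (hθ (c 0) trivial).1.symm ht

theorem IsFlowOn.add_apply {n : ℕ} {Y : State n → State n} {K : ℝ≥0}
    {θ : ℝ → State n → State n} (hθ : IsFlowOn Y univ θ) (hK : LipschitzWith K Y) (r t : ℝ)
    (x : State n) : θ (r + t) x = θ r (θ t x) := by
  have := ODE_solution_unique_univ (v := fun _ => Y) (s := fun _ => univ) (K := K) (t₀ := 0)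
    (f := fun r => θ (r + t) x) (g := fun r => θ r (θ t x))
    (fun _ => hK.lipschitzOnWith)
    (fun r => ⟨((hθ x trivial).2 (r + t)).2.comp_add_const r t, trivial⟩)
    (fun r => ⟨((hθ (θ t x) trivial).2 r).2, trivial⟩)
    (by simp [(hθ (θ t x) trivial).1])
  exact congrFun this r

theorem IsFlowOn.neg_apply_apply {n : ℕ} {Y : State n → State n} {K : ℝ≥0}
    {θ : ℝ → State n → State n} (hθ : IsFlowOn Y univ θ) (hK : LipschitzWith K Y) (t : ℝ)
    (x : State n) : θ (-t) (θ t x) = x := by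
  rw [← hθ.add_apply hK, neg_add_cancel, (hθ x trivial).1]

theorem IsFlowOn.dist_le {n : ℕ} {Y : State n → State n} {K : ℝ≥0}
    {θ : ℝ → State n → State n} (hθ : IsFlowOn Y univ θ) (hK : LipschitzWith K Y) (t : ℝ)
    (x y : State n) : dist (θ t x) (θ t y) ≤ dist x y * Real.exp (K * |t|) := by
  have key : ∀ {Y : State n → State n} {θ : ℝ → State n → State n}, IsFlowOn Y univ θ →
      LipschitzWith K Y → ∀ t ≥ 0, dist (θ t x) (θ t y) ≤ dist x y * Real.exp (K * t) := by
    intro Y θ hθ hK t ht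
    have := dist_le_of_trajectories_ODE (v := fun _ => Y) (δ := dist x y) (a := 0) (b := t)
      (fun _ => hK)
      (hθ.continuous_left (x := x) trivial).continuousOn
      (fun t _ => ((hθ x trivial).2 t).2.hasDerivWithinAt)
      (hθ.continuous_left (x := y) trivial).continuousOn
      (fun t _ => ((hθ y trivial).2 t).2.hasDerivWithinAt)
      (by rw [(hθ x trivial).1, (hθ y trivial).1]) t ⟨ht, le_rfl⟩
    simpa using this
  rcases le_total 0 t with ht | ht
  · simpa [abs_of_nonneg ht] using key hθ hK t ht
  · simpa [abs_of_nonpos ht] using key hθ.reverse hK.neg_field (-t) (by linarith)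

theorem IsFlowOn.lipschitzWith {n : ℕ} {Y : State n → State n} {K : ℝ≥0}
    {θ : ℝ → State n → State n} (hθ : IsFlowOn Y univ θ) (hK : LipschitzWith K Y) (t : ℝ) :
    LipschitzWith (Real.toNNReal (Real.exp (K * |t|))) (θ t) :=
  LipschitzWith.of_dist_le' fun x y => by
    rw [mul_comm]
    exact hθ.dist_le hK t x y

theorem IsFlowOn.continuous_uncurry {n : ℕ} {Y : State n → State n} {K : ℝ≥0}
    {θ : ℝ → State n → State n} (hθ : IsFlowOn Y univ θ) (hK : LipschitzWith K Y) :
    Continuous fun p : ℝ × State n => θ p.1 p.2 := by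
  rw [continuous_iff_continuousAt]
  rintro ⟨t, x⟩
  rw [ContinuousAt, tendsto_iff_dist_tendsto_zero]
  have h1 : Tendsto (fun p : ℝ × State n => dist p.2 x * Real.exp (K * |p.1|) +
      dist (θ p.1 x) (θ t x)) (𝓝 (t, x)) (𝓝 (dist x x * Real.exp (K * |t|) +
      dist (θ t x) (θ t x))) := by
    have := hθ.continuous_left (x := x) trivial
    have hc : Continuous (fun p : ℝ × State n => dist p.2 x * Real.exp (K * |p.1|) +
      dist (θ p.1 x) (θ t x)) := by fun_prop
    exact hc.tendsto (t, x)
  simp only [dist_self, zero_mul, zero_add] at h1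
  refine squeeze_zero (fun _ => dist_nonneg) (fun p => ?_) h1
  exact (dist_triangle _ (θ p.1 x) _).trans (add_le_add_left (hθ.dist_le hK _ _ _) _)

/-! ### Cutoffs -/

theorem exists_contDiff_cutoff {n : ℕ} {U C : Set (State n)} (hU : IsOpen U) (hC : IsCompact C)
    (hCU : C ⊆ U) : ∃ φ : State n → ℝ, ContDiff ℝ 1 φ ∧ HasCompactSupport φ ∧ tsupport φ ⊆ U ∧
      (∀ x, 0 ≤ φ x ∧ φ x ≤ 1) ∧ ∃ W, IsOpen W ∧ C ⊆ W ∧ ∀ x ∈ W, φ x = 1 := by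
  obtain ⟨L, hL, hCL, hLU⟩ := exists_compact_between hC hU hCU
  obtain ⟨φ, h1, h0, h01⟩ := exists_contMDiffMap_one_nhds_of_subset_interior (n := 1)
    (modelWithCornersSelf ℝ (State n)) hC.isClosed hCL
  have hts : tsupport φ ⊆ L := closure_minimal (fun x hx => by
    by_contra hxL
    exact hx (h0 x hxL)) hL.isClosed
  obtain ⟨W, hW, hCW, hW1⟩ := mem_nhdsSet_iff_exists.1 h1
  exact ⟨φ, φ.contMDiff.contDiff, hL.of_isClosed_subset (isClosed_tsupport _) hts,
    hts.trans hLU, fun x => h01 x, W, hW, hCW, hW1⟩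

theorem contDiff_smul_of_tsupport_subset {n : ℕ} {U : Set (State n)} (hU : IsOpen U)
    {G : Type*} [NormedAddCommGroup G] [NormedSpace ℝ G]
    {φ : State n → ℝ} {V : State n → G} (hφ : ContDiff ℝ 1 φ) (hφU : tsupport φ ⊆ U)
    (hV : ContDiffOn ℝ 1 V U) : ContDiff ℝ 1 fun x => φ x • V x := by
  rw [contDiff_iff_contDiffAt]
  intro x
  by_cases hx : x ∈ U
  · exact hφ.contDiffAt.smul (hV.contDiffAt (hU.mem_nhds hx))
  · have hx' : x ∉ tsupport φ := fun h => hx (hφU h)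
    refine (contDiffAt_const (c := (0 : G))).congr_of_eventuallyEq ?_
    filter_upwards [(isClosed_tsupport φ).isOpen_compl.mem_nhds hx'] with y hy
    rw [image_eq_zero_of_notMem_tsupport hy, zero_smul]

theorem exists_lipschitz_bound_smul {n : ℕ} {U : Set (State n)} (hU : IsOpen U)
    {G : Type*} [NormedAddCommGroup G] [NormedSpace ℝ G]
    {φ : State n → ℝ} {V : State n → G} (hφ : ContDiff ℝ 1 φ) (hφc : HasCompactSupport φ)
    (hφU : tsupport φ ⊆ U) (hV : ContDiffOn ℝ 1 V U) :
    ∃ K M : ℝ≥0, LipschitzWith K (fun x => φ x • V x) ∧ ∀ x, ‖φ x • V x‖ ≤ M := by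
  have h1 := contDiff_smul_of_tsupport_subset hU hφ hφU hV
  have hc : HasCompactSupport fun x => φ x • V x := hφc.smul_right
  obtain ⟨K, hK⟩ := h1.lipschitzWith_of_hasCompactSupport hc one_ne_zero
  obtain ⟨M, hM⟩ := hc.exists_bound_of_continuous h1.continuous
  exact ⟨K, M.toNNReal, hK, fun x => (hM x).trans (Real.le_coe_toNNReal M)⟩

/-- On a neighbourhood of a compact set, a `C¹` field agrees with one that has a global flow. -/
theorem exists_cutoff_flow {n : ℕ} {U C : Set (State n)} (hU : IsOpen U) (hC : IsCompact C)
    (hCU : C ⊆ U) {F : State n → State n} (hF : ContDiffOn ℝ 1 F U) :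
    ∃ (Y : State n → State n) (K : ℝ≥0) (θ : ℝ → State n → State n), LipschitzWith K Y ∧
      IsFlowOn Y univ θ ∧ ∃ W, IsOpen W ∧ C ⊆ W ∧ W ⊆ U ∧ ∀ x ∈ W, Y x = F x := by
  obtain ⟨φ, hφ, hφc, hφU, -, W, hW, hCW, hW1⟩ := exists_contDiff_cutoff hU hC hCU
  obtain ⟨K, M, hK, hM⟩ := exists_lipschitz_bound_smul hU hφ hφc hφU hF
  obtain ⟨θ, hθ⟩ := exists_isFlowOn_univ hK hM
  exact ⟨_, K, θ, hK, hθ, W ∩ U, hW.inter hU, subset_inter hCW hCU, inter_subset_right,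
    fun x hx => by simp [hW1 x hx.1]⟩

/-! ### Flows of `C¹` fields on open sets -/

/-- Two solutions in an open set of a `C¹` field that start at the same point agree. -/
theorem eqOn_of_solutions {n : ℕ} {U : Set (State n)} (hU : IsOpen U) {F : State n → State n}
    (hF : ContDiffOn ℝ 1 F U) {c d : ℝ → State n} {T : ℝ}
    (hc : ContinuousOn c (Icc 0 T)) (hcU : ∀ t ∈ Icc 0 T, c t ∈ U)
    (hc' : ∀ t ∈ Ico 0 T, HasDerivWithinAt c (F (c t)) (Ici t) t)
    (hd : ContinuousOn d (Icc 0 T)) (hdU : ∀ t ∈ Icc 0 T, d t ∈ U)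
    (hd' : ∀ t ∈ Ico 0 T, HasDerivWithinAt d (F (d t)) (Ici t) t) (h0 : c 0 = d 0) :
    EqOn c d (Icc 0 T) := by
  -- Both curves have compact images in U, so a cutoff around their union reduces uniqueness to the
  -- globally Lipschitz case.
  obtain ⟨Y, K, θ, hK, hθ, W, -, hCW, -, hYF⟩ := exists_cutoff_flow hU
    ((isCompact_Icc.image_of_continuousOn hc).union (isCompact_Icc.image_of_continuousOn hd))
    (by
      rintro x (⟨t, ht, rfl⟩ | ⟨t, ht, rfl⟩)
      exacts [hcU t ht, hdU t ht]) hF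
  intro t ht
  rw [hθ.eq_of_solution hK hc (fun r hr => ?_) ht, hθ.eq_of_solution hK hd (fun r hr => ?_) ht, h0]
  · rw [hYF _ (hCW (Or.inr ⟨r, Ico_subset_Icc_self hr, rfl⟩))]
    exact hd' r hr
  · rw [hYF _ (hCW (Or.inl ⟨r, Ico_subset_Icc_self hr, rfl⟩))]
    exact hc' r hr

/-- A solution curve of a `C¹` field that stays in the open set follows its flow. -/
theorem IsFlowOn.eq_of_solution_mem {n : ℕ} {X : Set (State n)} (hX : IsOpen X)
    {F : State n → State n} (hF : ContDiffOn ℝ 1 F X) {s : ℝ → State n → State n}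
    (hs : IsFlowOn F X s) {c : ℝ → State n} (hcX : ∀ t, c t ∈ X)
    (hc : ∀ t, HasDerivAt c (F (c t)) t) (t : ℝ) : c t = s t (c 0) := by
  have key : ∀ {F : State n → State n} {s : ℝ → State n → State n} {c : ℝ → State n},
      ContDiffOn ℝ 1 F X → IsFlowOn F X s → (∀ t, c t ∈ X) → (∀ t, HasDerivAt c (F (c t)) t) →
      ∀ t ≥ 0, c t = s t (c 0) := by
    intro F s c hF hs hcX hc t ht
    exact eqOn_of_solutions hX hF (fun r _ => (hc r).continuousAt.continuousWithinAt)
      (fun r _ => hcX r) (fun r _ => (hc r).hasDerivWithinAt)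
      (hs.continuous_left (hcX 0)).continuousOn (fun r _ => ((hs _ (hcX 0)).2 r).1)
      (fun r _ => ((hs _ (hcX 0)).2 r).2.hasDerivWithinAt) (hs _ (hcX 0)).1.symm ⟨ht, le_rfl⟩
  rcases le_total 0 t with ht | ht
  · exact key hF hs hcX hc t ht
  · have := key hF.neg hs.reverse (c := fun t => c (-t)) (fun t => hcX (-t)) (fun t => by
      have := HasDerivAt.scomp t (hc (-t)) (hasDerivAt_neg t)
      simpa [Function.comp_def] using this) (-t) (by linarith)
    simpa using this

theorem IsFlowOn.add_apply_mem {n : ℕ} {X : Set (State n)} (hX : IsOpen X)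
    {F : State n → State n} (hF : ContDiffOn ℝ 1 F X) {s : ℝ → State n → State n}
    (hs : IsFlowOn F X s) (r t : ℝ) {x : State n} (hx : x ∈ X) :
    s (r + t) x = s r (s t x) := by
  have := hs.eq_of_solution_mem hX hF (c := fun r => s (r + t) x) (fun r => ((hs x hx).2 _).1)
    (fun r => ((hs x hx).2 (r + t)).2.comp_add_const r t) r
  simpa using this

theorem IsFlowOn.neg_apply_apply_mem {n : ℕ} {X : Set (State n)} (hX : IsOpen X)
    {F : State n → State n} (hF : ContDiffOn ℝ 1 F X) {s : ℝ → State n → State n}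
    (hs : IsFlowOn F X s) (t : ℝ) {x : State n} (hx : x ∈ X) : s (-t) (s t x) = x := by
  rw [← hs.add_apply_mem hX hF _ _ hx, neg_add_cancel, (hs x hx).1]

/-- Near a point and on a bounded time interval, the flow of a `C¹` field on an open set agrees
with the flow of a Lipschitz field on the whole space. -/
theorem IsFlowOn.exists_local_flow {n : ℕ} {X : Set (State n)} (hX : IsOpen X)
    {F : State n → State n} (hF : ContDiffOn ℝ 1 F X) {s : ℝ → State n → State n}
    (hs : IsFlowOn F X s) {x₀ : State n} (hx₀ : x₀ ∈ X) (T : ℝ) :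
    ∃ (Y : State n → State n) (K : ℝ≥0) (θ : ℝ → State n → State n), LipschitzWith K Y ∧
      IsFlowOn Y univ θ ∧ ∃ O, IsOpen O ∧ x₀ ∈ O ∧ O ⊆ X ∧
        ∀ x ∈ O, ∀ t ∈ Icc (-T) T, s t x = θ t x := by
  have hcpt : IsCompact ((fun t => s t x₀) '' Icc (-T) T) :=
    isCompact_Icc.image (hs.continuous_left hx₀)
  obtain ⟨Y, K, θ, hK, hθ, W, hW, hCW, hWX, hYF⟩ := exists_cutoff_flow hX hcpt
    (by rintro x ⟨t, -, rfl⟩; exact ((hs x₀ hx₀).2 t).1) hF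
  have fwd : ∀ {F Y : State n → State n} {s θ : ℝ → State n → State n},
      ContDiffOn ℝ 1 F X → IsFlowOn F X s → IsFlowOn Y univ θ → (∀ x ∈ W, Y x = F x) →
      ∀ x ∈ X, ∀ t ≥ 0, (∀ r ∈ Icc 0 t, θ r x ∈ W) → s t x = θ t x := by
    intro F Y s θ hF hs hθ hYF x hx t ht hW'
    refine eqOn_of_solutions hX hF (hs.continuous_left hx).continuousOn
      (fun r _ => ((hs x hx).2 r).1) (fun r _ => ((hs x hx).2 r).2.hasDerivWithinAt)
      (hθ.continuous_left trivial).continuousOn (fun r hr => hWX (hW' r hr)) (fun r hr => ?_)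
      (by rw [(hs x hx).1, (hθ x trivial).1]) ⟨ht, le_rfl⟩
    rw [← hYF _ (hW' r (Ico_subset_Icc_self hr))]
    exact ((hθ x trivial).2 r).2.hasDerivWithinAt
  have two : ∀ x ∈ X, (∀ r ∈ Icc (-T) T, θ r x ∈ W) → ∀ t ∈ Icc (-T) T, s t x = θ t x := by
    intro x hx hxW t ht
    rcases le_total 0 t with h | h
    · exact fwd hF hs hθ hYF x hx t h fun r hr => hxW r ⟨by linarith [hr.1, ht.1, ht.2],
        hr.2.trans ht.2⟩
    · have := fwd hF.neg hs.reverse hθ.reverse (fun x hx => by rw [hYF x hx]) x hx (-t)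
        (by linarith) fun r hr => hxW (-r) ⟨by linarith [hr.2, ht.1], by linarith [hr.1, ht.1, ht.2]⟩
      simpa using this
  have h₀ : ∀ t ∈ Icc (-T) T, θ t x₀ ∈ W := by
    have half : ∀ {F Y : State n → State n} {s θ : ℝ → State n → State n},
        IsFlowOn F X s → IsFlowOn Y univ θ → LipschitzWith K Y → (∀ x ∈ W, Y x = F x) →
        ∀ t, 0 ≤ t → (∀ r ∈ Icc 0 t, s r x₀ ∈ W) → s t x₀ = θ t x₀ := by
      intro F Y s θ hs hθ hK hYF t ht hsW
      have := hθ.eq_of_solution hK (hs.continuous_left hx₀).continuousOn (T := t) (fun r hr => by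
        rw [hYF _ (hsW r (Ico_subset_Icc_self hr))]
        exact ((hs x₀ hx₀).2 r).2.hasDerivWithinAt) ⟨ht, le_rfl⟩
      rwa [(hs x₀ hx₀).1] at this
    intro t ht
    have : s t x₀ = θ t x₀ := by
      rcases le_total 0 t with h | h
      · exact half hs hθ hK hYF t h fun r hr => hCW ⟨r, ⟨by linarith [hr.1, ht.1, ht.2],
          hr.2.trans ht.2⟩, rfl⟩
      · have := half hs.reverse hθ.reverse hK.neg_field (fun x hx => by rw [hYF x hx]) (-t)
          (by linarith) fun r hr => hCW ⟨-r, ⟨by linarith [hr.2, ht.1],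
            by linarith [hr.1, ht.1, ht.2]⟩, rfl⟩
        simpa using this
    rw [← this]
    exact hCW ⟨t, ht, rfl⟩
  -- Tube argument: the orbit segment of x₀ lies in the open set W, and joint continuity of θ
  -- together with compactness of [-T, T] keeps the segments of nearby points in W. There the two
  -- fields agree, and uniqueness identifies the flows.
  have hnhds : ∀ᶠ x in 𝓝 x₀, ∀ r ∈ Icc (-T) T, θ r x ∈ W := by
    refine isCompact_Icc.eventually_forall_of_forall_eventually fun r hr => ?_
    have := (hθ.continuous_uncurry hK).comp continuous_swap
    exact this.continuousAt.eventually_mem (hW.mem_nhds (h₀ r hr))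
  obtain ⟨O, hO, hOo, hxO⟩ := eventually_nhds_iff.1 hnhds
  exact ⟨Y, K, θ, hK, hθ, O ∩ X, hOo.inter hX, ⟨hxO, hx₀⟩, inter_subset_right,
    fun x hx => two x hx.2 (hO x hx.1)⟩

/-- `IsFlowOn` demands regularity in time only; continuity in the initial state is inherited from
the Lipschitz flows with which s agrees locally. -/
theorem IsFlowOn.continuousOn_uncurry {n : ℕ} {X : Set (State n)} (hX : IsOpen X)
    {F : State n → State n} (hF : ContDiffOn ℝ 1 F X) {s : ℝ → State n → State n}
    (hs : IsFlowOn F X s) : ContinuousOn (fun p : ℝ × State n => s p.1 p.2) (univ ×ˢ X) := by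
  rintro ⟨t, x⟩ ⟨-, hx⟩
  obtain ⟨Y, K, θ, hK, hθ, O, hO, hxO, -, hOs⟩ := hs.exists_local_flow hX hF hx (|t| + 1)
  refine ContinuousAt.continuousWithinAt ?_
  refine (hθ.continuous_uncurry hK).continuousAt.congr ?_
  have ht : Ioo (-(|t| + 1)) (|t| + 1) ∈ 𝓝 t :=
    Ioo_mem_nhds (by linarith [neg_abs_le t]) (by linarith [le_abs_self t])
  filter_upwards [prod_mem_nhds ht (hO.mem_nhds hxO)] with p hp
  exact (hOs p.2 hp.2 p.1 (Ioo_subset_Icc_self hp.1)).symm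

/-! ### Lipschitz maps and null sets -/

/-- Lebesgue measure has the same null sets as n-dimensional Hausdorff measure, which a Lipschitz
map increases by a bounded factor at most. -/
theorem LipschitzOnWith.volume_image_eq_zero {n : ℕ} {f : State n → State n} {K : ℝ≥0}
    {A : Set (State n)} (hf : LipschitzOnWith K f A) (hA : volume A = 0) :
    volume (f '' A) = 0 := by
  have h1 := hf.hausdorffMeasure_image_le (d := Module.finrank ℝ (State n)) (by positivity)
  have hv : (Measure.hausdorffMeasure (Module.finrank ℝ (State n)) : Measure (State n)) A = 0 :=
    Measure.absolutelyContinuous_isAddHaarMeasure _ volume hA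
  rw [hv, mul_zero, nonpos_iff_eq_zero] at h1
  exact Measure.absolutelyContinuous_isAddHaarMeasure volume _ h1

/-- The flow of a `C¹` field on an open set maps null sets to null sets. -/
theorem IsFlowOn.volume_image_eq_zero {n : ℕ} {X : Set (State n)} (hX : IsOpen X)
    {F : State n → State n} (hF : ContDiffOn ℝ 1 F X) {s : ℝ → State n → State n}
    (hs : IsFlowOn F X s) (t : ℝ) {A : Set (State n)} (hAX : A ⊆ X) (hA : volume A = 0) :
    volume (s t '' A) = 0 := by
  have hloc : ∀ x ∈ A, ∃ O, IsOpen O ∧ x ∈ O ∧ volume (s t '' (A ∩ O)) = 0 := by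
    intro x hx
    obtain ⟨Y, K, θ, hK, hθ, O, hO, hxO, -, hOs⟩ := hs.exists_local_flow hX hF (hAX hx) |t|
    refine ⟨O, hO, hxO, ?_⟩
    have : s t '' (A ∩ O) = θ t '' (A ∩ O) :=
      image_congr fun y hy => hOs y hy.2 t ⟨neg_abs_le t, le_abs_self t⟩
    rw [this]
    exact ((hθ.lipschitzWith hK t).lipschitzOnWith).volume_image_eq_zero
      (measure_mono_null inter_subset_left hA)
  choose! O hO hxO hnull using hloc
  obtain ⟨C, hCA, hC, hcov⟩ := TopologicalSpace.countable_cover_nhdsWithin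
    (fun x hx => mem_nhdsWithin_of_mem_nhds ((hO x hx).mem_nhds (hxO x hx)))
  have : s t '' A ⊆ ⋃ x ∈ C, s t '' (A ∩ O x) := by
    rintro _ ⟨y, hy, rfl⟩
    obtain ⟨x, hx, hyx⟩ := mem_iUnion₂.1 (hcov hy)
    exact mem_iUnion₂.2 ⟨x, hx, y, ⟨hy, hyx⟩, rfl⟩
  exact measure_mono_null this ((measure_biUnion_null_iff hC).2 fun x hx => hnull x (hCA hx))

/-- The preimage of a null set under the flow is a null set. -/
theorem IsFlowOn.volume_preimage_eq_zero {n : ℕ} {X : Set (State n)} (hX : IsOpen X)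
    {F : State n → State n} (hF : ContDiffOn ℝ 1 F X) {s : ℝ → State n → State n}
    (hs : IsFlowOn F X s) (t : ℝ) {A : Set (State n)} (hA : volume A = 0) :
    volume (X ∩ s t ⁻¹' A) = 0 := by
  refine measure_mono_null ?_ (hs.volume_image_eq_zero hX hF (-t) (A := A ∩ X) inter_subset_right
    (measure_mono_null inter_subset_left hA))
  rintro x ⟨hx, hxA⟩
  exact ⟨s t x, ⟨hxA, ((hs x hx).2 t).1⟩, hs.neg_apply_apply_mem hX hF t hx⟩

/-! ### Integration by parts -/

theorem divergence_congr {n : ℕ} {V V' : State n → State n} {x : State n}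
    (h : V =ᶠ[𝓝 x] V') : divergence V x = divergence V' x := by
  simp only [divergence, h.fderiv_eq]

/-- Φ is only assumed Lipschitz because it will be a time integral along a flow whose field is
Lipschitz but not C¹. Rademacher's theorem gives its derivative almost everywhere, and the formula
is the sum of the coordinatewise ones. -/
theorem integral_fderiv_apply_of_hasCompactSupport {n : ℕ} {G : State n → State n}
    (hG : ContDiff ℝ 1 G) (hGc : HasCompactSupport G) {Φ : State n → ℝ} {K : ℝ≥0}
    (hΦ : LipschitzWith K Φ) :
    Integrable (fun x => fderiv ℝ Φ x (G x)) ∧ Integrable (fun x => Φ x * divergence G x) ∧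
      ∫ x, fderiv ℝ Φ x (G x) = -∫ x, Φ x * divergence G x := by
  have hGi : ∀ i, ContDiff ℝ 1 fun x => G x i := fun i => (contDiff_euclidean.1 hG) i
  have hGic : ∀ i, HasCompactSupport fun x => G x i := fun i =>
    hGc.comp_left (g := fun v : State n => v i) rfl
  have h1 : (fun x => fderiv ℝ Φ x (G x)) =ᵐ[volume]
      fun x => ∑ i, lineDeriv ℝ Φ x (EuclideanSpace.single i 1) * G x i := by
    filter_upwards [hΦ.ae_differentiableAt] with x hx
    have : G x = ∑ i, G x i • EuclideanSpace.single i (1 : ℝ) := by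
      simpa using ((EuclideanSpace.basisFun (Fin n) ℝ).sum_repr (G x)).symm
    conv_lhs => rw [this]
    rw [map_sum]
    refine Finset.sum_congr rfl fun i _ => ?_
    rw [map_smul, hx.lineDeriv_eq_fderiv, smul_eq_mul, mul_comm]
  -- The two minus signs cancel; they produce the direction -eᵢ that appears in
  -- `integral_lineDeriv_mul_eq`.
  have h2 : ∀ x, Φ x * divergence G x =
      ∑ i, -(lineDeriv ℝ (fun y => G y i) x (-EuclideanSpace.single i 1) * Φ x) := by
    intro x
    rw [divergence, Finset.mul_sum]
    refine Finset.sum_congr rfl fun i _ => ?_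
    have hd : DifferentiableAt ℝ (fun y => G y i) x := (hGi i).differentiable one_ne_zero x
    have hp := (EuclideanSpace.proj (𝕜 := ℝ) i).hasFDerivAt.comp x
      (hG.differentiable one_ne_zero x).hasFDerivAt
    have hp' : fderiv ℝ (fun y => G y i) x =
        (EuclideanSpace.proj (𝕜 := ℝ) i).comp (fderiv ℝ G x) := hp.fderiv
    rw [hd.lineDeriv_eq_fderiv, hp', map_neg]
    simp [mul_comm]
  have i1 : ∀ i, Integrable fun x => lineDeriv ℝ Φ x (EuclideanSpace.single i 1) * G x i :=
    fun i => by
      simpa [mul_comm] using (hΦ.locallyIntegrable_lineDeriv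
        (EuclideanSpace.single i 1)).integrable_smul_left_of_hasCompactSupport
        (hGi i).continuous (hGic i)
  have i2 : ∀ i, Integrable fun x =>
      -(lineDeriv ℝ (fun y => G y i) x (-EuclideanSpace.single i 1) * Φ x) := fun i => by
    have hl : (fun x => lineDeriv ℝ (fun y => G y i) x (-EuclideanSpace.single i 1)) =
        fun x => fderiv ℝ (fun y => G y i) x (-EuclideanSpace.single i 1) :=
      funext fun x => ((hGi i).differentiable one_ne_zero x).lineDeriv_eq_fderiv
    have hc : Continuous fun x => lineDeriv ℝ (fun y => G y i) x (-EuclideanSpace.single i 1) := by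
      rw [hl]
      exact ((hGi i).continuous_fderiv one_ne_zero).clm_apply continuous_const
    have hcs : HasCompactSupport fun x =>
        lineDeriv ℝ (fun y => G y i) x (-EuclideanSpace.single i 1) := by
      rw [hl]
      exact (hGic i).fderiv_apply ℝ _
    exact ((hc.mul hΦ.continuous).integrable_of_hasCompactSupport hcs.mul_right).neg
  refine ⟨(integrable_congr h1).2 (integrable_finsetSum _ fun i _ => i1 i), ?_, ?_⟩
  · simp only [h2]
    exact integrable_finsetSum _ fun i _ => i2 i
  · rw [integral_congr_ae h1, integral_finsetSum _ fun i _ => i1 i]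
    simp only [h2]
    rw [integral_finsetSum _ fun i _ => i2 i, ← Finset.sum_neg_distrib]
    refine Finset.sum_congr rfl fun i _ => ?_
    obtain ⟨D, hD⟩ := (hGi i).lipschitzWith_of_hasCompactSupport (hGic i) one_ne_zero
    rw [hΦ.integral_lineDeriv_mul_eq hD (hGic i), integral_neg, neg_neg]

/-- Integration by parts on an open set, for a `C¹` field and a compactly supported Lipschitz
function. -/
theorem integral_fderiv_apply_eq_neg {n : ℕ} {U : Set (State n)} (hU : IsOpen U)
    {V : State n → State n} (hV : ContDiffOn ℝ 1 V U) {Φ : State n → ℝ} {K : ℝ≥0}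
    (hΦ : LipschitzWith K Φ) (hΦc : HasCompactSupport Φ) (hΦU : tsupport Φ ⊆ U) :
    Integrable (fun x => fderiv ℝ Φ x (V x)) ∧ Integrable (fun x => Φ x * divergence V x) ∧
      ∫ x, fderiv ℝ Φ x (V x) = -∫ x, Φ x * divergence V x := by
  -- A cutoff equal to 1 near the support of Φ makes the field global and changes neither integrand.
  obtain ⟨η, hη, hηc, hηU, -, W, hW, hCW, hW1⟩ := exists_contDiff_cutoff hU hΦc hΦU
  have key := integral_fderiv_apply_of_hasCompactSupport
    (contDiff_smul_of_tsupport_subset hU hη hηU hV) hηc.smul_right hΦ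
  have e1 : (fun x => fderiv ℝ Φ x (η x • V x)) = fun x => fderiv ℝ Φ x (V x) := by
    funext x
    by_cases hx : x ∈ tsupport Φ
    · rw [hW1 x (hCW hx), one_smul]
    · have : fderiv ℝ Φ x = 0 := by
        by_contra h
        exact hx (tsupport_fderiv_subset ℝ (subset_closure h))
      simp [this]
  have e2 : (fun x => Φ x * divergence (fun x => η x • V x) x) =
      fun x => Φ x * divergence V x := by
    funext x
    by_cases hx : x ∈ tsupport Φ
    · congr 1
      refine divergence_congr ?_
      filter_upwards [hW.mem_nhds (hCW hx)] with y hy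
      rw [hW1 y hy, one_smul]
    · rw [image_eq_zero_of_notMem_tsupport hx, zero_mul, zero_mul]
  rwa [e1, e2] at key

theorem continuousOn_divergence {n : ℕ} {U : Set (State n)} (hU : IsOpen U)
    {V : State n → State n} (hV : ContDiffOn ℝ 1 V U) : ContinuousOn (divergence V) U := by
  have h := hV.continuousOn_fderiv_of_isOpen hU le_rfl
  unfold divergence
  refine continuousOn_finsetSum _ fun i _ => ?_
  have := h.clm_apply (continuousOn_const (c := EuclideanSpace.single i (1 : ℝ)))
  exact (EuclideanSpace.proj (𝕜 := ℝ) i).continuous.comp_continuousOn this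

/-! ### Change of time -/

/-- A `C¹` field on an open set, multiplied by a suitable positive function that vanishes outside
of the set, is bounded and Lipschitz on the whole space. -/
theorem exists_lipschitz_time_change {n : ℕ} {U : Set (State n)} (hU : IsOpen U)
    {V : State n → State n} (hV : ContDiffOn ℝ 1 V U) :
    ∃ χ : State n → ℝ, Continuous χ ∧ (∀ x ∈ U, 0 < χ x) ∧ (∀ x ∉ U, χ x = 0) ∧
      ∃ K M : ℝ≥0, LipschitzWith K (fun x => χ x • V x) ∧ ∀ x, ‖χ x • V x‖ ≤ M := by
  rcases U.eq_empty_or_nonempty with rfl | hne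
  · exact ⟨0, continuous_const, by simp, by simp, 0, 0, by simp,
      by simp⟩
  have hloc : ∀ x ∈ U, ∃ φ : State n → ℝ, ContDiff ℝ 1 φ ∧ HasCompactSupport φ ∧
      tsupport φ ⊆ U ∧ (∀ x, 0 ≤ φ x ∧ φ x ≤ 1) ∧ ∃ W, IsOpen W ∧ x ∈ W ∧ ∀ x ∈ W, φ x = 1 := by
    intro x hx
    simpa using exists_contDiff_cutoff hU (isCompact_singleton (x := x)) (by simpa using hx)
  choose! φ hφ hφc hφU hφ01 W hW hxW hW1 using hloc
  obtain ⟨C, hCU, hC, hcov⟩ := TopologicalSpace.countable_cover_nhdsWithin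
    (fun x hx => mem_nhdsWithin_of_mem_nhds ((hW x hx).mem_nhds (hxW x hx)))
  have hCne : C.Nonempty := by
    obtain ⟨y, hy⟩ := hne
    obtain ⟨x, hx, -⟩ := mem_iUnion₂.1 (hcov hy)
    exact ⟨x, hx⟩
  obtain ⟨p, rfl⟩ := hC.exists_eq_range hCne
  have hp : ∀ i, p i ∈ U := fun i => hCU ⟨i, rfl⟩
  choose K M hK hM using fun i => exists_lipschitz_bound_smul hU (hφ _ (hp i)) (hφc _ (hp i))
    (hφU _ (hp i)) hV
  -- The weight of the i-th cutoff is 2^{-i-1} / (1 + Kᵢ + Mᵢ). It controls at once the size of the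
  -- cutoff (at most 1), the Lipschitz constant Kᵢ and the bound Mᵢ, each by a geometric series of
  -- sum 1; hence the final constants 1 and 1.
  set c : ℕ → ℝ := fun i => 1 / 2 / 2 ^ i / (1 + K i + M i) with hc
  have hd : ∀ i, (1 : ℝ) ≤ 1 + K i + M i := fun i => by
    linarith [(K i).coe_nonneg, (M i).coe_nonneg]
  have hd0 : ∀ i, (0 : ℝ) < 1 + K i + M i := fun i => one_pos.trans_le (hd i)
  have hc0 : ∀ i, 0 < c i := fun i => div_pos (by positivity) (hd0 i)
  have hcb : ∀ i (r : ℝ), r ≤ 1 + K i + M i → c i * r ≤ 1 / 2 / 2 ^ i := fun i r hr => by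
    rw [hc, div_mul_eq_mul_div, div_le_iff₀ (hd0 i)]
    gcongr
  have hsum : HasSum (fun i : ℕ => (1 : ℝ) / 2 / 2 ^ i) 1 := hasSum_geometric_two' 1
  have hcφ : ∀ i x, ‖c i * φ (p i) x‖ ≤ 1 / 2 / 2 ^ i := fun i x => by
    rw [Real.norm_of_nonneg (mul_nonneg (hc0 i).le (hφ01 _ (hp i) x).1)]
    exact hcb i _ ((hφ01 _ (hp i) x).2.trans (hd i))
  have hsφ : ∀ x, Summable fun i => c i * φ (p i) x := fun x =>
    Summable.of_norm_bounded hsum.summable (hcφ · x)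
  have hVb : ∀ i x, ‖c i • (φ (p i) x • V x)‖ ≤ 1 / 2 / 2 ^ i := fun i x => by
    rw [norm_smul, Real.norm_of_nonneg (hc0 i).le]
    exact hcb i _ ((hM i x).trans (by linarith [(K i).coe_nonneg]))
  have hsV : ∀ x, Summable fun i => c i • (φ (p i) x • V x) := fun x =>
    Summable.of_norm_bounded hsum.summable (hVb · x)
  have heq : ∀ x, (∑' i, c i * φ (p i) x) • V x = ∑' i, c i • (φ (p i) x • V x) := fun x => by
    rw [← Summable.tsum_smul_const (hsφ x)]
    simp only [mul_smul]
  refine ⟨fun x => ∑' i, c i * φ (p i) x, ?_, ?_, ?_, 1, 1, ?_, ?_⟩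
  · exact continuous_tsum (fun i => continuous_const.mul (hφ _ (hp i)).continuous)
      hsum.summable hcφ
  · intro x hx
    obtain ⟨_, ⟨i, rfl⟩, hi⟩ := mem_iUnion₂.1 (hcov hx)
    exact (hsφ x).tsum_pos (fun j => mul_nonneg (hc0 j).le (hφ01 _ (hp j) x).1) i
      (by rw [hW1 _ (hp i) x hi, mul_one]; exact hc0 i)
  · intro x hx
    have : ∀ i, φ (p i) x = 0 := fun i =>
      image_eq_zero_of_notMem_tsupport fun h => hx (hφU _ (hp i) h)
    simp [this]
  · refine LipschitzWith.of_dist_le_mul fun x y => ?_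
    simp only [heq]
    rw [dist_eq_norm, ← (hsV x).tsum_sub (hsV y), NNReal.coe_one]
    refine tsum_of_norm_bounded (hsum.mul_right (dist x y)) fun i => ?_
    rw [← smul_sub, norm_smul, Real.norm_of_nonneg (hc0 i).le, ← dist_eq_norm]
    calc c i * dist (φ (p i) x • V x) (φ (p i) y • V y) ≤ c i * (K i * dist x y) := by
          gcongr
          exact (hK i).dist_le_mul x y
      _ = c i * K i * dist x y := by ring
      _ ≤ 1 / 2 / 2 ^ i * dist x y := by
          gcongr
          exact hcb i _ (by linarith [(M i).coe_nonneg])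
  · intro x
    rw [heq]
    exact tsum_of_norm_bounded hsum (hVb · x)

/-! ### Measure theory of flows on open sets -/

open Classical in
/-- A flow on `X`, extended by the identity. -/
noncomputable def extendFlow {n : ℕ} (X : Set (State n)) (s : ℝ → State n → State n) (t : ℝ)
    (x : State n) : State n := if x ∈ X then s t x else x

theorem extendFlow_of_mem {n : ℕ} {X : Set (State n)} {s : ℝ → State n → State n} (t : ℝ)
    {x : State n} (hx : x ∈ X) : extendFlow X s t x = s t x := if_pos hx

section

variable {n : ℕ} {X : Set (State n)} {F : State n → State n} {s : ℝ → State n → State n}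

theorem IsFlowOn.measurable_extendFlow (hX : IsOpen X) (hF : ContDiffOn ℝ 1 F X)
    (hs : IsFlowOn F X s) : Measurable fun p : ℝ × State n => extendFlow X s p.1 p.2 := by
  classical
  have h := ContinuousOn.measurable_piecewise (hs.continuousOn_uncurry hX hF)
    (continuous_snd.continuousOn (s := (univ ×ˢ X)ᶜ)) (isOpen_univ.prod hX).measurableSet
  convert h using 1
  funext p
  simp [extendFlow, Set.piecewise]

theorem IsFlowOn.quasiMeasurePreserving (hX : IsOpen X) (hF : ContDiffOn ℝ 1 F X)
    (hs : IsFlowOn F X s) (t : ℝ) : Measure.QuasiMeasurePreserving (extendFlow X s t)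
      (volume.restrict X) (volume.restrict X) := by
  have hm : Measurable (extendFlow X s t) :=
    (hs.measurable_extendFlow hX hF).comp measurable_prodMk_left
  refine ⟨hm, Measure.AbsolutelyContinuous.mk fun A hA hA0 => ?_⟩
  rw [Measure.restrict_apply hA] at hA0
  rw [Measure.map_apply hm hA, Measure.restrict_apply (hm hA)]
  refine measure_mono_null ?_ (hs.volume_preimage_eq_zero hX hF t hA0)
  rintro x ⟨hxA, hx⟩
  rw [mem_preimage, extendFlow_of_mem t hx] at hxA
  exact ⟨hx, hxA, ((hs x hx).2 t).1⟩

theorem IsFlowOn.quasiMeasurePreserving_uncurry (hX : IsOpen X) (hF : ContDiffOn ℝ 1 F X)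
    (hs : IsFlowOn F X s) (ν : Measure ℝ) [SFinite ν] :
    Measure.QuasiMeasurePreserving (fun p : ℝ × State n => extendFlow X s p.1 p.2)
      (ν.prod (volume.restrict X)) (volume.restrict X) := by
  have hm := hs.measurable_extendFlow hX hF
  refine ⟨hm, Measure.AbsolutelyContinuous.mk fun A hA hA0 => ?_⟩
  rw [Measure.map_apply hm hA, Measure.measure_prod_null (hm hA)]
  exact Eventually.of_forall fun t => (hs.quasiMeasurePreserving hX hF t).preimage_null hA0

/-- If, at almost every time, almost no point of `S` is mapped into `A`, then this holds at every
time. -/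
theorem IsFlowOn.ae_notMem_of_ae_ae_notMem (hX : IsOpen X) (hF : ContDiffOn ℝ 1 F X)
    (hs : IsFlowOn F X s) {S A : Set (State n)} (hS : MeasurableSet S) (hA : MeasurableSet A)
    (h : ∀ᵐ t ∂(volume.restrict (Ici (0 : ℝ))), ∀ᵐ x ∂(volume.restrict X),
      x ∈ S → extendFlow X s t x ∉ A) {T : ℝ} (hT : 0 ≤ T) :
    ∀ᵐ x ∂(volume.restrict X), x ∈ S → extendFlow X s T x ∉ A := by
  set e := extendFlow X s with he
  have hm : Measurable fun p : ℝ × State n => e p.1 p.2 := hs.measurable_extendFlow hX hF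
  have hmt : ∀ t, Measurable (e t) := fun t => hm.comp measurable_prodMk_left
  have hq : ∀ t, Measure.QuasiMeasurePreserving (e t) (volume.restrict X) (volume.restrict X) :=
    fun t => hs.quasiMeasurePreserving hX hF t
  have hadd : ∀ r t, ∀ x ∈ X, e (r + t) x = e r (e t x) := fun r t x hx => by
    rw [he, extendFlow_of_mem _ hx, extendFlow_of_mem _ hx,
      extendFlow_of_mem _ ((hs x hx).2 t).1, hs.add_apply_mem hX hF _ _ hx]
  have hzero : ∀ x ∈ X, e 0 x = x := fun x hx => by rw [he, extendFlow_of_mem _ hx, (hs x hx).1]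
  have hXe : ∀ᵐ x ∂(volume.restrict X), x ∈ X := ae_restrict_mem hX.measurableSet
  -- B consists of the points of S that are in A at time T; it has to be null. The idea is that
  -- orbits can hardly return to B.
  set B : Set (State n) := S ∩ e T ⁻¹' A with hB
  have hBm : MeasurableSet B := hS.inter (hmt T hA)
  -- A point of B ⊆ S that is in B again at time t is in A at time T + t ≥ 0, which the hypothesis
  -- excludes almost everywhere.
  have hpos : ∀ᵐ t ∂(volume : Measure ℝ), 0 ≤ t → ∀ᵐ x ∂(volume.restrict X),
      x ∈ B → e t x ∉ B := by
    rw [ae_restrict_iff' measurableSet_Ici] at h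
    have h' : ∀ᵐ t ∂(volume : Measure ℝ), T + t ∈ Ici (0 : ℝ) → ∀ᵐ x ∂(volume.restrict X),
        x ∈ S → e (T + t) x ∉ A := (quasiMeasurePreserving_add_left volume T).ae h
    filter_upwards [h'] with t ht ht0
    filter_upwards [ht (add_nonneg hT ht0), hXe] with x hx hxX hxB hxB'
    refine hx hxB.1 ?_
    rw [hadd _ _ _ hxX]
    exact hxB'.2
  -- A return from B to B after a negative time t is, seen from the other end, a return after -t;
  -- the flow preserves null sets, so this is excluded too.
  have hall : ∀ᵐ t ∂(volume : Measure ℝ), ∀ᵐ x ∂(volume.restrict X), x ∈ B → e t x ∉ B := by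
    have hneg : ∀ᵐ t ∂(volume : Measure ℝ), 0 ≤ -t → ∀ᵐ x ∂(volume.restrict X),
      x ∈ B → e (-t) x ∉ B := (quasiMeasurePreserving_neg volume).ae hpos
    filter_upwards [hpos, hneg] with t h1 h2
    rcases le_total 0 t with ht | ht
    · exact h1 ht
    · filter_upwards [(hq t).ae (h2 (by linarith)), hXe] with x hx hxX hxB hxB'
      refine hx hxB' ?_
      rwa [← hadd _ _ _ hxX, neg_add_cancel, hzero _ hxX]
  have hBswap : ∀ᵐ x ∂(volume.restrict X), ∀ᵐ t ∂(volume : Measure ℝ), x ∈ B → e t x ∉ B := by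
    refine (Measure.ae_ae_comm ?_).1 hall
    exact ((measurable_snd hBm).compl.union (hm hBm).compl).congr (by
      ext p
      simp only [mem_union, mem_compl_iff, mem_preimage, mem_ofPred_eq]
      tauto)
  obtain ⟨N, hN0, hNm, hN⟩ : ∃ N, (volume.restrict X) N = 0 ∧ MeasurableSet N ∧
      ∀ x ∉ N, ∀ᵐ t ∂(volume : Measure ℝ), x ∈ B → e t x ∉ B := by
    refine ⟨toMeasurable (volume.restrict X) {x | ¬ ∀ᵐ t ∂(volume : Measure ℝ), x ∈ B → e t x ∉ B}, ?_,
      measurableSet_toMeasurable _ _, fun x hx => ?_⟩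
    · rw [measure_toMeasurable]
      exact hBswap
    · by_contra hc
      exact hx (subset_toMeasurable _ _ hc)
  have hNswap : ∀ᵐ x ∂(volume.restrict X), ∀ᵐ t ∂(volume : Measure ℝ), e t x ∉ N := by
    refine (Measure.ae_ae_comm (hm hNm).compl).1 (Eventually.of_forall fun t => ?_)
    exact (hq t).ae (p := fun x => x ∉ N) (measure_eq_zero_iff_ae_notMem.1 hN0)
  -- Almost every orbit spends zero time in B: if it visits B at a point outside N, that point
  -- almost never returns; otherwise all its visits to B take place in the null set N.
  have hBall : ∀ᵐ x ∂(volume.restrict X), ∀ᵐ t ∂(volume : Measure ℝ), e t x ∉ B := by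
    filter_upwards [hNswap, hXe] with x hx hxX
    by_cases hex : ∃ t₀, e t₀ x ∈ B ∧ e t₀ x ∉ N
    · obtain ⟨t₀, hB₀, hN₀⟩ := hex
      have h1 : ∀ᵐ t ∂(volume : Measure ℝ), e t (e t₀ x) ∉ B := by
        filter_upwards [hN _ hN₀] with t ht using ht hB₀
      have h2 := (quasiMeasurePreserving_add_right volume (-t₀)).ae h1
      filter_upwards [h2] with t ht
      rwa [← hadd _ _ _ hxX, neg_add_cancel_right] at ht
    · push Not at hex
      filter_upwards [hx] with t ht hB'
      exact ht (hex t hB')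
  -- By Fubini there is one time t at which almost no point is in B; transporting this back by -t
  -- shows that B is null.
  obtain ⟨t, ht⟩ := ((Measure.ae_ae_comm (hm hBm).compl).2 hBall).exists
  have := (hq (-t)).ae ht
  filter_upwards [this, hXe] with x hx hxX hxS hxA
  refine hx ?_
  rw [← hadd _ _ _ hxX, add_neg_cancel, hzero _ hxX]
  exact ⟨hxS, hxA⟩

/-- Rademacher's theorem for the local Lipschitz flows. Differentiability almost everywhere is
enough for the change of variables. -/
theorem IsFlowOn.volume_not_differentiableAt (hX : IsOpen X) (hF : ContDiffOn ℝ 1 F X)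
    (hs : IsFlowOn F X s) (t : ℝ) :
    volume (X ∩ {x | ¬ DifferentiableAt ℝ (s t) x}) = 0 := by
  refine measure_null_of_locally_null _ fun x hx => ?_
  obtain ⟨Y, K, θ, hK, hθ, O, hO, hxO, -, hOs⟩ := hs.exists_local_flow hX hF hx.1 |t|
  refine ⟨_, inter_mem_nhdsWithin _ (hO.mem_nhds hxO), ?_⟩
  refine measure_mono_null ?_ (hθ.lipschitzWith hK t).ae_differentiableAt
  rintro y ⟨⟨-, hy⟩, hyO⟩ hd
  refine hy (hd.congr_of_eventuallyEq ?_)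
  filter_upwards [hO.mem_nhds hyO] with z hz using hOs z hz t ⟨neg_abs_le t, le_abs_self t⟩

/-- Change of variables along a flow. -/
theorem IsFlowOn.lintegral_comp_mul (hX : IsOpen X) (hF : ContDiffOn ℝ 1 F X)
    (hs : IsFlowOn F X s) (t : ℝ) (G : State n → ℝ≥0∞) (h : State n → ℝ) :
    ∫⁻ x in X, ENNReal.ofReal (h x) * G (s t x) =
      ∫⁻ y in X, G y * ENNReal.ofReal (perronFrobenius s t h y) := by
  set D : Set (State n) := X ∩ {x | DifferentiableAt ℝ (s (-t)) x} with hD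
  have hDm : MeasurableSet D :=
    hX.measurableSet.inter (measurableSet_of_differentiableAt ℝ (s (-t)))
  have hdiff : (X \ D : Set (State n)) = X ∩ {x | ¬ DifferentiableAt ℝ (s (-t)) x} := by
    ext x
    simp only [hD, Set.mem_sdiff, mem_inter_iff, mem_ofPred_eq]
    tauto
  have hnull : volume (X \ D) = 0 := hdiff ▸ hs.volume_not_differentiableAt hX hF (-t)
  have hinv : ∀ y ∈ X, s t (s (-t) y) = y := fun y hy => by
    simpa using hs.neg_apply_apply_mem hX hF (-t) hy
  have hDX : (D : Set (State n)) =ᵐ[volume] X :=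
    LE.le.eventuallyLE inter_subset_left |>.antisymm (ae_le_set.2 hnull)
  -- What the image misses is contained in the image of the null set X \ D, and flows map null sets
  -- to null sets. Both sides may therefore be restricted to D and its image, where the area formula
  -- applies.
  have himg : (s (-t) '' D : Set (State n)) =ᵐ[volume] X := by
    refine (LE.le.eventuallyLE ?_).antisymm (ae_le_set.2 ?_)
    · rintro _ ⟨y, hy, rfl⟩
      exact ((hs y hy.1).2 _).1
    · refine measure_mono_null ?_ (hs.volume_image_eq_zero hX hF (-t) sdiff_subset hnull)
      rintro x ⟨hx, hxD⟩
      refine ⟨s t x, ⟨((hs x hx).2 t).1, fun hc => hxD ?_⟩, hs.neg_apply_apply_mem hX hF t hx⟩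
      exact ⟨s t x, hc, hs.neg_apply_apply_mem hX hF t hx⟩
  rw [← setLIntegral_congr himg, ← setLIntegral_congr hDX,
    lintegral_image_eq_lintegral_abs_det_fderiv_mul volume hDm
      (fun x hx => hx.2.hasFDerivAt.hasFDerivWithinAt)
      (fun x hx y hy hxy => by rw [← hinv x hx.1, hxy, hinv y hy.1])]
  refine setLIntegral_congr_fun hDm fun y hy => ?_
  simp only [perronFrobenius]
  rw [hinv y hy.1, ENNReal.ofReal_mul' (abs_nonneg _)]
  ring

/-- Joint measurability in time and space, needed for Tonelli. It is local, and locally s may be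
replaced by a jointly continuous flow, for which the derivative in the space variable is jointly
measurable. -/
theorem IsFlowOn.aemeasurable_det_fderiv (hX : IsOpen X) (hF : ContDiffOn ℝ 1 F X)
    (hs : IsFlowOn F X s) : AEMeasurable (fun p : ℝ × State n => (fderiv ℝ (s p.1) p.2).det)
      (((volume : Measure ℝ).prod volume).restrict (univ ×ˢ X)) := by
  have hloc : ∀ p ∈ (univ ×ˢ X : Set (ℝ × State n)), ∃ O, IsOpen O ∧ p ∈ O ∧
      AEMeasurable (fun p : ℝ × State n => (fderiv ℝ (s p.1) p.2).det)
        (((volume : Measure ℝ).prod volume).restrict O) := by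
    rintro ⟨t, x⟩ ⟨-, hx⟩
    obtain ⟨Y, K, θ, hK, hθ, O, hO, hxO, -, hOs⟩ := hs.exists_local_flow hX hF hx (|t| + 1)
    have ht : t ∈ Ioo (-(|t| + 1)) (|t| + 1) :=
      ⟨by linarith [neg_abs_le t], by linarith [le_abs_self t]⟩
    refine ⟨Ioo (-(|t| + 1)) (|t| + 1) ×ˢ O, isOpen_Ioo.prod hO, ⟨ht, hxO⟩, ?_⟩
    have hmeas : Measurable fun p : ℝ × State n => (fderiv ℝ (θ p.1) p.2).det :=
      ContinuousLinearMap.continuous_det.measurable.comp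
        (measurable_fderiv_with_param ℝ (hθ.continuous_uncurry hK))
    refine hmeas.aemeasurable.congr ?_
    filter_upwards [ae_restrict_mem (isOpen_Ioo.prod hO).measurableSet] with p hp
    have : s p.1 =ᶠ[𝓝 p.2] θ p.1 := by
      filter_upwards [hO.mem_nhds hp.2] with z hz using hOs z hz _ (Ioo_subset_Icc_self hp.1)
    rw [this.fderiv_eq]
  choose! O hO hpO hOm using hloc
  obtain ⟨C, hCX, hC, hcov⟩ := TopologicalSpace.countable_cover_nhdsWithin
    (fun p hp => mem_nhdsWithin_of_mem_nhds ((hO p hp).mem_nhds (hpO p hp)))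
  have : Countable C := hC.to_subtype
  have h1 := aemeasurable_iUnion_iff.2 fun p : C => hOm p (hCX p.2)
  rw [← biUnion_eq_iUnion C (fun p _ => O p)] at h1
  exact h1.mono_measure (Measure.restrict_mono hcov le_rfl)

end

/-! ### Occupation integrals of the initial measure -/

namespace NavData

variable {n m : ℕ} {P : NavData n m} {F : State n → State n} {s : ℝ → State n → State n}

theorem aemeasurable_h0 (hh0i : IntegrableOn P.h0 P.X) :
    AEMeasurable (fun x => ENNReal.ofReal (P.h0 x)) (volume.restrict P.X) :=
  hh0i.aestronglyMeasurable.aemeasurable.ennreal_ofReal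

theorem isFiniteMeasure_μ0 (hh0i : IntegrableOn P.h0 P.X) : IsFiniteMeasure P.μ0 :=
  isFiniteMeasure_withDensity_ofReal hh0i.2

theorem μ0_absolutelyContinuous : P.μ0 ≪ volume.restrict P.X :=
  withDensity_absolutelyContinuous _ _

theorem ae_mem_X (hX : IsOpen P.X) : ∀ᵐ ξ ∂P.μ0, ξ ∈ P.X :=
  μ0_absolutelyContinuous.ae_le (ae_restrict_mem hX.measurableSet)

theorem lintegral_μ0 (hh0i : IntegrableOn P.h0 P.X) (G : State n → ℝ≥0∞) :
    ∫⁻ ξ, G ξ ∂P.μ0 = ∫⁻ x in P.X, ENNReal.ofReal (P.h0 x) * G x :=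
  lintegral_withDensity_eq_lintegral_mul_non_measurable₀ _ (aemeasurable_h0 hh0i)
    (Eventually.of_forall fun _ => ENNReal.ofReal_lt_top) G

/-- S is a measurable version of {h₀ > 0}. The flow preserves Lebesgue null sets but not μ₀-null
sets, so statements about μ₀ are rephrased with Lebesgue measure. -/
theorem exists_ae_μ0_iff (hh0i : IntegrableOn P.h0 P.X) :
    ∃ S : Set (State n), MeasurableSet S ∧ ∀ p : State n → Prop,
      (∀ᵐ ξ ∂P.μ0, p ξ) ↔ ∀ᵐ x ∂(volume.restrict P.X), x ∈ S → p x := by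
  have hm := aemeasurable_h0 hh0i
  refine ⟨{x | hm.mk _ x ≠ 0}, (hm.measurable_mk (measurableSet_singleton 0)).compl, fun p => ?_⟩
  rw [μ0, ae_withDensity_iff' hm]
  refine eventually_congr ?_
  filter_upwards [hm.ae_eq_mk] with x hx
  rw [hx]

/-- The time integral along trajectories of a function of the state is its integral against the
time integral of the Perron-Frobenius operator. -/
theorem lintegral_occupation (hX : IsOpen P.X) (hh0i : IntegrableOn P.h0 P.X)
    (hF : ContDiffOn ℝ 1 F P.X) (hs : IsFlowOn F P.X s) {G : State n → ℝ≥0∞}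
    (hG : Measurable G) (hG' : ∀ y, G y ≠ ⊤) :
    ∫⁻ ξ, (∫⁻ t in Ici (0 : ℝ), G (s t ξ)) ∂P.μ0 =
      ∫⁻ y in P.X, G y * ∫⁻ t in Ici (0 : ℝ), ENNReal.ofReal (perronFrobenius s t P.h0 y) := by
  have := isFiniteMeasure_μ0 hh0i
  have hXe := ae_restrict_mem (μ := volume) hX.measurableSet
  calc ∫⁻ ξ, (∫⁻ t in Ici (0 : ℝ), G (s t ξ)) ∂P.μ0
      -- Nothing is known about s outside X; the extension by the identity is jointly measurable, as
      -- Tonelli requires.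
      = ∫⁻ ξ, (∫⁻ t in Ici (0 : ℝ), G (extendFlow P.X s t ξ)) ∂P.μ0 := by
        refine lintegral_congr_ae ?_
        filter_upwards [ae_mem_X hX] with ξ hξ
        simp only [extendFlow_of_mem _ hξ]
    _ = ∫⁻ t in Ici (0 : ℝ), (∫⁻ ξ, G (extendFlow P.X s t ξ) ∂P.μ0) :=
        lintegral_lintegral_swap ((hG.comp (hs.measurable_extendFlow hX hF)).comp
          measurable_swap).aemeasurable
    _ = ∫⁻ t in Ici (0 : ℝ), (∫⁻ y in P.X, G y * ENNReal.ofReal (perronFrobenius s t P.h0 y)) := by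
        refine lintegral_congr fun t => ?_
        rw [lintegral_μ0 hh0i, ← hs.lintegral_comp_mul hX hF]
        refine lintegral_congr_ae ?_
        filter_upwards [hXe] with ξ hξ
        rw [extendFlow_of_mem _ hξ]
    _ = ∫⁻ y in P.X, ∫⁻ t in Ici (0 : ℝ), G y * ENNReal.ofReal (perronFrobenius s t P.h0 y) := by
        refine lintegral_lintegral_swap ?_
        have hh := hh0i.aestronglyMeasurable.aemeasurable.comp_quasiMeasurePreserving
          (hs.reverse.quasiMeasurePreserving_uncurry hX hF.neg (volume.restrict (Ici 0)))
        have hdet := hs.reverse.aemeasurable_det_fderiv hX hF.neg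
        have hdet' := hdet.mono_measure (Measure.restrict_mono
          (prod_mono_left (subset_univ (Ici (0 : ℝ)))) le_rfl)
        rw [← Measure.prod_restrict] at hdet'
        refine (hG.comp measurable_snd).aemeasurable.mul (AEMeasurable.ennreal_ofReal ?_)
        refine (hh.mul hdet'.abs).congr ?_
        have h2 : ∀ᵐ p : ℝ × State n ∂((volume.restrict (Ici 0)).prod (volume.restrict P.X)),
            p.2 ∈ P.X := Measure.quasiMeasurePreserving_snd.ae hXe
        filter_upwards [h2] with p hp
        simp [perronFrobenius, extendFlow_of_mem _ hp]
    _ = ∫⁻ y in P.X, G y *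
          ∫⁻ t in Ici (0 : ℝ), ENNReal.ofReal (perronFrobenius s t P.h0 y) := by
        simp only [lintegral_const_mul' _ _ (hG' _)]

end NavData

/-! ### Regular feedbacks: costs, finite time in X₁, stability -/

namespace NavData

/-- The standing assumptions on the data. -/
structure Standing {n m : ℕ} (P : NavData n m) : Prop where
  isOpen_X : IsOpen P.X
  measurableSet_Xu : MeasurableSet P.Xu
  disjoint : Disjoint P.Xu P.nbhd
  contDiffOn_f : ContDiffOn ℝ 1 P.f P.X
  contDiffOn_g : ∀ j, ContDiffOn ℝ 1 (P.g j) P.X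
  measurable_b : Measurable P.b
  b_nonneg : ∀ x ∈ P.X, 0 ≤ P.b x
  h0_nonneg : ∀ x ∈ P.X, 0 ≤ P.h0 x
  integrableOn_h0 : IntegrableOn P.h0 P.X
  α_pos : 0 < P.α
  β_pos : 0 < P.β

/-- Regular feedbacks, with the `C¹` representative of their occupation density. -/
structure IsRegular {n m : ℕ} (P : NavData n m) (k : State n → Fin m → ℝ)
    (s : ℝ → State n → State n) (ρ : State n → ℝ) : Prop where
  isFeedback : P.IsFeedback k s
  locallyStable : P.LocallyStable k s
  cost_ne_top : P.cost s (fun t ξ => k (s t ξ)) ≠ ⊤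
  time : (∃ c > 0, ∀ x ∈ P.X1, c ≤ P.b x) ∨ P.meanTime s ≠ ⊤
  density : P.IsOccupationDensity s ρ
  nonneg : ∀ x ∈ P.X1, 0 ≤ ρ x
  contDiffOn : ContDiffOn ℝ 1 ρ P.X1

variable {n m : ℕ} {P : NavData n m} {k : State n → Fin m → ℝ} {s : ℝ → State n → State n}
  {ρ : State n → ℝ}

theorem X1_eq : P.X1 = P.X ∩ (Metric.cthickening P.ε P.XT)ᶜ := by
  ext x
  simp only [X1, nbhd, Set.mem_sdiff, mem_inter_iff, mem_compl_iff]
  tauto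

theorem X1_subset : P.X1 ⊆ P.X := sdiff_subset

theorem mem_X1_or_nbhd {x : State n} (hx : x ∈ P.X) : x ∈ P.X1 ∨ x ∈ P.nbhd := by
  by_cases h : x ∈ P.nbhd
  exacts [Or.inr h, Or.inl ⟨hx, h⟩]

theorem notMem_X1_of_nbhd {x : State n} (hx : x ∈ P.nbhd) : x ∉ P.X1 := fun h => h.2 hx

namespace Standing

theorem isOpen_X1 (hP : P.Standing) : IsOpen P.X1 := by
  rw [X1_eq]
  exact hP.isOpen_X.inter Metric.isClosed_cthickening.isOpen_compl

theorem contDiffOn_field (hP : P.Standing) {U : Set (State n)} (hU : U ⊆ P.X)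
    (hk : ContDiffOn ℝ 1 k U) : ContDiffOn ℝ 1 (fun x => P.field x (k x)) U :=
  (hP.contDiffOn_f.mono hU).add (ContDiffOn.sum fun j _ =>
    (contDiffOn_pi.1 hk j).smul ((hP.contDiffOn_g j).mono hU))

end Standing

theorem measurable_indicator_of_continuousOn {U : Set (State n)} (hU : MeasurableSet U)
    {G : Type*} [TopologicalSpace G] [MeasurableSpace G] [BorelSpace G] [Zero G]
    {f : State n → G} (hf : ContinuousOn f U) : Measurable (U.indicator f) := by
  classical
  rw [← piecewise_eq_indicator]
  exact hf.measurable_piecewise continuousOn_const hU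

theorem measurable_indicator_runningCost (hP : P.Standing) {u : State n → Fin m → ℝ}
    {U : Set (State n)} (hU : MeasurableSet U) (hu : ∀ j, Measurable (U.indicator fun x => u x j)) :
    Measurable (U.indicator fun y => ENNReal.ofReal (P.runningCost y (u y))) := by
  have h1 : Measurable fun y => ENNReal.ofReal (P.runningCost y
      fun j => U.indicator (fun x => u x j) y) := by
    unfold runningCost
    refine ((hP.measurable_b.const_mul _).add ((hP.measurable_b.const_mul _).mul ?_)).ennreal_ofReal
    exact Finset.measurable_sum _ fun j _ => (hu j).abs
  convert h1.indicator hU using 1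
  funext y
  by_cases hy : y ∈ U <;> simp [hy]

namespace IsRegular

theorem isFlowOn (hr : P.IsRegular k s ρ) : IsFlowOn (fun x => P.field x (k x)) P.X s :=
  hr.isFeedback.2

/-- The occupation density represents time integrals along trajectories. -/
theorem lintegral_indicator_X1 (hr : P.IsRegular k s ρ) (hP : P.Standing) {G : State n → ℝ≥0∞}
    (hG : Measurable (P.X1.indicator G)) (hG' : ∀ y, G y ≠ ⊤) :
    ∫⁻ ξ, (∫⁻ t in Ici (0 : ℝ), P.X1.indicator G (s t ξ)) ∂P.μ0 =
      ∫⁻ y in P.X1, G y * ENNReal.ofReal (ρ y) := by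
  have hX1 := hP.isOpen_X1.measurableSet
  rw [lintegral_occupation hP.isOpen_X hP.integrableOn_h0
    (hP.contDiffOn_field subset_rfl hr.isFeedback.1) hr.isFlowOn hG (fun y => ?_)]
  · have : ∀ y, P.X1.indicator G y *
        ∫⁻ t in Ici (0 : ℝ), ENNReal.ofReal (perronFrobenius s t P.h0 y) = P.X1.indicator
        (fun y => G y * ∫⁻ t in Ici (0 : ℝ), ENNReal.ofReal (perronFrobenius s t P.h0 y)) y :=
      fun y => by by_cases hy : y ∈ P.X1 <;> simp [hy]
    simp only [this]
    rw [lintegral_indicator hX1, Measure.restrict_restrict hX1, inter_eq_left.2 X1_subset]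
    refine lintegral_congr_ae ?_
    filter_upwards [hr.density] with y hy
    rw [hy]
  · by_cases hy : y ∈ P.X1 <;> simp [hy, hG']

theorem measurable_indicator_cost (hr : P.IsRegular k s ρ) (hP : P.Standing) :
    Measurable (P.X1.indicator fun y => ENNReal.ofReal (P.runningCost y (k y))) :=
  measurable_indicator_runningCost hP hP.isOpen_X1.measurableSet fun j =>
    measurable_indicator_of_continuousOn hP.isOpen_X1.measurableSet
      ((contDiffOn_pi.1 hr.isFeedback.1 j).continuousOn.mono X1_subset)

theorem programCost_eq (hr : P.IsRegular k s ρ) (hP : P.Standing) :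
    P.programCost (ρ, fun x => ρ x • k x) = P.cost s (fun t ξ => k (s t ξ)) := by
  have h1 : P.cost s (fun t ξ => k (s t ξ)) = ∫⁻ ξ, (∫⁻ t in Ici (0 : ℝ),
      P.X1.indicator (fun y => ENNReal.ofReal (P.runningCost y (k y))) (s t ξ)) ∂P.μ0 := by
    rfl
  rw [h1, hr.lintegral_indicator_X1 hP (hr.measurable_indicator_cost hP)
    fun _ => ENNReal.ofReal_ne_top]
  refine setLIntegral_congr_fun hP.isOpen_X1.measurableSet fun y hy => ?_
  have h0 := hr.nonneg y hy
  simp only [runningCost, Pi.smul_apply, smul_eq_mul, abs_mul, abs_of_nonneg h0]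
  rw [← ENNReal.ofReal_mul' h0, ← Finset.mul_sum]
  congr 1
  ring

theorem traversal_eq (hr : P.IsRegular k s ρ) (hP : P.Standing) :
    P.traversal s = ∫⁻ x in P.X1, ENNReal.ofReal (P.b x * ρ x) := by
  rw [traversal, hr.lintegral_indicator_X1 hP (hP.measurable_b.ennreal_ofReal.indicator
    hP.isOpen_X1.measurableSet) fun _ => ENNReal.ofReal_ne_top]
  refine setLIntegral_congr_fun hP.isOpen_X1.measurableSet fun y hy => ?_
  rw [ENNReal.ofReal_mul' (hr.nonneg y hy)]

theorem meanTime_eq (hr : P.IsRegular k s ρ) (hP : P.Standing) :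
    P.meanTime s = ∫⁻ x in P.X1, ENNReal.ofReal (ρ x) := by
  rw [meanTime, hr.lintegral_indicator_X1 hP (measurable_const.indicator
    hP.isOpen_X1.measurableSet) fun _ => ENNReal.one_ne_top]
  simp

/-- If b ≥ c > 0 on X₁, the running cost there is at least α c, so finite cost bounds the time spent
in X₁. -/
theorem meanTime_ne_top (hr : P.IsRegular k s ρ) (hP : P.Standing) : P.meanTime s ≠ ⊤ := by
  rcases hr.time with ⟨c, hc, hcb⟩ | h
  · have hle : ENNReal.ofReal (P.α * c) * P.meanTime s ≤ P.cost s (fun t ξ => k (s t ξ)) := by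
      rw [meanTime, cost, ← lintegral_const_mul' _ _ ENNReal.ofReal_ne_top]
      refine lintegral_mono fun ξ => ?_
      rw [← lintegral_const_mul' _ _ ENNReal.ofReal_ne_top]
      refine lintegral_mono fun t => ?_
      by_cases hy : s t ξ ∈ P.X1
      · simp only [indicator_of_mem hy, mul_one]
        refine ENNReal.ofReal_le_ofReal ?_
        have hb := hcb _ hy
        have : 0 ≤ P.β * P.b (s t ξ) * ∑ j, |k (s t ξ) j| :=
          mul_nonneg (mul_nonneg hP.β_pos.le (hc.le.trans hb))
            (Finset.sum_nonneg fun _ _ => abs_nonneg _)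
        have := mul_le_mul_of_nonneg_left hb hP.α_pos.le
        unfold runningCost
        linarith
      · simp [hy]
    intro htop
    rw [htop, ENNReal.mul_top (by simpa using mul_pos hP.α_pos hc)] at hle
    exact hr.cost_ne_top (top_le_iff.1 hle)
  · exact h

theorem integrableOn (hr : P.IsRegular k s ρ) (hP : P.Standing) : IntegrableOn ρ P.X1 := by
  refine ⟨hr.contDiffOn.continuousOn.aestronglyMeasurable hP.isOpen_X1.measurableSet, ?_⟩
  rw [hasFiniteIntegral_iff_ofReal ((ae_restrict_iff' hP.isOpen_X1.measurableSet).2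
    (Eventually.of_forall hr.nonneg)), ← hr.meanTime_eq hP]
  exact (hr.meanTime_ne_top hP).lt_top

theorem measurable_extendFlow (hr : P.IsRegular k s ρ) (hP : P.Standing) :
    Measurable fun p : ℝ × State n => extendFlow P.X s p.1 p.2 :=
  hr.isFlowOn.measurable_extendFlow hP.isOpen_X (hP.contDiffOn_field subset_rfl hr.isFeedback.1)

/-- Almost every trajectory eventually enters the neighbourhood of the target and remains there. -/
theorem ae_exists_mem_nbhd (hr : P.IsRegular k s ρ) (hP : P.Standing) :
    ∀ᵐ ξ ∂P.μ0, ∃ t₀, 0 ≤ t₀ ∧ s t₀ ξ ∈ P.nbhd ∧ ∀ t ≥ t₀, s t ξ ∈ P.nbhd := by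
  have := isFiniteMeasure_μ0 hP.integrableOn_h0
  have hX1 := hP.isOpen_X1.measurableSet
  have hm : Measurable fun ξ => ∫⁻ t in Ici (0 : ℝ),
      P.X1.indicator (fun _ => (1 : ℝ≥0∞)) (extendFlow P.X s t ξ) :=
    (((measurable_const.indicator hX1).comp (hr.measurable_extendFlow hP)).comp
      measurable_swap).lintegral_prod_right'
  have hfin : ∫⁻ ξ, (∫⁻ t in Ici (0 : ℝ),
      P.X1.indicator (fun _ => (1 : ℝ≥0∞)) (extendFlow P.X s t ξ)) ∂P.μ0 ≠ ⊤ := by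
    have h := hr.meanTime_ne_top hP
    rw [meanTime] at h
    refine (lintegral_congr_ae ?_).trans_ne h
    filter_upwards [ae_mem_X hP.isOpen_X] with ξ hξ
    simp only [extendFlow_of_mem _ hξ]
  filter_upwards [ae_lt_top hm hfin, ae_mem_X hP.isOpen_X] with ξ hξ hξX
  simp only [extendFlow_of_mem _ hξX] at hξ
  -- A trajectory that never enters the neighbourhood spends infinite time in X₁, which finite mean
  -- time excludes almost surely.
  obtain ⟨t₀, ht₀, hN⟩ : ∃ t₀, 0 ≤ t₀ ∧ s t₀ ξ ∈ P.nbhd := by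
    by_contra! hno
    refine hξ.ne ?_
    rw [setLIntegral_congr_fun (g := fun _ => 1) measurableSet_Ici fun t ht =>
      indicator_of_mem ((mem_X1_or_nbhd ((hr.isFlowOn ξ hξX).2 t).1).resolve_right
        (hno t ht)) _]
    simp
  refine ⟨t₀, ht₀, hN, fun t ht => ?_⟩
  have := (hr.locallyStable _ hN).2.1 (t - t₀) (by linarith)
  rwa [← hr.isFlowOn.add_apply_mem hP.isOpen_X (hP.contDiffOn_field subset_rfl hr.isFeedback.1)
    _ _ hξX, sub_add_cancel] at this

theorem aeStable (hr : P.IsRegular k s ρ) (hP : P.Standing) : P.AEStable s := by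
  filter_upwards [hr.ae_exists_mem_nbhd hP, ae_mem_X hP.isOpen_X] with ξ hξ hξX
  obtain ⟨t₀, -, hN, -⟩ := hξ
  have := ((hr.locallyStable _ hN).2.2).comp (tendsto_atTop_add_const_right atTop (-t₀) tendsto_id)
  refine this.congr fun t => ?_
  simp only [Function.comp, id]
  rw [← hr.isFlowOn.add_apply_mem hP.isOpen_X (hP.contDiffOn_field subset_rfl hr.isFeedback.1)
    _ _ hξX, neg_add_cancel_right]

end IsRegular

/-- Zero total occupation time of the obstacle implies zero occupation at every time. -/
theorem obstacleMass_eq_zero (hP : P.Standing) (hks : P.IsFeedback k s)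
    (h : ∫⁻ t in Ici (0 : ℝ), P.obstacleMass s t = 0) {t : ℝ} (ht : 0 ≤ t) :
    P.obstacleMass s t = 0 := by
  have hF := hP.contDiffOn_field subset_rfl hks.1
  have := isFiniteMeasure_μ0 hP.integrableOn_h0
  obtain ⟨S, hS, hSp⟩ := exists_ae_μ0_iff hP.integrableOn_h0
  have hm := hks.2.measurable_extendFlow hP.isOpen_X hF
  have hind : Measurable (P.Xu.indicator fun _ => (1 : ℝ≥0∞)) :=
    measurable_const.indicator hP.measurableSet_Xu
  have hmass : ∀ t, P.obstacleMass s t =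
      ∫⁻ ξ, P.Xu.indicator (fun _ => (1 : ℝ≥0∞)) (extendFlow P.X s t ξ) ∂P.μ0 := fun t => by
    refine lintegral_congr_ae ?_
    filter_upwards [ae_mem_X hP.isOpen_X] with ξ hξ
    rw [extendFlow_of_mem _ hξ]
  have hiff : ∀ t, P.obstacleMass s t = 0 ↔
      ∀ᵐ x ∂(volume.restrict P.X), x ∈ S → extendFlow P.X s t x ∉ P.Xu := fun t => by
    have hmt : Measurable fun ξ => P.Xu.indicator (fun _ => (1 : ℝ≥0∞)) (extendFlow P.X s t ξ) :=
      hind.comp (hm.comp measurable_prodMk_left)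
    rw [hmass, lintegral_eq_zero_iff hmt, ← hSp]
    exact eventually_congr (Eventually.of_forall fun x => by simp)
  rw [hiff]
  refine hks.2.ae_notMem_of_ae_ae_notMem hP.isOpen_X hF hS hP.measurableSet_Xu ?_ ht
  simp only [hmass] at h
  have hml : Measurable fun t => ∫⁻ ξ, P.Xu.indicator (fun _ => (1 : ℝ≥0∞))
      (extendFlow P.X s t ξ) ∂P.μ0 := (hind.comp hm).lintegral_prod_right'
  rw [lintegral_eq_zero_iff hml] at h
  filter_upwards [h] with t ht
  rw [← hiff, hmass]
  exact ht

end NavData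

/-! ### Regular feedbacks: constraints and the Liouville equation -/

namespace NavData

variable {n m : ℕ} {P : NavData n m} {k : State n → Fin m → ℝ} {s : ℝ → State n → State n}
  {ρ : State n → ℝ}

namespace IsRegular

/-- The obstacle is disjoint from the neighbourhood of the target, so all time spent in it is spent
in X₁ and is measured by ρ. -/
theorem lintegral_obstacleMass (hr : P.IsRegular k s ρ) (hP : P.Standing) :
    ∫⁻ t in Ici (0 : ℝ), P.obstacleMass s t =
      ∫⁻ x in P.X1, P.Xu.indicator (fun y => ENNReal.ofReal (ρ y)) x := by
  have := isFiniteMeasure_μ0 hP.integrableOn_h0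
  have hX1 := hP.isOpen_X1.measurableSet
  have hind : Measurable (P.Xu.indicator fun _ => (1 : ℝ≥0∞)) :=
    measurable_const.indicator hP.measurableSet_Xu
  have h1 := hr.lintegral_indicator_X1 hP (hind.indicator hX1)
    (fun y => by by_cases hy : y ∈ P.Xu <;> simp [hy])
  calc ∫⁻ t in Ici (0 : ℝ), P.obstacleMass s t
      = ∫⁻ t in Ici (0 : ℝ), ∫⁻ ξ, P.Xu.indicator (fun _ => (1 : ℝ≥0∞))
          (extendFlow P.X s t ξ) ∂P.μ0 := by
        refine lintegral_congr fun t => lintegral_congr_ae ?_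
        filter_upwards [ae_mem_X hP.isOpen_X] with ξ hξ
        rw [extendFlow_of_mem _ hξ]
    _ = ∫⁻ ξ, (∫⁻ t in Ici (0 : ℝ), P.Xu.indicator (fun _ => (1 : ℝ≥0∞))
          (extendFlow P.X s t ξ)) ∂P.μ0 :=
        lintegral_lintegral_swap (hind.comp (hr.measurable_extendFlow hP)).aemeasurable
    _ = ∫⁻ ξ, (∫⁻ t in Ici (0 : ℝ), P.X1.indicator (P.Xu.indicator fun _ => (1 : ℝ≥0∞))
          (s t ξ)) ∂P.μ0 := by
        refine lintegral_congr_ae ?_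
        filter_upwards [ae_mem_X hP.isOpen_X] with ξ hξ
        refine lintegral_congr fun t => ?_
        rw [extendFlow_of_mem _ hξ]
        rcases mem_X1_or_nbhd ((hr.isFlowOn ξ hξ).2 t).1 with h | h
        · rw [indicator_of_mem h]
        · rw [indicator_of_notMem (notMem_X1_of_nbhd h),
            indicator_of_notMem (disjoint_right.1 hP.disjoint h)]
    _ = _ := by
        rw [h1]
        refine lintegral_congr fun y => ?_
        by_cases hy : y ∈ P.Xu <;> simp [hy]

theorem obstacle_iff (hr : P.IsRegular k s ρ) (hP : P.Standing) :
    (∀ t, 0 ≤ t → P.obstacleMass s t = 0) ↔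
      ∫⁻ x in P.X1, P.Xu.indicator (fun y => ENNReal.ofReal (ρ y)) x = 0 := by
  rw [← hr.lintegral_obstacleMass hP]
  refine ⟨fun h => ?_, fun h t ht => obstacleMass_eq_zero hP hr.isFeedback h ht⟩
  rw [setLIntegral_congr_fun measurableSet_Ici fun t ht => h t ht, lintegral_zero]

/-- Almost no trajectory meets an open subset of `X₁` if and only if the density vanishes on it. -/
theorem ae_notMem_iff (hr : P.IsRegular k s ρ) (hP : P.Standing) {O : Set (State n)}
    (hO : IsOpen O) (hOX : O ⊆ P.X1) :
    (∀ᵐ ξ ∂P.μ0, ∀ t, 0 ≤ t → s t ξ ∉ O) ↔ ∀ x ∈ O, ρ x = 0 := by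
  have := isFiniteMeasure_μ0 hP.integrableOn_h0
  have hX1 := hP.isOpen_X1.measurableSet
  have hind : Measurable (O.indicator fun _ => (1 : ℝ≥0∞)) :=
    measurable_const.indicator hO.measurableSet
  have h1 := hr.lintegral_indicator_X1 hP (hind.indicator hX1)
    (fun y => by by_cases hy : y ∈ O <;> simp [hy])
  have h2 : ∀ y, P.X1.indicator (O.indicator fun _ => (1 : ℝ≥0∞)) y =
      O.indicator (fun _ => (1 : ℝ≥0∞)) y := fun y => by
    by_cases hy : y ∈ O
    · simp [hy, hOX hy]
    · by_cases hy1 : y ∈ P.X1 <;> simp [hy, hy1]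
  have h3 : ∫⁻ y in P.X1, O.indicator (fun _ => (1 : ℝ≥0∞)) y * ENNReal.ofReal (ρ y) =
      ∫⁻ y in O, ENNReal.ofReal (ρ y) := by
    have : ∀ y, O.indicator (fun _ => (1 : ℝ≥0∞)) y * ENNReal.ofReal (ρ y) =
        O.indicator (fun y => ENNReal.ofReal (ρ y)) y := fun y => by
      by_cases hy : y ∈ O <;> simp [hy]
    simp only [this]
    rw [lintegral_indicator hO.measurableSet, Measure.restrict_restrict hO.measurableSet,
      inter_eq_left.2 hOX]
  simp only [h2] at h1
  rw [h3] at h1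
  have hρm : AEMeasurable (fun y => ENNReal.ofReal (ρ y)) (volume.restrict O) :=
    ((hr.contDiffOn.continuousOn.mono hOX).aemeasurable hO.measurableSet).ennreal_ofReal
  constructor
  · intro h
    have hz : ∫⁻ y in O, ENNReal.ofReal (ρ y) = 0 := by
      rw [← h1, lintegral_congr_ae (g := fun _ => 0), lintegral_zero]
      filter_upwards [h] with ξ hξ
      rw [setLIntegral_congr_fun (g := fun _ => 0) measurableSet_Ici fun t ht =>
        indicator_of_notMem (hξ t ht) _, lintegral_zero]
    rw [lintegral_eq_zero_iff' hρm] at hz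
    have : ρ =ᵐ[volume.restrict O] fun _ => 0 := by
      filter_upwards [hz, ae_restrict_mem hO.measurableSet] with y hy hyO
      exact le_antisymm (ENNReal.ofReal_eq_zero.1 hy) (hr.nonneg y (hOX hyO))
    -- Continuity of ρ upgrades almost everywhere on the open set to everywhere.
    exact Measure.eqOn_open_of_ae_eq this hO (hr.contDiffOn.continuousOn.mono hOX)
      continuousOn_const
  · intro h
    rw [setLIntegral_congr_fun (g := fun _ => 0) hO.measurableSet fun y hy => by simp [h y hy],
      lintegral_zero] at h1
    have hm : Measurable fun ξ => ∫⁻ t in Ici (0 : ℝ),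
        O.indicator (fun _ => (1 : ℝ≥0∞)) (extendFlow P.X s t ξ) :=
      ((hind.comp (hr.measurable_extendFlow hP)).comp measurable_swap).lintegral_prod_right'
    have h1' : ∫⁻ ξ, (∫⁻ t in Ici (0 : ℝ),
        O.indicator (fun _ => (1 : ℝ≥0∞)) (extendFlow P.X s t ξ)) ∂P.μ0 = 0 := by
      rw [← h1]
      refine lintegral_congr_ae ?_
      filter_upwards [ae_mem_X hP.isOpen_X] with ξ hξ
      simp only [extendFlow_of_mem _ hξ]
    rw [lintegral_eq_zero_iff hm] at h1'
    filter_upwards [h1', ae_mem_X hP.isOpen_X] with ξ hξ hξX t ht htO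
    simp only [extendFlow_of_mem _ hξX, Pi.zero_apply] at hξ
    have hc := hr.isFlowOn.continuous_left hξX
    have hmc : Measurable fun t => O.indicator (fun _ => (1 : ℝ≥0∞)) (s t ξ) :=
      hind.comp hc.measurable
    rw [lintegral_eq_zero_iff hmc,
      Measure.restrict_congr_set Ioi_ae_eq_Ici.symm] at hξ
    -- The visiting times of a single trajectory form an open set. Its part in (0, ∞) is null, hence
    -- empty; a visit at a time t ≥ 0, even t = 0, would by openness be followed by later ones.
    have hopen : IsOpen ((fun t => s t ξ) ⁻¹' O) := hO.preimage hc
    have hzero : volume (((fun t => s t ξ) ⁻¹' O) ∩ Ioi 0) = 0 := by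
      rw [← Measure.restrict_apply hopen.measurableSet]
      refine measure_mono_null (fun r hr => ?_) hξ
      have hr' : s r ξ ∈ O := hr
      simp [hr']
    have hemp := (hopen.inter isOpen_Ioi).measure_eq_zero_iff volume |>.1 hzero
    obtain ⟨r, hrt, hr0⟩ := (((hopen.eventually_mem htO).filter_mono
      (nhdsWithin_le_nhds (s := Ioi t))).and self_mem_nhdsWithin).exists
    exact (hemp.subset ⟨hrt, ht.trans_lt hr0⟩).elim

/-- `ae_notMem_iff` is applied to the open subset of X₁ where |k_j| > L_j: it is avoided by almost
all trajectories exactly when ρ vanishes on it, which is |ρ k_j| ≤ L_j ρ. Near the target the bound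
is part of local stability. -/
theorem control_iff (hr : P.IsRegular k s ρ) (hP : P.Standing) :
    (∀ᵐ ξ ∂P.μ0, ∀ t, 0 ≤ t → ∀ j, |k (s t ξ) j| ≤ P.L j) ↔
      ∀ x ∈ P.X1, ∀ j, |(ρ x • k x) j| ≤ P.L j * ρ x := by
  have hO : ∀ j, IsOpen (P.X1 ∩ {x | P.L j < |k x j|}) := fun j =>
    (((contDiffOn_pi.1 hr.isFeedback.1 j).continuousOn.mono X1_subset).abs).isOpen_inter_preimage
      hP.isOpen_X1 isOpen_Ioi
  have key : ∀ j, (∀ᵐ ξ ∂P.μ0, ∀ t, 0 ≤ t → |k (s t ξ) j| ≤ P.L j) ↔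
      ∀ x ∈ P.X1, |(ρ x • k x) j| ≤ P.L j * ρ x := fun j => by
    have h := hr.ae_notMem_iff hP (hO j) inter_subset_left
    have e1 : (∀ᵐ ξ ∂P.μ0, ∀ t, 0 ≤ t → |k (s t ξ) j| ≤ P.L j) ↔
        ∀ᵐ ξ ∂P.μ0, ∀ t, 0 ≤ t → s t ξ ∉ P.X1 ∩ {x | P.L j < |k x j|} := by
      refine eventually_congr ?_
      filter_upwards [ae_mem_X hP.isOpen_X] with ξ hξ
      refine forall₂_congr fun t _ => ⟨fun h hm => absurd h (not_le.2 hm.2), fun h => ?_⟩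
      rcases mem_X1_or_nbhd ((hr.isFlowOn ξ hξ).2 t).1 with h1 | h1
      · by_contra hc
        exact h ⟨h1, not_le.1 hc⟩
      · exact (hr.locallyStable _ h1).1 j
    rw [e1, h]
    refine ⟨fun h x hx => ?_, fun h x hx => ?_⟩
    · have h0 := hr.nonneg x hx
      rw [Pi.smul_apply, smul_eq_mul, abs_mul, abs_of_nonneg h0, mul_comm]
      by_cases hc : P.L j < |k x j|
      · simp [h x ⟨hx, hc⟩]
      · exact mul_le_mul_of_nonneg_right (not_lt.1 hc) h0
    · have h0 := hr.nonneg x hx.1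
      have h1 := h x hx.1
      rw [Pi.smul_apply, smul_eq_mul, abs_mul, abs_of_nonneg h0, mul_comm] at h1
      by_contra hne
      exact absurd (le_of_mul_le_mul_right h1 (lt_of_le_of_ne h0 (Ne.symm hne))) (not_le.2 hx.2)
  constructor
  · intro h x hx j
    exact (key j).1 (h.mono fun ξ hξ t ht => hξ t ht j) x hx
  · intro h
    have := ae_all_iff.2 fun j => (key j).2 fun x hx => h x hx j
    filter_upwards [this] with ξ hξ t ht j using hξ j t ht

/-- The weak form of the Liouville equation. -/
theorem integral_fderiv_mul (hr : P.IsRegular k s ρ) (hP : P.Standing) {φ : State n → ℝ}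
    (hφ : ContDiff ℝ 1 φ) (hφc : HasCompactSupport φ) (hφX : tsupport φ ⊆ P.X1) :
    ∫ y in P.X1, fderiv ℝ φ y (P.field y (k y)) * ρ y = -∫ x in P.X1, P.h0 x * φ x := by
  have := isFiniteMeasure_μ0 hP.integrableOn_h0
  have hX1 := hP.isOpen_X1.measurableSet
  have hF := hP.contDiffOn_field subset_rfl hr.isFeedback.1
  set g : State n → ℝ := fun y => fderiv ℝ φ y (P.field y (k y)) with hg
  have hgsupp : Function.support g ⊆ tsupport φ := fun y hy => by
    refine tsupport_fderiv_subset ℝ (subset_closure fun h => hy ?_)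
    simp [hg, h]
  have hgX : ∀ y, y ∉ P.X1 → g y = 0 := fun y hy => by
    by_contra h
    exact hy (hφX (hgsupp h))
  have hgc : Continuous g := by
    obtain ⟨η, hη, -, hηU, -, W, -, hCW, hW1⟩ := exists_contDiff_cutoff hP.isOpen_X hφc
      (hφX.trans X1_subset)
    have : g = fun y => fderiv ℝ φ y (η y • P.field y (k y)) := by
      funext y
      by_cases hy : y ∈ tsupport φ
      · rw [hW1 y (hCW hy), one_smul]
      · have h0 : fderiv ℝ φ y = 0 := by
          by_contra h
          exact hy (tsupport_fderiv_subset ℝ (subset_closure h))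
        simp [hg, h0]
    rw [this]
    exact (hφ.continuous_fderiv one_ne_zero).clm_apply
      (contDiff_smul_of_tsupport_subset hP.isOpen_X hη hηU hF).continuous
  obtain ⟨M, hM⟩ := (HasCompactSupport.intro hφc fun y hy => by
    by_contra h
    exact hy (hgsupp h) : HasCompactSupport g).exists_bound_of_continuous hgc
  set e : State n × ℝ → State n := fun p => extendFlow P.X s p.2 p.1 with he
  have hem : Measurable e := (hr.measurable_extendFlow hP).comp measurable_swap
  set μ : Measure (State n × ℝ) := P.μ0.prod (volume.restrict (Ici 0)) with hμ
  -- On X₁ the occupation measure has density ρ; this is the occupation formula for indicators.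
  have hν : (μ.map e).restrict P.X1 =
      (volume.restrict P.X1).withDensity fun y => ENNReal.ofReal (ρ y) := by
    ext A hA
    have hAX : MeasurableSet (A ∩ P.X1) := hA.inter hX1
    rw [Measure.restrict_apply hA, Measure.map_apply hem hAX, withDensity_apply _ hA,
      ← lintegral_indicator_one (hem hAX), hμ, lintegral_prod _ (by
        exact (measurable_one.indicator (hem hAX)).aemeasurable)]
    have h1 := hr.lintegral_indicator_X1 hP
      (((measurable_const (a := (1 : ℝ≥0∞))).indicator hA).indicator hX1)
      (fun y => by by_cases hy : y ∈ A <;> simp [hy])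
    have h2 : ∀ y, A.indicator (fun _ => (1 : ℝ≥0∞)) y * ENNReal.ofReal (ρ y) =
        A.indicator (fun y => ENNReal.ofReal (ρ y)) y := fun y => by
      by_cases hy : y ∈ A <;> simp [hy]
    simp only [h2] at h1
    rw [lintegral_indicator hA] at h1
    rw [← h1]
    refine lintegral_congr_ae ?_
    filter_upwards [ae_mem_X hP.isOpen_X] with ξ hξ
    refine lintegral_congr fun t => ?_
    classical
    have h3 : e (ξ, t) = s t ξ := extendFlow_of_mem _ hξ
    by_cases hA' : s t ξ ∈ A <;> by_cases hX' : s t ξ ∈ P.X1 <;>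
      simp only [indicator_apply, mem_preimage, mem_inter_iff, h3, hA', hX', Pi.one_apply,
        and_self, and_true, and_false, if_true, if_false]
  -- The occupation measure can be infinite near the target; only its restriction to X₁ is known to
  -- be finite, which is enough since g is supported there.
  have hgν : IntegrableOn g P.X1 (μ.map e) := by
    have hfin : IsFiniteMeasure ((μ.map e).restrict P.X1) := by
      rw [hν]
      exact isFiniteMeasure_withDensity_ofReal (hr.integrableOn hP).2
    exact Integrable.of_bound hgc.aestronglyMeasurable M (Eventually.of_forall hM)
  have hgi : Integrable g (μ.map e) :=
    (integrableOn_iff_integrable_of_support_subset (hgsupp.trans hφX)).1 hgν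
  have hge : Integrable (fun p => g (e p)) μ := hgi.comp_measurable hem
  have lhs : ∫ y in P.X1, g y * ρ y = ∫ p, g (e p) ∂μ := by
    rw [← integral_map hem.aemeasurable hgc.aestronglyMeasurable,
      ← setIntegral_eq_integral_of_forall_compl_eq_zero hgX, hν,
      integral_withDensity_eq_integral_toReal_smul₀]
    · refine setIntegral_congr_fun hX1 fun y hy => ?_
      simp only [smul_eq_mul, ENNReal.toReal_ofReal (hr.nonneg y hy)]
      ring
    · exact (hr.integrableOn hP).aestronglyMeasurable.aemeasurable.ennreal_ofReal
    · exact Eventually.of_forall fun _ => ENNReal.ofReal_lt_top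
  rw [lhs, hμ, integral_prod _ hge]
  -- The integrand is d/dt φ(s_t ξ), and φ vanishes along the trajectory once it has entered the
  -- neighbourhood for good.
  have inner : ∀ᵐ ξ ∂P.μ0, ∫ t in Ici (0 : ℝ), g (e (ξ, t)) = -φ ξ := by
    filter_upwards [hr.ae_exists_mem_nbhd hP, ae_mem_X hP.isOpen_X, hge.prod_right_ae]
      with ξ hξ hξX hi
    obtain ⟨t₀, -, -, ht₀⟩ := hξ
    simp only [he, extendFlow_of_mem _ hξX] at hi ⊢
    have hd : ∀ t, HasDerivAt (fun t => φ (s t ξ)) (g (s t ξ)) t := fun t =>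
      ((hφ.differentiable one_ne_zero _).hasFDerivAt).comp_hasDerivAt t
        ((hr.isFlowOn ξ hξX).2 t).2
    have hlim : Tendsto (fun t => φ (s t ξ)) atTop (𝓝 0) := by
      refine tendsto_const_nhds.congr' ?_
      filter_upwards [eventually_ge_atTop t₀] with t ht
      exact (image_eq_zero_of_notMem_tsupport fun h =>
        notMem_X1_of_nbhd (ht₀ t ht) (hφX h)).symm
    rw [integral_Ici_eq_integral_Ioi, integral_Ioi_of_hasDerivAt_of_tendsto'
      (fun t _ => hd t) (IntegrableOn.mono_set (t := Ici 0) hi Ioi_subset_Ici_self) hlim, (hr.isFlowOn ξ hξX).1, zero_sub]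
  rw [integral_congr_ae inner, integral_neg, neg_inj]
  have hφ0 : ∀ y, y ∉ P.X1 → φ y = 0 := fun y hy =>
    image_eq_zero_of_notMem_tsupport fun h => hy (hφX h)
  rw [μ0, integral_withDensity_eq_integral_toReal_smul₀ (aemeasurable_h0 hP.integrableOn_h0)
    (Eventually.of_forall fun _ => ENNReal.ofReal_lt_top)]
  have : ∫ x in P.X, (ENNReal.ofReal (P.h0 x)).toReal • φ x = ∫ x in P.X, P.h0 x * φ x :=
    setIntegral_congr_fun hP.isOpen_X.measurableSet fun x hx => by
      simp only [smul_eq_mul, ENNReal.toReal_ofReal (hP.h0_nonneg x hx)]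
  rw [this]
  exact setIntegral_eq_of_subset_of_forall_sdiff_eq_zero hP.isOpen_X.measurableSet X1_subset
    fun x hx => by simp [hφ0 x hx.2]

theorem field_smul (P : NavData n m) (k : State n → Fin m → ℝ) (ρ : State n → ℝ) (y : State n) :
    ρ y • P.f y + ∑ j, (ρ y • k y) j • P.g j y = ρ y • P.field y (k y) := by
  simp only [field, smul_add, Finset.smul_sum, Pi.smul_apply, smul_smul, smul_eq_mul]

/-- Integration by parts in the weak form shows that div(ρ(f + g k)) - h₀ has zero integral against
every test function, hence vanishes almost everywhere. -/
theorem liouville (hr : P.IsRegular k s ρ) (hP : P.Standing) :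
    ∀ᵐ x ∂(volume.restrict P.X1),
      divergence (fun y => ρ y • P.f y + ∑ j, (ρ y • k y) j • P.g j y) x = P.h0 x := by
  have hX1 := hP.isOpen_X1.measurableSet
  simp only [field_smul]
  set V : State n → State n := fun y => ρ y • P.field y (k y) with hVdef
  have hV : ContDiffOn ℝ 1 V P.X1 :=
    hr.contDiffOn.smul (hP.contDiffOn_field X1_subset (hr.isFeedback.1.mono X1_subset))
  have hdc : ContinuousOn (divergence V) P.X1 := continuousOn_divergence hP.isOpen_X1 hV
  have hloc : LocallyIntegrableOn (fun x => divergence V x - P.h0 x) P.X1 :=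
    (hdc.locallyIntegrableOn hX1).sub
      (hP.integrableOn_h0.mono_set X1_subset).locallyIntegrableOn
  have key : ∀ᵐ x, x ∈ P.X1 → divergence V x - P.h0 x = 0 := by
    refine hP.isOpen_X1.ae_eq_zero_of_integral_contDiff_smul_eq_zero hloc fun φ hφ hφc hφX => ?_
    have hφ1 : ContDiff ℝ 1 φ := hφ.of_le (by exact_mod_cast le_top)
    obtain ⟨K, hK⟩ := hφ1.lipschitzWith_of_hasCompactSupport hφc one_ne_zero
    obtain ⟨-, hi, h2⟩ := integral_fderiv_apply_eq_neg hP.isOpen_X1 hV hK hφc hφX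
    have h1 := hr.integral_fderiv_mul hP hφ1 hφc hφX
    have hφ0 : ∀ y, y ∉ P.X1 → φ y = 0 := fun y hy =>
      image_eq_zero_of_notMem_tsupport fun h => hy (hφX h)
    have hf0 : ∀ y, y ∉ P.X1 → fderiv ℝ φ y = 0 := fun y hy => by
      by_contra h
      exact hy (hφX (tsupport_fderiv_subset ℝ (subset_closure h)))
    have e1 : ∫ y in P.X1, fderiv ℝ φ y (P.field y (k y)) * ρ y = ∫ y, fderiv ℝ φ y (V y) := by
      rw [← setIntegral_eq_integral_of_forall_compl_eq_zero (s := P.X1)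
        (f := fun y => fderiv ℝ φ y (V y)) (fun y hy => by simp [hf0 y hy])]
      exact setIntegral_congr_fun hX1 fun y _ => by simp [hVdef, mul_comm]
    have e2 : ∫ y in P.X1, P.h0 y * φ y = ∫ y, P.h0 y * φ y :=
      setIntegral_eq_integral_of_forall_compl_eq_zero fun y hy => by simp [hφ0 y hy]
    have hi2 : Integrable fun y => P.h0 y * φ y := by
      rw [← integrableOn_iff_integrable_of_support_subset (s := P.X1) fun y hy => by
        by_contra h
        exact hy (by simp [hφ0 y h])]
      obtain ⟨M, hM⟩ := hφc.exists_bound_of_continuous hφ.continuous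
      exact (hP.integrableOn_h0.mono_set X1_subset).mul_bdd hφ.continuous.aestronglyMeasurable
        (Eventually.of_forall hM)
    have e3 : ∀ y, φ y • (divergence V y - P.h0 y) = φ y * divergence V y - P.h0 y * φ y :=
      fun y => by simp only [smul_eq_mul]; ring
    simp only [e3]
    rw [integral_sub hi hi2, ← e2]
    rw [e1, h2] at h1
    linarith
  rw [ae_restrict_iff' hX1]
  filter_upwards [key] with x hx hx1
  linarith [hx hx1]

theorem feasible_of_admissible (hr : P.IsRegular k s ρ) (hP : P.Standing)
    (ha : P.Admissible s (fun t ξ => k (s t ξ))) : P.Feasible (ρ, fun x => ρ x • k x) where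
  contDiff_fst := hr.contDiffOn
  contDiff_snd := hr.contDiffOn.smul (hr.isFeedback.1.mono X1_subset)
  integrable := hr.integrableOn hP
  nonneg := hr.nonneg
  obstacle := (hr.obstacle_iff hP).1 ha.obstacle
  traversal_le := (hr.traversal_eq hP).symm.trans_le ha.traversal_le
  control_le := (hr.control_iff hP).1 ha.control_le
  liouville := hr.liouville hP

theorem admissible_of_feasible (hr : P.IsRegular k s ρ) (hP : P.Standing)
    (hq : P.Feasible (ρ, fun x => ρ x • k x)) : P.Admissible s (fun t ξ => k (s t ξ)) := by
  have := isFiniteMeasure_μ0 hP.integrableOn_h0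
  have h2 : ∀ᵐ p : ℝ × State n ∂((volume.restrict (Ici 0)).prod P.μ0), p.2 ∈ P.X :=
    Measure.quasiMeasurePreserving_snd.ae (ae_mem_X hP.isOpen_X)
  have hm := hr.measurable_extendFlow hP
  have hF := hP.contDiffOn_field subset_rfl hr.isFeedback.1
  refine ⟨?_, ?_, ?_, (hr.obstacle_iff hP).2 hq.obstacle,
    (hr.traversal_eq hP).trans_le hq.traversal_le, (hr.control_iff hP).2 hq.control_le,
    hr.aeStable hP⟩
  · refine hm.aemeasurable.congr ?_
    filter_upwards [h2] with p hp using extendFlow_of_mem _ hp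
  · have hk := (measurable_indicator_of_continuousOn hP.isOpen_X.measurableSet
      hr.isFeedback.1.continuousOn).comp hm
    refine hk.aemeasurable.congr ?_
    filter_upwards [h2] with p hp
    simp only [Function.comp, extendFlow_of_mem _ hp]
    exact indicator_of_mem ((hr.isFlowOn _ hp).2 _).1 _
  · filter_upwards [ae_mem_X hP.isOpen_X] with ξ hξ
    have hc := hr.isFlowOn.continuous_left hξ
    refine ⟨hc.continuousOn, fun t _ => ⟨((hr.isFlowOn ξ hξ).2 t).1, ?_⟩⟩
    have hcF : Continuous fun τ => P.field (s τ ξ) (k (s τ ξ)) :=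
      hF.continuousOn.comp_continuous hc fun τ => ((hr.isFlowOn ξ hξ).2 τ).1
    rw [intervalIntegral.integral_eq_sub_of_hasDerivAt
      (fun τ _ => ((hr.isFlowOn ξ hξ).2 τ).2) (hcF.intervalIntegrable _ _),
      (hr.isFlowOn ξ hξ).1, add_sub_cancel]

end IsRegular

end NavData

/-! ### Occupation measures and densities -/

section

variable {n : ℕ} {Y : State n → State n} {K : ℝ≥0} {θ : ℝ → State n → State n}

theorem IsFlowOn.eq_self_of_zero (hθ : IsFlowOn Y univ θ) (hK : LipschitzWith K Y) {x : State n}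
    (hx : Y x = 0) (t : ℝ) : θ t x = x := by
  have := ODE_solution_unique_univ (v := fun _ => Y) (s := fun _ => univ) (K := K) (t₀ := 0)
    (f := fun r => θ r x) (g := fun _ => x) (fun _ => hK.lipschitzOnWith)
    (fun r => ⟨((hθ x trivial).2 r).2, trivial⟩)
    (fun r => ⟨by simpa [hx] using hasDerivAt_const r x, trivial⟩) (hθ x trivial).1
  exact congrFun this t

/-- The open set outside of which the field vanishes is invariant. -/
theorem IsFlowOn.mem_of_forall_notMem (hθ : IsFlowOn Y univ θ) (hK : LipschitzWith K Y)
    {U : Set (State n)} (hU : ∀ x ∉ U, Y x = 0) {x : State n} (hx : x ∈ U) (t : ℝ) :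
    θ t x ∈ U := by
  by_contra h
  have h1 := hθ.eq_self_of_zero hK (hU _ h) (-t)
  rw [hθ.neg_apply_apply hK] at h1
  exact h (h1 ▸ hx)

/-- The time integral of a compactly supported Lipschitz function along a flow. -/
theorem IsFlowOn.lipschitz_timeIntegral (hθ : IsFlowOn Y univ θ) (hK : LipschitzWith K Y)
    {U : Set (State n)} (hU : ∀ x ∉ U, Y x = 0) {ψ : State n → ℝ} {D : ℝ≥0}
    (hψ : LipschitzWith D ψ) (hψc : HasCompactSupport ψ) (hψU : tsupport ψ ⊆ U)
    {T : ℝ} (hT : 0 ≤ T) :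
    (∃ C, LipschitzWith C fun x => ∫ t in (0 : ℝ)..T, ψ (θ t x)) ∧
    HasCompactSupport (fun x => ∫ t in (0 : ℝ)..T, ψ (θ t x)) ∧
    tsupport (fun x => ∫ t in (0 : ℝ)..T, ψ (θ t x)) ⊆ U ∧
    ∀ x, HasDerivAt (fun r => ∫ t in (0 : ℝ)..T, ψ (θ t (θ r x))) (ψ (θ T x) - ψ x) 0 := by
  have hc : ∀ x, Continuous fun t => ψ (θ t x) := fun x =>
    hψ.continuous.comp (hθ.continuous_left trivial)
  have hii : ∀ x a b, IntervalIntegrable (fun t => ψ (θ t x)) volume a b := fun x a b =>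
    (hc x).intervalIntegrable a b
  refine ⟨?_, ?_⟩
  · refine ⟨Real.toNNReal (D * Real.exp (K * T) * T), LipschitzWith.of_dist_le' fun x y => ?_⟩
    rw [dist_eq_norm, ← intervalIntegral.integral_sub (hii x 0 T) (hii y 0 T)]
    refine (intervalIntegral.norm_integral_le_of_norm_le_const
      (C := D * (dist x y * Real.exp (K * T))) fun t ht => ?_).trans_eq ?_
    · rw [uIoc_of_le hT] at ht
      rw [← dist_eq_norm]
      refine (hψ.dist_le_mul _ _).trans ?_
      refine mul_le_mul_of_nonneg_left ((hθ.dist_le hK t x y).trans ?_) D.coe_nonneg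
      rw [abs_of_pos ht.1]
      gcongr
      exact ht.2
    · rw [sub_zero, abs_of_nonneg hT]
      ring
  -- The integral vanishes at x unless the orbit of x meets the support of ψ within [0, T], that is,
  -- unless x lies in the support flowed backwards by at most T.
  · have hCc : IsCompact ((fun p : ℝ × State n => θ p.1 p.2) '' (Icc (-T) 0 ×ˢ tsupport ψ)) :=
      (isCompact_Icc.prod hψc).image (hθ.continuous_uncurry hK)
    have hsub : Function.support (fun x => ∫ t in (0 : ℝ)..T, ψ (θ t x)) ⊆
        (fun p : ℝ × State n => θ p.1 p.2) '' (Icc (-T) 0 ×ˢ tsupport ψ) := by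
      intro x hx
      by_contra hno
      refine hx ?_
      have : ∀ t ∈ uIcc 0 T, ψ (θ t x) = 0 := fun t ht => by
        rw [uIcc_of_le hT] at ht
        by_contra hne
        exact hno ⟨(-t, θ t x), ⟨⟨neg_le_neg ht.2, by simpa using ht.1⟩, subset_closure hne⟩,
          hθ.neg_apply_apply hK t x⟩
      show ∫ t in (0 : ℝ)..T, ψ (θ t x) = 0
      rw [intervalIntegral.integral_congr this, intervalIntegral.integral_zero]
    have hts := closure_minimal hsub hCc.isClosed
    refine ⟨hCc.of_isClosed_subset (isClosed_tsupport _) hts, hts.trans ?_, fun x => ?_⟩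
    · rintro _ ⟨⟨t, x⟩, ⟨-, hx⟩, rfl⟩
      exact hθ.mem_of_forall_notMem hK hU (hψU hx) t
    -- Moving the starting point along the orbit by r shifts the window of integration to [r, T +
    -- r].
    · have h1 : ∀ r, ∫ t in (0 : ℝ)..T, ψ (θ t (θ r x)) =
          (∫ t in (0 : ℝ)..(T + r), ψ (θ t x)) - ∫ t in (0 : ℝ)..r, ψ (θ t x) := fun r => by
        simp only [← hθ.add_apply hK]
        rw [intervalIntegral.integral_comp_add_right (fun t => ψ (θ t x)), zero_add,
          intervalIntegral.integral_interval_sub_left (hii x _ _) (hii x _ _)]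
      simp only [h1]
      have h2 : ∀ b, HasDerivAt (fun u => ∫ t in (0 : ℝ)..u, ψ (θ t x)) (ψ (θ b x)) b := fun b =>
        intervalIntegral.integral_hasDerivAt_right (hii x _ _)
          ((hc x).stronglyMeasurableAtFilter _ _) (hc x).continuousAt
      have h3 : HasDerivAt (fun r => ∫ t in (0 : ℝ)..(T + r), ψ (θ t x)) (ψ (θ T x)) 0 := by
        have := (h2 (T + 0)).comp_const_add T 0
        simpa using this
      have h4 := h3.fun_sub (h2 0)
      rwa [(hθ x trivial).1] at h4

/-- For a flow whose field is `χ V` with `div V = h ≥ 0`, the occupation measure of the initial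
density `h` is at most `1 / χ`: the case of Lipschitz functions with compact support. -/
theorem IsFlowOn.lintegral_timeIntegral_le {U : Set (State n)} (hUo : IsOpen U)
    {V : State n → State n} (hV : ContDiffOn ℝ 1 V U) {χ : State n → ℝ} (hχ : Continuous χ)
    (hχU : ∀ x ∈ U, 0 < χ x) (hχ0 : ∀ x ∉ U, χ x = 0)
    (hθ : IsFlowOn (fun x => χ x • V x) univ θ) (hK : LipschitzWith K fun x => χ x • V x)
    {h : State n → ℝ} (hh : ∀ x ∈ U, 0 ≤ h x)
    (hdiv : ∀ᵐ x ∂(volume.restrict U), divergence V x = h x) {ψ : State n → ℝ} {D : ℝ≥0}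
    (hψ : LipschitzWith D ψ) (hψc : HasCompactSupport ψ) (hψU : tsupport ψ ⊆ U)
    (hψ0 : ∀ x, 0 ≤ ψ x) {T : ℝ} (hT : 0 ≤ T) :
    ∫⁻ x in U, ENNReal.ofReal (h x) * ∫⁻ t in Ioc 0 T, ENNReal.ofReal (ψ (θ t x)) ≤
      ∫⁻ x in U, ENNReal.ofReal (ψ x) * ENNReal.ofReal (χ x)⁻¹ := by
  have hU0 : ∀ x ∉ U, χ x • V x = 0 := fun x hx => by rw [hχ0 x hx, zero_smul]
  obtain ⟨⟨C, hC⟩, hΦc, hΦU, hΦd⟩ := hθ.lipschitz_timeIntegral hK hU0 hψ hψc hψU hT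
  set Φ : State n → ℝ := fun x => ∫ t in (0 : ℝ)..T, ψ (θ t x) with hΦ
  obtain ⟨i1, i2, hibp⟩ := integral_fderiv_apply_eq_neg hUo hV hC hΦc hΦU
  have hΦ0 : ∀ x, 0 ≤ Φ x := fun x =>
    intervalIntegral.integral_nonneg hT fun t _ => hψ0 _
  have hΦl : ∀ x, ENNReal.ofReal (Φ x) = ∫⁻ t in Ioc 0 T, ENNReal.ofReal (ψ (θ t x)) := fun x => by
    simp only [hΦ]
    rw [intervalIntegral.integral_of_le hT, ofReal_integral_eq_lintegral_ofReal]
    · exact ((hψ.continuous.comp (hθ.continuous_left trivial)).intervalIntegrable 0 T).1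
    · exact Eventually.of_forall fun t => hψ0 _
  have hΦn : ∀ x ∉ U, Φ x = 0 := fun x hx =>
    image_eq_zero_of_notMem_tsupport fun hx' => hx (hΦU hx')
  have hψn : ∀ x ∉ U, ψ x = 0 := fun x hx =>
    image_eq_zero_of_notMem_tsupport fun hx' => hx (hψU hx')
  have iψ : Integrable fun x => ψ x * (χ x)⁻¹ := by
    rw [← integrableOn_iff_integrable_of_support_subset (s := tsupport ψ) fun x hx =>
      subset_closure (left_ne_zero_of_mul hx)]
    exact (hψ.continuous.continuousOn.mul (hχ.continuousOn.inv₀ fun x hx =>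
      (hχU x (hψU hx)).ne')).integrableOn_compact hψc
  -- The derivative of Φ along χV is ψ(θ_T x) - ψ(x) ≥ -ψ(x), and division by χ gives the estimate.
  -- It is almost everywhere only, since Φ is merely Lipschitz.
  have hpt : ∀ᵐ x, -fderiv ℝ Φ x (V x) ≤ ψ x * (χ x)⁻¹ := by
    filter_upwards [hC.ae_differentiableAt] with x hx
    by_cases hxU : x ∈ U
    · have hd : HasDerivAt (fun r => Φ (θ r x)) (fderiv ℝ Φ x (χ x • V x)) 0 := by
        have h0 := ((hθ x trivial).2 0).2
        rw [(hθ x trivial).1] at h0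
        refine HasFDerivAt.comp_hasDerivAt (l := Φ) (f := fun r => θ r x) 0 ?_ h0
        rw [(hθ x trivial).1]
        exact hx.hasFDerivAt
      have h1 := hd.unique (hΦd x)
      rw [map_smul, smul_eq_mul] at h1
      have hχx := hχU x hxU
      rw [← div_eq_mul_inv, le_div_iff₀ hχx]
      linarith [hψ0 (θ T x)]
    · have : fderiv ℝ Φ x = 0 := by
        by_contra hne
        exact hxU (hΦU (tsupport_fderiv_subset ℝ (subset_closure hne)))
      simp [this, hψn x hxU]
  calc ∫⁻ x in U, ENNReal.ofReal (h x) * ∫⁻ t in Ioc 0 T, ENNReal.ofReal (ψ (θ t x))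
      = ∫⁻ x in U, ENNReal.ofReal (Φ x * divergence V x) := by
        refine lintegral_congr_ae ?_
        filter_upwards [hdiv] with x hx
        rw [hx, ENNReal.ofReal_mul (hΦ0 x), hΦl, mul_comm]
    _ = ENNReal.ofReal (∫ x in U, Φ x * divergence V x) := by
        rw [ofReal_integral_eq_lintegral_ofReal i2.integrableOn]
        filter_upwards [hdiv, ae_restrict_mem hUo.measurableSet] with x hx hxU
        rw [hx]
        exact mul_nonneg (hΦ0 x) (hh x hxU)
    _ = ENNReal.ofReal (∫ x, -fderiv ℝ Φ x (V x)) := by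
        rw [setIntegral_eq_integral_of_forall_compl_eq_zero (fun x hx => by simp [hΦn x hx]),
          integral_neg, hibp, neg_neg]
    _ ≤ ENNReal.ofReal (∫ x, ψ x * (χ x)⁻¹) :=
        ENNReal.ofReal_le_ofReal (integral_mono_ae i1.neg iψ hpt)
    _ = ENNReal.ofReal (∫ x in U, ψ x * (χ x)⁻¹) := by
        rw [setIntegral_eq_integral_of_forall_compl_eq_zero (fun x hx => by simp [hψn x hx])]
    _ = ∫⁻ x in U, ENNReal.ofReal (ψ x) * ENNReal.ofReal (χ x)⁻¹ := by
        rw [ofReal_integral_eq_lintegral_ofReal iψ.integrableOn]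
        · simp only [ENNReal.ofReal_mul (hψ0 _)]
        · filter_upwards [ae_restrict_mem hUo.measurableSet] with x hx
          exact mul_nonneg (hψ0 x) (inv_nonneg.2 (hχU x hx).le)

/-- For a flow whose field is `χ V` with `div V = h ≥ 0`, the occupation measure of the initial
density `h` is at most `1 / χ`. -/
theorem IsFlowOn.lintegral_occupation_le {U : Set (State n)} (hUo : IsOpen U)
    {V : State n → State n} (hV : ContDiffOn ℝ 1 V U) {χ : State n → ℝ} (hχ : Continuous χ)
    (hχU : ∀ x ∈ U, 0 < χ x) (hχ0 : ∀ x ∉ U, χ x = 0)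
    (hθ : IsFlowOn (fun x => χ x • V x) univ θ) (hK : LipschitzWith K fun x => χ x • V x)
    {h : State n → ℝ} (hh : ∀ x ∈ U, 0 ≤ h x) (hhi : IntegrableOn h U)
    (hdiv : ∀ᵐ x ∂(volume.restrict U), divergence V x = h x) {ψ : State n → ℝ≥0∞}
    (hψ : Measurable (U.indicator ψ)) :
    ∫⁻ x in U, ENNReal.ofReal (h x) * ∫⁻ t in Ici (0 : ℝ), ψ (θ t x) ≤
      ∫⁻ x in U, ψ x * ENNReal.ofReal (χ x)⁻¹ := by
  have hU0 : ∀ x ∉ U, χ x • V x = 0 := fun x hx => by rw [hχ0 x hx, zero_smul]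
  have hθU : ∀ x ∈ U, ∀ t, θ t x ∈ U := fun x hx t => hθ.mem_of_forall_notMem hK hU0 hx t
  set m : Measure (State n) := (volume.restrict U).withDensity fun x => ENNReal.ofReal (h x)
    with hm
  have hhm : AEMeasurable (fun x => ENNReal.ofReal (h x)) (volume.restrict U) :=
    hhi.aestronglyMeasurable.aemeasurable.ennreal_ofReal
  have hlm : ∀ G : State n → ℝ≥0∞, ∫⁻ x, G x ∂m = ∫⁻ x in U, ENNReal.ofReal (h x) * G x :=
    fun G => lintegral_withDensity_eq_lintegral_mul_non_measurable₀ _ hhm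
      (Eventually.of_forall fun _ => ENNReal.ofReal_lt_top) G
  have hmfin : IsFiniteMeasure m := isFiniteMeasure_withDensity_ofReal hhi.2
  have hmU : ∀ᵐ x ∂m, x ∈ U :=
    (withDensity_absolutelyContinuous _ _).ae_le (ae_restrict_mem hUo.measurableSet)
  set lam : Measure (State n) := (volume.restrict U).withDensity
    fun x => ENNReal.ofReal (χ x)⁻¹ with hlam
  have hχm : Measurable fun x => ENNReal.ofReal (χ x)⁻¹ := hχ.measurable.inv.ennreal_ofReal
  have hθm : Measurable fun p : State n × ℝ => θ p.2 p.1 :=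
    ((hθ.continuous_uncurry hK).comp continuous_swap).measurable
  -- The horizon is cut off at N to keep the occupation measure finite, which inner regularity by
  -- compact sets needs below.
  set ν : ℕ → Measure (State n) := fun N =>
    (m.prod (volume.restrict (Ioc (0 : ℝ) N))).map fun p => θ p.2 p.1 with hν
  have hνl : ∀ N (G : State n → ℝ≥0∞), Measurable G →
      ∫⁻ x, G x ∂(ν N) = ∫⁻ x, (∫⁻ t in Ioc (0 : ℝ) N, G (θ t x)) ∂m := fun N G hG => by
    rw [hν, lintegral_map hG hθm]
    exact lintegral_prod _ (hG.comp hθm).aemeasurable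
  have hνfin : ∀ N, IsFiniteMeasure (ν N) := fun N => Measure.isFiniteMeasure_map _ _
  -- The estimate for Lipschitz functions is applied to thickened indicators of C, and the thickness
  -- tends to 0; this is legitimate because 1/χ is integrable on some compact thickening of C inside
  -- U.
  have hcpt : ∀ N (C : Set (State n)), IsCompact C → C ⊆ U → ν N C ≤ lam C := by
    intro N C hC hCU
    obtain ⟨δ₀, hδ₀, hδU⟩ := hC.exists_cthickening_subset_open hUo hCU
    have hfin : lam (Metric.cthickening δ₀ C) ≠ ⊤ := by
      rw [hlam, withDensity_apply _ Metric.isClosed_cthickening.measurableSet,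
        Measure.restrict_restrict Metric.isClosed_cthickening.measurableSet,
        inter_eq_left.2 hδU]
      have : IntegrableOn (fun x => (χ x)⁻¹) (Metric.cthickening δ₀ C) :=
        (hχ.continuousOn.inv₀ fun x hx => (hχU x (hδU hx)).ne').integrableOn_compact
          hC.cthickening
      have h1 := this.2
      rw [hasFiniteIntegral_iff_ofReal] at h1
      · exact h1.ne
      · filter_upwards [ae_restrict_mem Metric.isClosed_cthickening.measurableSet] with x hx
        exact inv_nonneg.2 (hχU x (hδU hx)).le
    have hlim : Tendsto (fun r => lam (Metric.cthickening r C)) (𝓝[>] 0) (𝓝 (lam C)) :=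
      (tendsto_measure_cthickening_of_isClosed ⟨δ₀, hδ₀, hfin⟩ hC.isClosed).mono_left
        nhdsWithin_le_nhds
    refine ge_of_tendsto hlim ?_
    filter_upwards [Ioc_mem_nhdsGT hδ₀] with δ hδ
    set ψ' : State n → ℝ := fun x => thickenedIndicator hδ.1 C x with hψ'
    have hsupp : tsupport ψ' ⊆ Metric.cthickening δ C :=
      closure_minimal (fun x hx => by
        by_contra hno
        refine hx ?_
        have : x ∉ Metric.thickening δ C := fun h' =>
          hno (Metric.thickening_subset_cthickening _ _ h')
        show ((thickenedIndicator hδ.1 C x : ℝ≥0) : ℝ) = 0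
        rw [thickenedIndicator_zero hδ.1 C this, NNReal.coe_zero]) Metric.isClosed_cthickening
    have hcU : Metric.cthickening δ C ⊆ U := (Metric.cthickening_mono hδ.2 C).trans hδU
    have hlip : LipschitzWith δ.toNNReal⁻¹ ψ' := fun x y =>
      lipschitzWith_thickenedIndicator hδ.1 C x y
    have key := hθ.lintegral_timeIntegral_le hUo hV hχ hχU hχ0 hK hh hdiv hlip
      (hC.cthickening.of_isClosed_subset (isClosed_tsupport _) hsupp) (hsupp.trans hcU)
      (fun x => NNReal.coe_nonneg _) N.cast_nonneg
    have hψm : Measurable fun x => ENNReal.ofReal (ψ' x) :=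
      hlip.continuous.measurable.ennreal_ofReal
    rw [← hlm, ← hνl N _ hψm] at key
    calc ν N C = ∫⁻ x, C.indicator 1 x ∂(ν N) := (lintegral_indicator_one hC.measurableSet).symm
      _ ≤ ∫⁻ x, ENNReal.ofReal (ψ' x) ∂(ν N) := by
          refine lintegral_mono fun x => ?_
          by_cases hx : x ∈ C
          · have h1 : ψ' x = 1 := by
              simp only [hψ', thickenedIndicator_one hδ.1 C hx, NNReal.coe_one]
            simp [hx, h1]
          · simp [hx]
      _ ≤ ∫⁻ x in U, ENNReal.ofReal (ψ' x) * ENNReal.ofReal (χ x)⁻¹ := key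
      _ ≤ ∫⁻ x in U, (Metric.cthickening δ C).indicator (fun x => ENNReal.ofReal (χ x)⁻¹) x := by
          refine lintegral_mono fun x => ?_
          by_cases hx : x ∈ Metric.cthickening δ C
          · rw [indicator_of_mem hx]
            refine mul_le_of_le_one_left' ?_
            rw [ENNReal.ofReal_le_one]
            exact_mod_cast thickenedIndicator_le_one hδ.1 C x
          · rw [image_eq_zero_of_notMem_tsupport fun hx' => hx (hsupp hx')]
            simp
      _ = lam (Metric.cthickening δ C) := by
          rw [hlam, withDensity_apply _ Metric.isClosed_cthickening.measurableSet,
            lintegral_indicator Metric.isClosed_cthickening.measurableSet]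
  -- Inner regularity passes from compact sets to Borel sets; integrals of arbitrary measurable
  -- functions and monotone convergence in N follow.
  have hle : ∀ N, (ν N).restrict U ≤ lam := by
    intro N
    refine Measure.le_iff.2 fun A hA => ?_
    rw [Measure.restrict_apply hA, (hA.inter hUo.measurableSet).measure_eq_iSup_isCompact_of_ne_top
      (measure_ne_top _ _)]
    exact iSup₂_le fun C hC => iSup_le fun hCc =>
      (hcpt N C hCc (hC.trans inter_subset_right)).trans
        (measure_mono (hC.trans inter_subset_left))
  have hfinN : ∀ N : ℕ, ∫⁻ x, (∫⁻ t in Ioc (0 : ℝ) N, U.indicator ψ (θ t x)) ∂m ≤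
      ∫⁻ x in U, ψ x * ENNReal.ofReal (χ x)⁻¹ := by
    intro N
    rw [← hνl N _ hψ]
    calc ∫⁻ x, U.indicator ψ x ∂(ν N) = ∫⁻ x in U, U.indicator ψ x ∂(ν N) := by
          rw [setLIntegral_indicator hUo.measurableSet, inter_self,
            lintegral_indicator hUo.measurableSet]
      _ ≤ ∫⁻ x, U.indicator ψ x ∂lam := lintegral_mono' (hle N) le_rfl
      _ = ∫⁻ x in U, ENNReal.ofReal (χ x)⁻¹ * U.indicator ψ x :=
          lintegral_withDensity_eq_lintegral_mul _ hχm hψ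
      _ = _ := setLIntegral_congr_fun hUo.measurableSet fun x hx => by
          simp only [indicator_of_mem hx, mul_comm]
  rw [← hlm]
  have hsup : ∀ x, ∫⁻ t in Ioi (0 : ℝ), U.indicator ψ (θ t x) =
      ⨆ N : ℕ, ∫⁻ t in Ioc (0 : ℝ) N, U.indicator ψ (θ t x) := fun x => by
    have : Ioi (0 : ℝ) = ⋃ N : ℕ, Ioc (0 : ℝ) N := by
      ext t
      simp only [mem_Ioi, mem_iUnion, mem_Ioc]
      exact ⟨fun ht => (exists_nat_ge t).imp fun N hN => ⟨ht, hN⟩, fun ⟨N, hN⟩ => hN.1⟩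
    rw [this, setLIntegral_iUnion_of_directed]
    exact Monotone.directed_le fun a b hab => Ioc_subset_Ioc_right (by exact_mod_cast hab)
  calc ∫⁻ x, (∫⁻ t in Ici (0 : ℝ), ψ (θ t x)) ∂m
      = ∫⁻ x, (⨆ N : ℕ, ∫⁻ t in Ioc (0 : ℝ) N, U.indicator ψ (θ t x)) ∂m := by
        refine lintegral_congr_ae ?_
        filter_upwards [hmU] with x hx
        rw [← hsup, Measure.restrict_congr_set Ioi_ae_eq_Ici.symm]
        refine lintegral_congr fun t => ?_
        rw [indicator_of_mem (hθU x hx t)]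
    _ = ⨆ N : ℕ, ∫⁻ x, (∫⁻ t in Ioc (0 : ℝ) N, U.indicator ψ (θ t x)) ∂m := by
        refine lintegral_iSup (fun N => (hψ.comp hθm).lintegral_prod_right') fun a b hab x => ?_
        exact lintegral_mono_set (Ioc_subset_Ioc_right (by exact_mod_cast hab))
    _ ≤ _ := iSup_le hfinN

end

/-! ### Change of time on the real line -/

/-- The time elapsed at parameter `r` when the parameter runs with speed `1 / w`. -/
noncomputable def timeChange (w : ℝ → ℝ) (r : ℝ) : ℝ := ∫ y in (0 : ℝ)..r, w y

/-- The parameter at time `t`. -/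
noncomputable def timeChangeInv (w : ℝ → ℝ) (t : ℝ) : ℝ := sInf {r | t ≤ timeChange w r}

section

variable {w : ℝ → ℝ}

theorem hasDerivAt_timeChange (hw : Continuous w) (r : ℝ) :
    HasDerivAt (timeChange w) (w r) r :=
  intervalIntegral.integral_hasDerivAt_right (hw.intervalIntegrable _ _)
    (hw.stronglyMeasurableAtFilter _ _) hw.continuousAt

theorem timeChange_zero : timeChange w 0 = 0 := intervalIntegral.integral_same

theorem strictMono_timeChange (hw : Continuous w) (h0 : ∀ r, 0 < w r) :
    StrictMono (timeChange w) :=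
  strictMono_of_deriv_pos fun r => by rw [(hasDerivAt_timeChange hw r).deriv]; exact h0 r

theorem continuous_timeChange (hw : Continuous w) : Continuous (timeChange w) :=
  continuous_iff_continuousAt.2 fun r => (hasDerivAt_timeChange hw r).continuousAt

theorem timeChangeInv_timeChange (hw : Continuous w) (h0 : ∀ r, 0 < w r) (r : ℝ) :
    timeChangeInv w (timeChange w r) = r := by
  have : {y | timeChange w r ≤ timeChange w y} = Ici r := by
    ext y
    exact (strictMono_timeChange hw h0).le_iff_le
  rw [timeChangeInv, this, csInf_Ici]

/-- Sublevel sets of the inverse are expressed by `timeChange` itself; this gives measurability when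
the weight depends on a parameter. -/
theorem timeChangeInv_le_iff (hw : Continuous w) (h0 : ∀ r, 0 < w r) {t : ℝ}
    (ht : t ∈ range (timeChange w)) (a : ℝ) : timeChangeInv w t ≤ a ↔ t ≤ timeChange w a := by
  obtain ⟨r, rfl⟩ := ht
  rw [timeChangeInv_timeChange hw h0, (strictMono_timeChange hw h0).le_iff_le]

theorem range_timeChange_mem_nhds (hw : Continuous w) (h0 : ∀ r, 0 < w r) (r : ℝ) :
    range (timeChange w) ∈ 𝓝 (timeChange w r) := by
  have hm := strictMono_timeChange hw h0
  refine mem_of_superset (Ioo_mem_nhds (hm (sub_one_lt r)) (hm (lt_add_one r))) ?_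
  exact (intermediate_value_Ioo (by linarith) (continuous_timeChange hw).continuousOn).trans
    (image_subset_range _ _)

theorem hasDerivAt_timeChangeInv (hw : Continuous w) (h0 : ∀ r, 0 < w r) (r : ℝ) :
    HasDerivAt (timeChangeInv w) (w r)⁻¹ (timeChange w r) := by
  have hm := strictMono_timeChange hw h0
  have hinv := timeChangeInv_timeChange hw h0
  have hr := range_timeChange_mem_nhds hw h0 r
  refine HasDerivAt.of_local_left_inverse (f := timeChange w) ?_ ?_ (h0 r).ne' ?_
  · refine StrictMonoOn.continuousAt_of_image_mem_nhds (s := range (timeChange w)) ?_ hr ?_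
    · rintro _ ⟨a, rfl⟩ _ ⟨b, rfl⟩ hab
      rw [hinv, hinv]
      exact hm.lt_iff_lt.1 hab
    · have : timeChangeInv w '' range (timeChange w) = univ :=
        eq_univ_of_forall fun a => ⟨timeChange w a, ⟨a, rfl⟩, hinv a⟩
      rw [this]
      exact univ_mem
  · rw [hinv]
    exact hasDerivAt_timeChange hw r
  · filter_upwards [hr] with t ht
    obtain ⟨a, rfl⟩ := ht
    rw [hinv]

theorem tendsto_timeChange (hwi : IntegrableOn w (Ioi 0)) :
    Tendsto (timeChange w) atTop (𝓝 (∫ r in Ioi 0, w r)) :=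
  intervalIntegral_tendsto_integral_Ioi 0 hwi tendsto_id

theorem timeChange_lt (hw : Continuous w) (h0 : ∀ r, 0 < w r) (hwi : IntegrableOn w (Ioi 0))
    (r : ℝ) : timeChange w r < ∫ y in Ioi 0, w y :=
  ((strictMono_timeChange hw h0) (lt_add_one r)).trans_le
    ((strictMono_timeChange hw h0).monotone.ge_of_tendsto (tendsto_timeChange hwi) _)

/-- The change of time maps `[0, ∞)` onto `[0, T)`. -/
theorem timeChange_image_Ici (hw : Continuous w) (h0 : ∀ r, 0 < w r)
    (hwi : IntegrableOn w (Ioi 0)) : timeChange w '' Ici 0 = Ico 0 (∫ r in Ioi 0, w r) := by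
  have hm := strictMono_timeChange hw h0
  refine Subset.antisymm ?_ ?_
  · rintro _ ⟨r, hr, rfl⟩
    exact ⟨by rw [← timeChange_zero (w := w)]; exact hm.monotone hr, timeChange_lt hw h0 hwi r⟩
  · rintro t ⟨ht0, ht⟩
    obtain ⟨b, hb, hb0⟩ := (((tendsto_timeChange hwi).eventually_const_lt ht).and
      (eventually_ge_atTop 0)).exists
    obtain ⟨r, hr, hrt⟩ := intermediate_value_Icc hb0 (continuous_timeChange hw).continuousOn
      ⟨by rwa [timeChange_zero], hb.le⟩
    exact ⟨r, hr.1, hrt⟩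

theorem exists_timeChange_eq (hw : Continuous w) (h0 : ∀ r, 0 < w r)
    (hwi : IntegrableOn w (Ioi 0)) {t : ℝ} (ht : t ∈ Ico 0 (∫ r in Ioi 0, w r)) :
    ∃ r, 0 ≤ r ∧ timeChange w r = t := by
  rw [← timeChange_image_Ici hw h0 hwi] at ht
  exact ht

theorem tendsto_timeChangeInv (hw : Continuous w) (h0 : ∀ r, 0 < w r)
    (hwi : IntegrableOn w (Ioi 0)) :
    Tendsto (timeChangeInv w) (𝓝[<] (∫ r in Ioi 0, w r)) atTop := by
  refine tendsto_atTop.2 fun a => ?_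
  have h1 : max (timeChange w a) 0 < ∫ r in Ioi 0, w r :=
    max_lt (timeChange_lt hw h0 hwi a) (by
      simpa [timeChange_zero] using timeChange_lt hw h0 hwi 0)
  filter_upwards [Ioo_mem_nhdsLT h1] with t ht
  obtain ⟨r, -, rfl⟩ := exists_timeChange_eq hw h0 hwi
    ⟨(le_max_right _ _).trans ht.1.le, ht.2⟩
  rw [timeChangeInv_timeChange hw h0]
  exact ((strictMono_timeChange hw h0).lt_iff_lt.1 ((le_max_left _ _).trans_lt ht.1)).le

/-- Substitution t = `timeChange w r`: physical time corresponds to dt = w(r) dr. -/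
theorem lintegral_comp_timeChangeInv (hw : Continuous w) (h0 : ∀ r, 0 < w r)
    (hwi : IntegrableOn w (Ioi 0)) (G : ℝ → ℝ≥0∞) :
    ∫⁻ t in Ico 0 (∫ r in Ioi 0, w r), G (timeChangeInv w t) =
      ∫⁻ r in Ici 0, ENNReal.ofReal (w r) * G r := by
  rw [← timeChange_image_Ici hw h0 hwi, lintegral_image_eq_lintegral_abs_deriv_mul
    measurableSet_Ici (fun r _ => (hasDerivAt_timeChange hw r).hasDerivWithinAt)
    (strictMono_timeChange hw h0).injective.injOn]
  refine lintegral_congr fun r => ?_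
  rw [timeChangeInv_timeChange hw h0, abs_of_pos (h0 r)]

end

/-! ### Compact exhaustions of open sets -/

theorem IsOpen.exists_compact_exhaustion {n : ℕ} {U : Set (State n)} (hU : IsOpen U) :
    ∃ C : ℕ → Set (State n), (∀ i, IsCompact (C i)) ∧ (∀ i, C i ⊆ U) ∧
      ∀ A, IsCompact A → A ⊆ U → ∃ i, A ⊆ C i := by
  have : LocallyCompactSpace U := hU.locallyCompactSpace
  let E := CompactExhaustion.choice U
  refine ⟨fun i => Subtype.val '' E i, fun i => (E.isCompact i).image continuous_subtype_val,
    fun i => by rintro _ ⟨x, -, rfl⟩; exact x.2, fun A hA hAU => ?_⟩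
  have hA' : IsCompact (Subtype.val ⁻¹' A : Set U) := by
    rw [Subtype.isCompact_iff, Subtype.image_preimage_coe, inter_eq_right.2 hAU]
    exact hA
  obtain ⟨i, hi⟩ := E.exists_superset_of_isCompact hA'
  exact ⟨i, fun x hx => ⟨⟨x, hAU hx⟩, hi hx, rfl⟩⟩

/-! ### The scaled flux of a feasible pair -/

namespace NavData

variable {n m : ℕ} {P : NavData n m} {k : State n → Fin m → ℝ} {s : ℝ → State n → State n}
  {q : (State n → ℝ) × (State n → Fin m → ℝ)} {χ : State n → ℝ} {θ : ℝ → State n → State n}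

/-- The flux `ρ f + g ρ̄`. -/
noncomputable def flux (P : NavData n m) (q : (State n → ℝ) × (State n → Fin m → ℝ))
    (y : State n) : State n :=
  q.1 y • P.f y + ∑ j, q.2 y j • P.g j y

/-- The feedback `ρ̄ / ρ`. -/
noncomputable def ratio (q : (State n → ℝ) × (State n → Fin m → ℝ)) (y : State n) : Fin m → ℝ :=
  fun j => q.2 y j / q.1 y

/-- The part of `X₁` where `ρ > 0`. -/
def carrier (P : NavData n m) (q : (State n → ℝ) × (State n → Fin m → ℝ)) : Set (State n) :=
  P.X1 ∩ {y | 0 < q.1 y}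

/-- `θ` is the flow of a regularizing multiple `χ` of the flux, supported on `X₁`. -/
structure IsFluxFlow (P : NavData n m) (q : (State n → ℝ) × (State n → Fin m → ℝ))
    (χ : State n → ℝ) (θ : ℝ → State n → State n) : Prop where
  continuous : Continuous χ
  pos : ∀ x ∈ P.X1, 0 < χ x
  zero : ∀ x ∉ P.X1, χ x = 0
  lipschitz : ∃ K, LipschitzWith K fun x => χ x • P.flux q x
  isFlowOn : IsFlowOn (fun x => χ x • P.flux q x) univ θ

/-- The rate of the physical time along the flow of the scaled flux. -/
noncomputable def rate (P : NavData n m) (q : (State n → ℝ) × (State n → Fin m → ℝ))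
    (χ : State n → ℝ) : State n → ℝ :=
  P.X1.indicator fun y => χ y * q.1 y

/-- Initial states from which the flow of the scaled flux leaves `X₁` asymptotically, in finite
physical time. -/
structure Escapes (P : NavData n m) (q : (State n → ℝ) × (State n → Fin m → ℝ))
    (χ : State n → ℝ) (θ : ℝ → State n → State n) (ξ : State n) : Prop where
  mem : ξ ∈ P.X1
  not_tendsto : ∀ y ∈ P.X1, ¬ Tendsto (fun r => θ r ξ) atTop (𝓝 y)
  integrableOn : IntegrableOn (fun r => P.rate q χ (θ r ξ)) (Ioi 0)

namespace Feasible

variable (hq : P.Feasible q)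
include hq

theorem snd_eq_zero {y : State n} (hy : y ∈ P.X1) (h0 : q.1 y = 0) (j : Fin m) : q.2 y j = 0 := by
  have := hq.control_le y hy j
  rw [h0, mul_zero] at this
  exact abs_eq_zero.1 (le_antisymm this (abs_nonneg _))

theorem flux_eq {y : State n} (hy : y ∈ P.X1) :
    P.flux q y = q.1 y • P.field y (ratio q y) := by
  have h : ∀ j, q.1 y * (q.2 y j / q.1 y) = q.2 y j := fun j => by
    by_cases h0 : q.1 y = 0
    · rw [h0, zero_mul, hq.snd_eq_zero hy h0]
    · field_simp
  simp only [flux, field, ratio, smul_add, Finset.smul_sum, smul_smul, h]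

theorem abs_ratio_le {y : State n} (hy : y ∈ P.carrier q) (j : Fin m) :
    |ratio q y j| ≤ P.L j := by
  have h : 0 < q.1 y := hy.2
  rw [ratio, abs_div, abs_of_pos h, div_le_iff₀ h]
  exact hq.control_le y hy.1 j

theorem contDiffOn_flux (hP : P.Standing) : ContDiffOn ℝ 1 (P.flux q) P.X1 :=
  (hq.contDiff_fst.smul (hP.contDiffOn_f.mono X1_subset)).add (ContDiffOn.sum fun j _ =>
    (contDiffOn_pi.1 hq.contDiff_snd j).smul ((hP.contDiffOn_g j).mono X1_subset))

theorem isOpen_carrier (hP : P.Standing) : IsOpen (P.carrier q) :=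
  hq.contDiff_fst.continuousOn.isOpen_inter_preimage hP.isOpen_X1 isOpen_Ioi

theorem contDiffOn_ratio : ContDiffOn ℝ 1 (ratio q) (P.carrier q) :=
  contDiffOn_pi.2 fun j =>
    ((contDiffOn_pi.1 hq.contDiff_snd j).mono inter_subset_left).div
      (hq.contDiff_fst.mono inter_subset_left) fun _ hy => hy.2.ne'

theorem contDiffOn_field (hP : P.Standing) :
    ContDiffOn ℝ 1 (fun y => P.field y (ratio q y)) (P.carrier q) :=
  hP.contDiffOn_field (inter_subset_left.trans X1_subset) hq.contDiffOn_ratio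

theorem exists_isFluxFlow (hP : P.Standing) : ∃ χ θ, P.IsFluxFlow q χ θ := by
  obtain ⟨χ, hχ, hpos, hzero, K, M, hK, hM⟩ :=
    exists_lipschitz_time_change hP.isOpen_X1 (hq.contDiffOn_flux hP)
  obtain ⟨θ, hθ⟩ := exists_isFlowOn_univ hK hM
  exact ⟨χ, θ, hχ, hpos, hzero, ⟨K, hK⟩, hθ⟩

/-- The constraint makes ρ vanish almost everywhere on the obstacle in X₁, so the obstacle meets {ρ
> 0} in a null set. -/
theorem volume_obstacle (hP : P.Standing) : volume (P.Xu ∩ P.carrier q) = 0 := by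
  have hX1 := hP.isOpen_X1.measurableSet
  have hm : AEMeasurable (P.Xu.indicator fun y => ENNReal.ofReal (q.1 y))
      (volume.restrict P.X1) :=
    (hq.contDiff_fst.continuousOn.aemeasurable hX1).ennreal_ofReal.indicator hP.measurableSet_Xu
  have h := hq.obstacle
  rw [lintegral_eq_zero_iff' hm] at h
  have h' := (ae_restrict_iff' hX1).1 h
  refine measure_mono_null (fun y hy => ?_) h'
  simp only [mem_compl_iff, mem_ofPred_eq, Classical.not_imp]
  refine ⟨hy.2.1, ?_⟩
  have : 0 < q.1 y := hy.2.2
  simp [hy.1, this]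

theorem rate_nonneg (hθ : P.IsFluxFlow q χ θ) (y : State n) : 0 ≤ P.rate q χ y :=
  indicator_nonneg (fun y hy => mul_nonneg (hθ.pos y hy).le (hq.nonneg y hy)) y

theorem measurable_rate (hP : P.Standing) (hθ : P.IsFluxFlow q χ θ) : Measurable (P.rate q χ) :=
  measurable_indicator_of_continuousOn hP.isOpen_X1.measurableSet
    (hθ.continuous.continuousOn.mul hq.contDiff_fst.continuousOn)

end Feasible

namespace IsFluxFlow

variable (hθ : P.IsFluxFlow q χ θ)
include hθ

theorem mem_X1 {x : State n} (hx : x ∈ P.X1) (t : ℝ) : θ t x ∈ P.X1 := by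
  obtain ⟨K, hK⟩ := hθ.lipschitz
  exact hθ.isFlowOn.mem_of_forall_notMem hK (fun y hy => by simp [hθ.zero y hy]) hx t

theorem continuous_left (x : State n) : Continuous fun t => θ t x :=
  hθ.isFlowOn.continuous_left (mem_univ x)

theorem measurable_uncurry : Measurable fun p : ℝ × State n => θ p.1 p.2 := by
  obtain ⟨K, hK⟩ := hθ.lipschitz
  exact (hθ.isFlowOn.continuous_uncurry hK).measurable

end IsFluxFlow

end NavData

/-! ### Orbits of the scaled flux reach the neighbourhood of the target -/

namespace NavData

variable {n m : ℕ} {P : NavData n m} {k : State n → Fin m → ℝ} {s : ℝ → State n → State n}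
  {q : (State n → ℝ) × (State n → Fin m → ℝ)} {χ : State n → ℝ} {θ : ℝ → State n → State n}
  {ξ : State n}

/-- Vector fields for controls within the bounds are uniformly bounded on compact sets. -/
theorem Standing.exists_field_bound (hP : P.Standing) {A : Set (State n)} (hA : IsCompact A)
    (hAX : A ⊆ P.X) :
    ∃ B, ∀ y ∈ A, ∀ u : Fin m → ℝ, (∀ j, |u j| ≤ P.L j) → ‖P.field y u‖ ≤ B := by
  obtain ⟨B, hB⟩ := hA.exists_bound_of_continuousOn
    (f := fun y => ‖P.f y‖ + ∑ j, P.L j * ‖P.g j y‖)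
    ((hP.contDiffOn_f.continuousOn.mono hAX).norm.add (continuousOn_finsetSum _ fun j _ =>
      continuousOn_const.mul ((hP.contDiffOn_g j).continuousOn.mono hAX).norm))
  refine ⟨B, fun y hy u hu => le_trans ?_ ((le_abs_self _).trans (hB y hy))⟩
  refine (norm_add_le _ _).trans (add_le_add le_rfl ((norm_sum_le _ _).trans
    (Finset.sum_le_sum fun j _ => ?_)))
  rw [norm_smul, Real.norm_eq_abs]
  exact mul_le_mul_of_nonneg_right (hu j) (norm_nonneg _)

namespace IsFluxFlow

/-- The Liouville constraint says that the flux has divergence h₀, so the estimate of occupation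
measures by 1/χ applies to it. -/
theorem lintegral_le (hθ : P.IsFluxFlow q χ θ) (hP : P.Standing) (hq : P.Feasible q)
    {ψ : State n → ℝ≥0∞} (hψ : Measurable (P.X1.indicator ψ)) :
    ∫⁻ ξ, P.X1.indicator (fun ξ => ∫⁻ r in Ici (0 : ℝ), ψ (θ r ξ)) ξ ∂P.μ0 ≤
      ∫⁻ x in P.X1, ψ x * ENNReal.ofReal (χ x)⁻¹ := by
  obtain ⟨K, hK⟩ := hθ.lipschitz
  have hX1 := hP.isOpen_X1.measurableSet
  refine le_trans (le_of_eq ?_) (IsFlowOn.lintegral_occupation_le hP.isOpen_X1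
    (hq.contDiffOn_flux hP) hθ.continuous hθ.pos hθ.zero hθ.isFlowOn hK
    (fun x hx => hP.h0_nonneg x (X1_subset hx)) (hP.integrableOn_h0.mono_set X1_subset)
    hq.liouville hψ)
  rw [lintegral_μ0 hP.integrableOn_h0]
  have : ∀ x, ENNReal.ofReal (P.h0 x) *
      P.X1.indicator (fun ξ => ∫⁻ r in Ici (0 : ℝ), ψ (θ r ξ)) x =
      P.X1.indicator (fun x => ENNReal.ofReal (P.h0 x) * ∫⁻ r in Ici (0 : ℝ), ψ (θ r x)) x :=
    fun x => by by_cases hx : x ∈ P.X1 <;> simp [hx]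
  simp only [this]
  rw [lintegral_indicator hX1, Measure.restrict_restrict hX1, inter_eq_left.2 X1_subset]

theorem ae_lintegral_lt_top (hθ : P.IsFluxFlow q χ θ) (hP : P.Standing) (hq : P.Feasible q)
    {ψ : State n → ℝ≥0∞} (hψ : Measurable ψ)
    (hfin : ∫⁻ x in P.X1, ψ x * ENNReal.ofReal (χ x)⁻¹ ≠ ⊤) :
    ∀ᵐ ξ ∂P.μ0, ξ ∈ P.X1 → ∫⁻ r in Ici (0 : ℝ), ψ (θ r ξ) < ⊤ := by
  have hX1 := hP.isOpen_X1.measurableSet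
  have hm : Measurable (P.X1.indicator (fun ξ => ∫⁻ r in Ici (0 : ℝ), ψ (θ r ξ))) :=
    (((hψ.comp hθ.measurable_uncurry).comp measurable_swap).lintegral_prod_right').indicator hX1
  have h := ae_lt_top hm ((hθ.lintegral_le hP hq (hψ.indicator hX1)).trans_lt hfin.lt_top).ne
  filter_upwards [h] with ξ hξ hξ1
  rwa [indicator_of_mem hξ1] at hξ

/-- With ψ = χ 1_C the estimate gives at most the volume of C, so ∫ χ 1_C along almost every orbit
is finite. Convergence to a point of X₁, where χ > 0, would make it infinite for some C of the
exhaustion. -/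
theorem ae_not_tendsto (hθ : P.IsFluxFlow q χ θ) (hP : P.Standing) (hq : P.Feasible q) :
    ∀ᵐ ξ ∂P.μ0, ξ ∈ P.X1 → ∀ y ∈ P.X1, ¬ Tendsto (fun r => θ r ξ) atTop (𝓝 y) := by
  have hX1 := hP.isOpen_X1.measurableSet
  obtain ⟨C, hC, hCX, hex⟩ := hP.isOpen_X1.exists_compact_exhaustion
  have h : ∀ i, ∀ᵐ ξ ∂P.μ0, ξ ∈ P.X1 →
      ∫⁻ r in Ici (0 : ℝ), (C i).indicator (fun y => ENNReal.ofReal (χ y)) (θ r ξ) < ⊤ :=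
    fun i => by
    refine hθ.ae_lintegral_lt_top hP hq
      (hθ.continuous.measurable.ennreal_ofReal.indicator (hC i).measurableSet) ?_
    have : ∀ x, (C i).indicator (fun y => ENNReal.ofReal (χ y)) x * ENNReal.ofReal (χ x)⁻¹ =
        (C i).indicator (fun _ => 1) x := fun x => by
      by_cases hx : x ∈ C i
      · have hp := hθ.pos x (hCX i hx)
        simp only [indicator_of_mem hx]
        rw [← ENNReal.ofReal_mul hp.le, mul_inv_cancel₀ hp.ne', ENNReal.ofReal_one]
      · simp [hx]
    simp only [this]
    rw [lintegral_indicator (hC i).measurableSet, setLIntegral_one]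
    exact ((Measure.restrict_apply_le _ _).trans_lt (hC i).measure_lt_top).ne
  filter_upwards [ae_all_iff.2 h] with ξ hξ hξ1 y hy hlim
  obtain ⟨A, hA, hAX, hyA⟩ := exists_compact_subset hP.isOpen_X1 hy
  obtain ⟨i, hi⟩ := hex A hA hyA
  have hχy := hθ.pos y hy
  have h1 := hlim.eventually (isOpen_interior.mem_nhds hAX)
  have h2 := (hθ.continuous.continuousAt.tendsto.comp hlim).eventually_const_lt
    (half_lt_self hχy)
  obtain ⟨r₀, hr₀⟩ := eventually_atTop.1 (h1.and h2)
  refine (hξ i hξ1).ne (top_unique ?_)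
  calc (⊤ : ℝ≥0∞) = ∫⁻ r in Ici (max r₀ 0), ENNReal.ofReal (χ y / 2) := by
        rw [setLIntegral_const, Real.volume_Ici, ENNReal.mul_top]
        simpa using hχy
    _ ≤ ∫⁻ r in Ici (max r₀ 0), (C i).indicator (fun y => ENNReal.ofReal (χ y)) (θ r ξ) := by
        refine setLIntegral_mono' measurableSet_Ici fun r hr => ?_
        have := hr₀ r ((le_max_left _ _).trans hr)
        rw [indicator_of_mem (hi (interior_subset this.1))]
        exact ENNReal.ofReal_le_ofReal this.2.le
    _ ≤ _ := lintegral_mono_set (Ici_subset_Ici.2 (le_max_right _ _))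

/-- With ψ = χρ the estimate gives ∫ ρ < ∞, so the total physical time is finite along almost every
orbit. -/
theorem ae_escapes (hθ : P.IsFluxFlow q χ θ) (hP : P.Standing) (hq : P.Feasible q) :
    ∀ᵐ ξ ∂P.μ0, ξ ∈ P.X1 → P.Escapes q χ θ ξ := by
  have hX1 := hP.isOpen_X1.measurableSet
  have hm := hq.measurable_rate hP hθ
  have h : ∀ᵐ ξ ∂P.μ0, ξ ∈ P.X1 →
      ∫⁻ r in Ici (0 : ℝ), ENNReal.ofReal (P.rate q χ (θ r ξ)) < ⊤ := by
    refine hθ.ae_lintegral_lt_top hP hq (ψ := fun y => ENNReal.ofReal (P.rate q χ y))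
      hm.ennreal_ofReal ?_
    have hfin := hq.integrable.2
    rw [hasFiniteIntegral_iff_ofReal ((ae_restrict_iff' hX1).2
      (Eventually.of_forall hq.nonneg))] at hfin
    refine (le_of_eq (setLIntegral_congr_fun hX1 fun x hx => ?_)).trans_lt hfin |>.ne
    have hp := hθ.pos x hx
    simp only [rate, indicator_of_mem hx]
    rw [← ENNReal.ofReal_mul (mul_nonneg hp.le (hq.nonneg x hx))]
    congr 1
    field_simp
  filter_upwards [h, hθ.ae_not_tendsto hP hq] with ξ h1 h2 hξ
  refine ⟨hξ, h2 hξ, (hm.comp (hθ.continuous_left ξ).measurable).aestronglyMeasurable, ?_⟩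
  rw [hasFiniteIntegral_iff_ofReal (Eventually.of_forall fun r => hq.rate_nonneg hθ _),
    Measure.restrict_congr_set Ioi_ae_eq_Ici]
  exact h1 hξ

end IsFluxFlow

namespace Escapes

/-- Where ρ = 0, the control constraint forces ρ̄ = 0 and the flux vanishes. Such a point is an
equilibrium, and an orbit through it would be constant, hence convergent in X₁. -/
theorem mem_carrier (he : P.Escapes q χ θ ξ) (hθ : P.IsFluxFlow q χ θ) (hq : P.Feasible q)
    (r : ℝ) : θ r ξ ∈ P.carrier q := by
  obtain ⟨K, hK⟩ := hθ.lipschitz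
  have hmem := hθ.mem_X1 he.mem r
  refine ⟨hmem, lt_of_le_of_ne (hq.nonneg _ hmem) fun h0 => ?_⟩
  have hz : χ (θ r ξ) • P.flux q (θ r ξ) = 0 := by rw [hq.flux_eq hmem, ← h0]; simp
  refine he.not_tendsto _ hmem (tendsto_const_nhds.congr fun t => ?_)
  rw [← hθ.isFlowOn.eq_self_of_zero hK hz (t - r), ← hθ.isFlowOn.add_apply hK, sub_add_cancel]

theorem rate_eq (he : P.Escapes q χ θ ξ) (hθ : P.IsFluxFlow q χ θ) (r : ℝ) :
    P.rate q χ (θ r ξ) = χ (θ r ξ) * q.1 (θ r ξ) :=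
  indicator_of_mem (hθ.mem_X1 he.mem r) _

theorem rate_pos (he : P.Escapes q χ θ ξ) (hθ : P.IsFluxFlow q χ θ) (hq : P.Feasible q)
    (r : ℝ) : 0 < P.rate q χ (θ r ξ) := by
  rw [he.rate_eq hθ]
  exact mul_pos (hθ.pos _ (hθ.mem_X1 he.mem r)) (he.mem_carrier hθ hq r).2

theorem continuous_rate (he : P.Escapes q χ θ ξ) (hθ : P.IsFluxFlow q χ θ) (hq : P.Feasible q) :
    Continuous fun r => P.rate q χ (θ r ξ) := by
  simp only [he.rate_eq hθ]
  have hc := hθ.continuous_left ξ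
  exact (hθ.continuous.comp hc).mul
    (hq.contDiff_fst.continuousOn.comp_continuous hc (hθ.mem_X1 he.mem))

theorem hasDerivAt (he : P.Escapes q χ θ ξ) (hθ : P.IsFluxFlow q χ θ) (hq : P.Feasible q)
    (r : ℝ) : HasDerivAt (fun r => θ r ξ)
      (P.rate q χ (θ r ξ) • P.field (θ r ξ) (ratio q (θ r ξ))) r := by
  have h : HasDerivAt (fun r => θ r ξ) (χ (θ r ξ) • P.flux q (θ r ξ)) r :=
    ((hθ.isFlowOn ξ (mem_univ _)).2 r).2
  rwa [hq.flux_eq (hθ.mem_X1 he.mem r), smul_smul, ← he.rate_eq hθ] at h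

end Escapes

/-- The physical time at which the trajectory leaves `X₁`. -/
noncomputable def escapeTime (P : NavData n m) (q : (State n → ℝ) × (State n → Fin m → ℝ))
    (χ : State n → ℝ) (θ : ℝ → State n → State n) (ξ : State n) : ℝ :=
  ∫ r in Ioi 0, P.rate q χ (θ r ξ)

/-- The flow of the scaled flux, in physical time. -/
noncomputable def physicalPath (P : NavData n m) (q : (State n → ℝ) × (State n → Fin m → ℝ))
    (χ : State n → ℝ) (θ : ℝ → State n → State n) (ξ : State n) (t : ℝ) : State n :=
  θ (timeChangeInv (fun r => P.rate q χ (θ r ξ)) t) ξ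

namespace Escapes

variable (he : P.Escapes q χ θ ξ) (hθ : P.IsFluxFlow q χ θ) (hq : P.Feasible q)
include he hθ hq

theorem physicalPath_timeChange (r : ℝ) :
    P.physicalPath q χ θ ξ (timeChange (fun r => P.rate q χ (θ r ξ)) r) = θ r ξ := by
  rw [physicalPath, timeChangeInv_timeChange (he.continuous_rate hθ hq) (he.rate_pos hθ hq)]

theorem exists_timeChange {t : ℝ} (ht : t ∈ Ico 0 (P.escapeTime q χ θ ξ)) :
    ∃ r, 0 ≤ r ∧ timeChange (fun r => P.rate q χ (θ r ξ)) r = t :=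
  exists_timeChange_eq (he.continuous_rate hθ hq) (he.rate_pos hθ hq) he.integrableOn ht

theorem escapeTime_pos : 0 < P.escapeTime q χ θ ξ := by
  simpa [timeChange_zero, escapeTime] using
    timeChange_lt (he.continuous_rate hθ hq) (he.rate_pos hθ hq) he.integrableOn 0

theorem physicalPath_zero : P.physicalPath q χ θ ξ 0 = ξ := by
  have h := he.physicalPath_timeChange hθ hq 0
  rwa [timeChange_zero, (hθ.isFlowOn ξ (mem_univ _)).1] at h

theorem physicalPath_mem (t : ℝ) : P.physicalPath q χ θ ξ t ∈ P.carrier q :=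
  he.mem_carrier hθ hq _

theorem hasDerivAt_physicalPath {t : ℝ} (ht : t ∈ Ico 0 (P.escapeTime q χ θ ξ)) :
    HasDerivAt (P.physicalPath q χ θ ξ)
      (P.field (P.physicalPath q χ θ ξ t) (ratio q (P.physicalPath q χ θ ξ t))) t := by
  obtain ⟨r, -, rfl⟩ := he.exists_timeChange hθ hq ht
  have hi := timeChangeInv_timeChange (he.continuous_rate hθ hq) (he.rate_pos hθ hq) r
  have h1 := hasDerivAt_timeChangeInv (he.continuous_rate hθ hq) (he.rate_pos hθ hq) r
  have h2 := he.hasDerivAt hθ hq r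
  rw [← hi] at h2
  have h3 := h2.scomp _ h1
  rw [hi] at h3
  rw [he.physicalPath_timeChange hθ hq]
  rwa [smul_smul, inv_mul_cancel₀ (he.rate_pos hθ hq r).ne', one_smul] at h3

theorem continuousOn_physicalPath :
    ContinuousOn (P.physicalPath q χ θ ξ) (Ico 0 (P.escapeTime q χ θ ξ)) := fun _ ht =>
  (he.hasDerivAt_physicalPath hθ hq ht).continuousAt.continuousWithinAt

theorem continuousOn_field (hP : P.Standing) :
    ContinuousOn (fun t => P.field (P.physicalPath q χ θ ξ t) (ratio q (P.physicalPath q χ θ ξ t)))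
      (Ico 0 (P.escapeTime q χ θ ξ)) :=
  (hq.contDiffOn_field hP).continuousOn.comp (he.continuousOn_physicalPath hθ hq)
    fun t _ => he.physicalPath_mem hθ hq t

theorem physicalPath_eq_integral (hP : P.Standing) {t : ℝ}
    (ht : t ∈ Ico 0 (P.escapeTime q χ θ ξ)) :
    P.physicalPath q χ θ ξ t = P.physicalPath q χ θ ξ 0 + ∫ τ in (0 : ℝ)..t,
      P.field (P.physicalPath q χ θ ξ τ) (ratio q (P.physicalPath q χ θ ξ τ)) := by
  have hsub : uIcc 0 t ⊆ Ico 0 (P.escapeTime q χ θ ξ) := by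
    rw [uIcc_of_le ht.1]
    exact fun r hr => ⟨hr.1, hr.2.trans_lt ht.2⟩
  rw [intervalIntegral.integral_eq_sub_of_hasDerivAt
    (fun τ hτ => he.hasDerivAt_physicalPath hθ hq (hsub hτ))
    ((he.continuousOn_field hθ hq hP).mono hsub).intervalIntegrable]
  abel

/-- In physical time the path is a solution for the control ρ̄/ρ along it, which respects the
bounds, on an interval of finite length. -/
theorem exists_isCompact (hP : P.Standing) (hesc : P.NoFiniteEscape) :
    ∃ A, IsCompact A ∧ A ⊆ P.X ∧
      ∀ t ∈ Ico 0 (P.escapeTime q χ θ ξ), P.physicalPath q χ θ ξ t ∈ A := by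
  set T := P.escapeTime q χ θ ξ
  set c := P.physicalPath q χ θ ξ
  -- Outside [0, T) the control is set to 0 to have a function measurable on the whole line.
  set u : ℝ → Fin m → ℝ := (Ico 0 T).indicator fun t => ratio q (c t)
  have hu : Measurable u := by
    classical
    have : u = (Ico 0 T).piecewise (fun t => ratio q (c t)) (fun _ => 0) :=
      (piecewise_eq_indicator).symm
    rw [this]
    exact ContinuousOn.measurable_piecewise
      (hq.contDiffOn_ratio.continuousOn.comp (he.continuousOn_physicalPath hθ hq)
        fun t _ => he.physicalPath_mem hθ hq t) continuousOn_const measurableSet_Ico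
  refine hesc T (he.escapeTime_pos hθ hq) u c hu (fun t ht j => ?_)
    (he.continuousOn_physicalPath hθ hq) (fun t _ => X1_subset (he.physicalPath_mem hθ hq t).1)
    fun t ht => ?_
  · simp only [u, indicator_of_mem ht]
    exact hq.abs_ratio_le (he.physicalPath_mem hθ hq t) j
  · refine (he.physicalPath_eq_integral hθ hq hP ht).trans (congrArg (c 0 + ·) ?_)
    refine intervalIntegral.integral_congr fun τ hτ => ?_
    rw [uIcc_of_le ht.1] at hτ
    simp only [u]
    rw [indicator_of_mem (show τ ∈ Ico 0 T from ⟨hτ.1, hτ.2.trans_lt ht.2⟩)]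

/-- The speed in the parameter r is the rate times a field that is bounded on the compact set; the
rate is integrable, so the orbit has finite length and converges. The limit stays in X but cannot be
in X₁. -/
theorem exists_limit (hP : P.Standing) (hesc : P.NoFiniteEscape) :
    ∃ y ∈ P.nbhd, Tendsto (fun r => θ r ξ) atTop (𝓝 y) := by
  obtain ⟨A, hA, hAX, hcA⟩ := he.exists_isCompact hθ hq hP hesc
  have hθA : ∀ r, 0 ≤ r → θ r ξ ∈ A := fun r hr => by
    rw [← he.physicalPath_timeChange hθ hq r]
    refine hcA _ ⟨?_, timeChange_lt (he.continuous_rate hθ hq) (he.rate_pos hθ hq)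
      he.integrableOn r⟩
    rw [← timeChange_zero (w := fun r => P.rate q χ (θ r ξ))]
    exact (strictMono_timeChange (he.continuous_rate hθ hq) (he.rate_pos hθ hq)).monotone hr
  obtain ⟨B, hB⟩ := hP.exists_field_bound hA hAX
  have hFc : Continuous fun r => P.rate q χ (θ r ξ) • P.field (θ r ξ) (ratio q (θ r ξ)) :=
    (he.continuous_rate hθ hq).smul ((hq.contDiffOn_field hP).continuousOn.comp_continuous
      (hθ.continuous_left ξ) (he.mem_carrier hθ hq))
  have hint : IntegrableOn (fun r => P.rate q χ (θ r ξ) • P.field (θ r ξ) (ratio q (θ r ξ)))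
      (Ioi 0) := by
    refine Integrable.mono' (he.integrableOn.mul_const B) hFc.aestronglyMeasurable
      ((ae_restrict_iff' measurableSet_Ioi).2 (Eventually.of_forall fun r hr => ?_))
    rw [norm_smul, Real.norm_eq_abs, abs_of_pos (he.rate_pos hθ hq r)]
    exact mul_le_mul_of_nonneg_left (hB _ (hθA r (le_of_lt hr)) _ fun j =>
      hq.abs_ratio_le (he.mem_carrier hθ hq r) j) (he.rate_pos hθ hq r).le
  have hlim := tendsto_limUnder_of_hasDerivAt_of_integrableOn_Ioi
    (fun r _ => he.hasDerivAt hθ hq r) hint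
  set y := limUnder atTop fun r => θ r ξ
  have hyA : y ∈ A := hA.isClosed.mem_of_tendsto hlim (eventually_ge_atTop (0 : ℝ) |>.mono hθA)
  exact ⟨y, (mem_X1_or_nbhd (hAX hyA)).resolve_left fun h => he.not_tendsto y h hlim, hlim⟩

end Escapes

end NavData

/-! ### Joining the flux path to the local feedback -/

namespace NavData

variable {n m : ℕ} {P : NavData n m} {k : State n → Fin m → ℝ} {s : ℝ → State n → State n}
  {q : (State n → ℝ) × (State n → Fin m → ℝ)} {χ : State n → ℝ} {θ : ℝ → State n → State n}
  {ξ y : State n}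

/-- The trajectory that follows the flux until it arrives at `y`, and the local feedback from
there on. -/
noncomputable def joinedPath (P : NavData n m) (q : (State n → ℝ) × (State n → Fin m → ℝ))
    (χ : State n → ℝ) (θ s : ℝ → State n → State n) (ξ y : State n) (t : ℝ) : State n :=
  if t < P.escapeTime q χ θ ξ then P.physicalPath q χ θ ξ t else s (t - P.escapeTime q χ θ ξ) y

theorem recovered_of_mem {x : State n} (hx : x ∈ P.X1) : P.recovered k q x = ratio q x := by
  rw [recovered, if_pos hx]
  rfl

theorem recovered_of_nbhd {x : State n} (hx : x ∈ P.nbhd) : P.recovered k q x = k x :=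
  if_neg (notMem_X1_of_nbhd hx)

theorem joinedPath_of_lt {t : ℝ} (ht : t < P.escapeTime q χ θ ξ) :
    P.joinedPath q χ θ s ξ y t = P.physicalPath q χ θ ξ t := if_pos ht

theorem joinedPath_of_le {t : ℝ} (ht : P.escapeTime q χ θ ξ ≤ t) :
    P.joinedPath q χ θ s ξ y t = s (t - P.escapeTime q χ θ ξ) y := if_neg (not_lt.2 ht)

namespace LocallyStable

variable (hl : P.LocallyStable k s) (hy : y ∈ P.nbhd)
include hl hy

theorem joinedPath_mem_nbhd {t : ℝ} (ht : P.escapeTime q χ θ ξ ≤ t) :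
    P.joinedPath q χ θ s ξ y t ∈ P.nbhd := by
  rw [joinedPath_of_le ht]
  exact (hl y hy).2.1 _ (sub_nonneg.2 ht)

theorem tendsto_joinedPath :
    Tendsto (fun t => Metric.infDist (P.joinedPath q χ θ s ξ y t) P.XT) atTop (𝓝 0) := by
  have h := ((hl y hy).2.2).comp
    (tendsto_atTop_add_const_right atTop (-P.escapeTime q χ θ ξ) tendsto_id)
  refine h.congr' ?_
  filter_upwards [eventually_ge_atTop (P.escapeTime q χ θ ξ)] with t ht
  rw [joinedPath_of_le ht]
  simp [sub_eq_add_neg]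

end LocallyStable

namespace Escapes

variable (he : P.Escapes q χ θ ξ) (hθ : P.IsFluxFlow q χ θ) (hq : P.Feasible q)
include he hθ hq

theorem joinedPath_mem_carrier {t : ℝ} (ht : t < P.escapeTime q χ θ ξ) :
    P.joinedPath q χ θ s ξ y t ∈ P.carrier q := by
  rw [joinedPath_of_lt ht]
  exact he.physicalPath_mem hθ hq t

theorem joinedPath_mem (hl : P.LocallyStable k s) (hy : y ∈ P.nbhd) (t : ℝ) :
    P.joinedPath q χ θ s ξ y t ∈ P.X := by
  rcases lt_or_ge t (P.escapeTime q χ θ ξ) with h | h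
  · exact X1_subset (he.joinedPath_mem_carrier hθ hq h).1
  · exact (hl.joinedPath_mem_nbhd hy h).1

theorem pos_of_joinedPath_mem (hl : P.LocallyStable k s) (hy : y ∈ P.nbhd) {t : ℝ}
    (ht : P.joinedPath q χ θ s ξ y t ∈ P.X1) : 0 < q.1 (P.joinedPath q χ θ s ξ y t) := by
  rcases lt_or_ge t (P.escapeTime q χ θ ξ) with h | h
  · exact (he.joinedPath_mem_carrier hθ hq h).2
  · exact absurd ht (notMem_X1_of_nbhd (hl.joinedPath_mem_nbhd hy h))

theorem abs_recovered_joinedPath_le (hl : P.LocallyStable k s) (hy : y ∈ P.nbhd) (t : ℝ)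
    (j : Fin m) : |P.recovered k q (P.joinedPath q χ θ s ξ y t) j| ≤ P.L j := by
  rcases lt_or_ge t (P.escapeTime q χ θ ξ) with h | h
  · have hc := he.joinedPath_mem_carrier (s := s) (y := y) hθ hq h
    rw [recovered_of_mem hc.1]
    exact hq.abs_ratio_le hc j
  · have hc := hl.joinedPath_mem_nbhd (q := q) (χ := χ) (θ := θ) (ξ := ξ) hy h
    rw [recovered_of_nbhd hc]
    exact (hl _ hc).1 j

theorem continuousOn_joinedPath (hks : P.IsFeedback k s) (hy : y ∈ P.nbhd)
    (hlim : Tendsto (fun r => θ r ξ) atTop (𝓝 y)) :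
    ContinuousOn (P.joinedPath q χ θ s ξ y) (Ici 0) := by
  intro t ht
  have hsy := (hks.2.continuous_left hy.1).comp
    (continuous_id.sub (continuous_const (y := P.escapeTime q χ θ ξ)))
  refine ContinuousAt.continuousWithinAt ?_
  rcases lt_trichotomy t (P.escapeTime q χ θ ξ) with h | h | h
  · refine (he.hasDerivAt_physicalPath hθ hq ⟨ht, h⟩).continuousAt.congr ?_
    filter_upwards [eventually_lt_nhds h] with τ hτ
    exact (joinedPath_of_lt hτ).symm
  -- At the junction, physical time tending to the escape time from below means r → ∞, so the left
  -- limit is y, where the local trajectory starts.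
  · have hval : P.joinedPath q χ θ s ξ y t = y := by
      rw [joinedPath_of_le h.ge, h, sub_self, (hks.2 y hy.1).1]
    rw [continuousAt_iff_continuous_left'_right']
    constructor
    · rw [ContinuousWithinAt, hval, h]
      refine (hlim.comp (tendsto_timeChangeInv (he.continuous_rate hθ hq) (he.rate_pos hθ hq)
        he.integrableOn)).congr' ?_
      filter_upwards [self_mem_nhdsWithin] with τ hτ
      exact (joinedPath_of_lt hτ).symm
    · refine (hsy.continuousAt (x := t)).continuousWithinAt.congr (fun τ hτ => ?_) ?_
      · exact joinedPath_of_le (h.ge.trans (le_of_lt hτ))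
      · exact joinedPath_of_le h.ge
  · refine (hsy.continuousAt (x := t)).congr ?_
    filter_upwards [eventually_gt_nhds h] with τ hτ
    exact (joinedPath_of_le (le_of_lt hτ)).symm

theorem hasDerivAt_joinedPath (hks : P.IsFeedback k s) (hl : P.LocallyStable k s)
    (hy : y ∈ P.nbhd) {t : ℝ} (ht : 0 ≤ t) (ht' : t ≠ P.escapeTime q χ θ ξ) :
    HasDerivAt (P.joinedPath q χ θ s ξ y) (P.field (P.joinedPath q χ θ s ξ y t)
      (P.recovered k q (P.joinedPath q χ θ s ξ y t))) t := by
  rcases lt_or_gt_of_ne ht' with h | h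
  · have hc := he.joinedPath_mem_carrier (s := s) (y := y) hθ hq h
    rw [recovered_of_mem hc.1, joinedPath_of_lt h]
    refine (he.hasDerivAt_physicalPath hθ hq ⟨ht, h⟩).congr_of_eventuallyEq ?_
    filter_upwards [eventually_lt_nhds h] with τ hτ
    exact joinedPath_of_lt hτ
  · have hc := hl.joinedPath_mem_nbhd (q := q) (χ := χ) (θ := θ) (ξ := ξ) hy (le_of_lt h)
    rw [recovered_of_nbhd hc, joinedPath_of_le (le_of_lt h)]
    refine HasDerivAt.congr_of_eventuallyEq (f := fun τ => s (τ - P.escapeTime q χ θ ξ) y)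
      (((hks.2 y hy.1).2 _).2.comp_sub_const t _) ?_
    filter_upwards [eventually_gt_nhds h] with τ hτ
    exact joinedPath_of_le (le_of_lt hτ)

theorem joinedPath_zero : P.joinedPath q χ θ s ξ y 0 = ξ := by
  rw [joinedPath_of_lt (he.escapeTime_pos hθ hq), he.physicalPath_zero hθ hq]

/-- The feedback may jump at the junction, so the fundamental theorem of calculus is used with one
exceptional time. The velocity is integrable because it is bounded before the junction and
continuous after it. -/
theorem joinedPath_eq_integral (hP : P.Standing) (hesc : P.NoFiniteEscape)
    (hks : P.IsFeedback k s) (hl : P.LocallyStable k s) (hy : y ∈ P.nbhd)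
    (hlim : Tendsto (fun r => θ r ξ) atTop (𝓝 y)) {t : ℝ} (ht : 0 ≤ t) :
    P.joinedPath q χ θ s ξ y t = ξ + ∫ τ in (0 : ℝ)..t, P.field (P.joinedPath q χ θ s ξ y τ)
      (P.recovered k q (P.joinedPath q χ θ s ξ y τ)) := by
  set T := P.escapeTime q χ θ ξ with hT
  set F : ℝ → State n := fun τ => P.field (P.joinedPath q χ θ s ξ y τ)
      (P.recovered k q (P.joinedPath q χ θ s ξ y τ)) with hF
  have hTpos := he.escapeTime_pos hθ hq
  have h1 : IntegrableOn F (Ico 0 T) := by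
    obtain ⟨A, hA, hAX, hcA⟩ := he.exists_isCompact hθ hq hP hesc
    obtain ⟨B, hB⟩ := hP.exists_field_bound hA hAX
    have hc : ContinuousOn F (Ico 0 T) := by
      refine (he.continuousOn_field hθ hq hP).congr fun τ hτ => ?_
      simp only [hF]
      rw [recovered_of_mem (he.joinedPath_mem_carrier hθ hq hτ.2).1, joinedPath_of_lt hτ.2]
    refine Integrable.of_bound (hc.aestronglyMeasurable measurableSet_Ico) B
      ((ae_restrict_iff' measurableSet_Ico).2 (Eventually.of_forall fun τ hτ => hB _ ?_ _ ?_))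
    · rw [joinedPath_of_lt hτ.2]
      exact hcA τ hτ
    · exact he.abs_recovered_joinedPath_le hθ hq hl hy τ
  have h2 : IntegrableOn F (Icc T (max t T)) := by
    refine ContinuousOn.integrableOn_Icc ?_
    have hc : ContinuousOn (fun τ => P.field (s (τ - T) y) (k (s (τ - T) y))) (Icc T (max t T)) :=
      ((hP.contDiffOn_field subset_rfl hks.1).continuousOn.comp_continuous
        ((hks.2.continuous_left hy.1).comp (continuous_id.sub continuous_const))
        fun τ => ((hks.2 y hy.1).2 _).1).continuousOn
    refine hc.congr fun τ hτ => ?_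
    simp only [hF]
    rw [recovered_of_nbhd (hl.joinedPath_mem_nbhd hy hτ.1), joinedPath_of_le hτ.1]
  have hi : IntervalIntegrable F volume 0 t := by
    rw [intervalIntegrable_iff_integrableOn_Icc_of_le ht]
    refine (h1.union h2).mono_set fun τ hτ => ?_
    rcases lt_or_ge τ T with h | h
    · exact Or.inl ⟨hτ.1, h⟩
    · exact Or.inr ⟨h, hτ.2.trans (le_max_left _ _)⟩
  rw [integral_eq_of_hasDerivAt_off_countable_of_le (P.joinedPath q χ θ s ξ y) F ht
    (countable_singleton T) ((he.continuousOn_joinedPath hθ hq hks hy hlim).mono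
      Icc_subset_Ici_self) (fun τ hτ => he.hasDerivAt_joinedPath hθ hq hks hl hy hτ.1.1.le hτ.2) hi,
    he.joinedPath_zero hθ hq]
  abel

end Escapes

/-- At every time, almost no trajectory along the flux is in the obstacle. -/
theorem Feasible.volume_obstacle_physicalPath (hq : P.Feasible q) (hP : P.Standing)
    (hθ : P.IsFluxFlow q χ θ) (t : ℝ) :
    volume {ξ | P.Escapes q χ θ ξ ∧ t ∈ Ico 0 (P.escapeTime q χ θ ξ) ∧
      P.physicalPath q χ θ ξ t ∈ P.Xu} = 0 := by
  obtain ⟨C, hC, hCX, hex⟩ := (hq.isOpen_carrier hP).exists_compact_exhaustion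
  choose Y K Θ hK hΘ W hWo hCW hWX hYW using fun i =>
    exists_cutoff_flow (hq.isOpen_carrier hP) (hC i) (hCX i) (hq.contDiffOn_field hP)
  -- A path that stays in the compact set Cᵢ up to time t follows the Lipschitz flow Θᵢ; if it ends
  -- in the obstacle, its initial state lies in the backward image of a null set. Countably many i
  -- cover all paths.
  have hnull : ∀ i, volume (Θ i (-t) '' (P.Xu ∩ P.carrier q)) = 0 := fun i =>
    ((hΘ i).lipschitzWith (hK i) (-t)).lipschitzOnWith.volume_image_eq_zero
      (hq.volume_obstacle hP)
  refine measure_mono_null ?_ (measure_iUnion_null hnull)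
  rintro ξ ⟨he, ht, hu⟩
  have hsub : Icc 0 t ⊆ Ico 0 (P.escapeTime q χ θ ξ) := fun r hr => ⟨hr.1, hr.2.trans_lt ht.2⟩
  have hcont := (he.continuousOn_physicalPath hθ hq).mono hsub
  obtain ⟨i, hi⟩ := hex _ (isCompact_Icc.image_of_continuousOn hcont) (by
    rintro _ ⟨r, -, rfl⟩
    exact he.physicalPath_mem hθ hq r)
  have h1 := (hΘ i).eq_of_solution (hK i) hcont (fun r hr => by
    rw [hYW i _ (hCW i (hi (mem_image_of_mem _ ⟨hr.1, hr.2.le⟩)))]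
    exact (he.hasDerivAt_physicalPath hθ hq (hsub ⟨hr.1, hr.2.le⟩)).hasDerivWithinAt)
    (right_mem_Icc.2 ht.1)
  rw [he.physicalPath_zero hθ hq] at h1
  refine mem_iUnion.2 ⟨i, _, ⟨hu, he.physicalPath_mem hθ hq t⟩, ?_⟩
  rw [h1, (hΘ i).neg_apply_apply (hK i)]

end NavData

/-! ### Admissible trajectories from a feasible pair -/

namespace NavData

variable {n m : ℕ} {P : NavData n m} {k : State n → Fin m → ℝ} {s : ℝ → State n → State n}
  {q : (State n → ℝ) × (State n → Fin m → ℝ)} {χ : State n → ℝ} {θ : ℝ → State n → State n}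
  {ξ : State n} {x : ℝ → State n → State n}

/-- The trajectory from `ξ` follows the flux, and the flow `s` near the target. -/
def FollowsFlux (P : NavData n m) (q : (State n → ℝ) × (State n → Fin m → ℝ))
    (χ : State n → ℝ) (θ s x : ℝ → State n → State n) (ξ : State n) : Prop :=
  (P.Escapes q χ θ ξ ∧ ∃ y ∈ P.nbhd, Tendsto (fun r => θ r ξ) atTop (𝓝 y) ∧
    ∀ t, x t ξ = P.joinedPath q χ θ s ξ y t) ∨ (ξ ∈ P.nbhd ∧ ∀ t, x t ξ = s t ξ)

/-- The path is assembled from jointly measurable flows; the point to check is that escape time and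
inverse time change depend measurably on the initial state. -/
theorem aemeasurable_joinedPath (hP : P.Standing) (hθ : P.IsFluxFlow q χ θ) (hq : P.Feasible q)
    (hks : P.IsFeedback k s) {E : Set (State n)} (hE : MeasurableSet E)
    (hEe : ∀ ξ ∈ E, P.Escapes q χ θ ξ) {y : State n → State n} (hy : Measurable y)
    (hyX : ∀ ξ ∈ E, y ξ ∈ P.X) {x : ℝ → State n → State n}
    (hxE : ∀ ξ ∈ E, ∀ t, x t ξ = P.joinedPath q χ θ s ξ (y ξ) t)
    (hx : ∀ ξ ∉ E, ∀ t, x t ξ = s t ξ) :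
    AEMeasurable (fun p : ℝ × State n => x p.1 p.2)
      ((volume.restrict (Ici (0 : ℝ))).prod P.μ0) := by
  classical
  have := isFiniteMeasure_μ0 hP.integrableOn_h0
  have hrate : StronglyMeasurable fun p : State n × ℝ => P.rate q χ (θ p.2 p.1) :=
    ((hq.measurable_rate hP hθ).comp
      (hθ.measurable_uncurry.comp measurable_swap)).stronglyMeasurable
  have hT : Measurable (P.escapeTime q χ θ) := hrate.integral_prod_right.measurable
  have htc : ∀ a, Measurable fun ξ => timeChange (fun r => P.rate q χ (θ r ξ)) a := fun a => by
    simp only [timeChange, intervalIntegral]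
    exact hrate.integral_prod_right.measurable.sub hrate.integral_prod_right.measurable
  set D : Set (ℝ × State n) := {p | p.2 ∈ E ∧ 0 ≤ p.1 ∧ p.1 < P.escapeTime q χ θ p.2} with hD
  have hDm : MeasurableSet D := (measurable_snd hE).inter
    ((measurableSet_le measurable_const measurable_fst).inter
      (measurableSet_lt measurable_fst (hT.comp measurable_snd)))
  set σ : ℝ × State n → ℝ :=
    D.indicator fun p => timeChangeInv (fun r => P.rate q χ (θ r p.2)) p.1 with hσ
  have hσm : Measurable σ := by
    refine measurable_of_Iic fun a => ?_
    -- On D the sublevel set is read off from the time change itself. Off D the default value is 0,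
    -- whence the condition 0 ≤ a.
    have : σ ⁻¹' Iic a = (D ∩ {p | p.1 ≤ timeChange (fun r => P.rate q χ (θ r p.2)) a}) ∪
        (Dᶜ ∩ {_p | 0 ≤ a}) := by
      ext p
      by_cases hp : p ∈ D
      · have he := hEe _ hp.1
        obtain ⟨r, -, hr⟩ := he.exists_timeChange hθ hq hp.2
        have := timeChangeInv_le_iff (he.continuous_rate hθ hq) (he.rate_pos hθ hq)
          (t := p.1) ⟨r, hr⟩ a
        simp [hσ, hp, this]
      · simp [hσ, hp]
    rw [this]
    exact (hDm.inter (measurableSet_le measurable_fst ((htc a).comp measurable_snd))).union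
      (hDm.compl.inter (MeasurableSet.const _))
  have hs := hks.2.measurable_extendFlow hP.isOpen_X (hP.contDiffOn_field subset_rfl hks.1)
  have hz : Measurable fun p : ℝ × State n => if p ∈ D then θ (σ p) p.2 else
      if p.2 ∈ E then extendFlow P.X s (p.1 - P.escapeTime q χ θ p.2) (y p.2)
      else extendFlow P.X s p.1 p.2 :=
    Measurable.ite hDm (hθ.measurable_uncurry.comp (hσm.prodMk measurable_snd))
      (Measurable.ite (measurable_snd hE)
        (hs.comp ((measurable_fst.sub (hT.comp measurable_snd)).prodMk (hy.comp measurable_snd)))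
        hs)
  refine ⟨_, hz, ?_⟩
  filter_upwards [Measure.quasiMeasurePreserving_fst.ae (ae_restrict_mem measurableSet_Ici),
    Measure.quasiMeasurePreserving_snd.ae (ae_mem_X hP.isOpen_X)] with p hp hpX
  by_cases hpE : p.2 ∈ E
  · rw [hxE _ hpE]
    by_cases hpT : p.1 < P.escapeTime q χ θ p.2
    · have hpD : p ∈ D := ⟨hpE, hp, hpT⟩
      rw [if_pos hpD, joinedPath_of_lt hpT]
      simp only [hσ, indicator_of_mem hpD, physicalPath]
    · rw [if_neg fun h => hpT h.2.2, if_pos hpE, joinedPath_of_le (not_lt.1 hpT),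
        extendFlow_of_mem _ (hyX _ hpE)]
  · rw [if_neg fun h => hpE h.1, if_neg hpE, hx _ hpE, extendFlow_of_mem _ hpX]

theorem Feasible.exists_followsFlux (hq : P.Feasible q) (hP : P.Standing)
    (hesc : P.NoFiniteEscape) (hks : P.IsFeedback k s) (hθ : P.IsFluxFlow q χ θ) :
    ∃ x : ℝ → State n → State n, AEMeasurable (fun p : ℝ × State n => x p.1 p.2)
      ((volume.restrict (Ici (0 : ℝ))).prod P.μ0) ∧ ∀ᵐ ξ ∂P.μ0, P.FollowsFlux q χ θ s x ξ := by
  classical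
  obtain ⟨A, hA, hAm, hAp⟩ :=
    ((ae_mem_X hP.isOpen_X).and (hθ.ae_escapes hP hq)).exists_measurable_mem
  set E := A ∩ P.X1 with hE
  have hEm : MeasurableSet E := hAm.inter hP.isOpen_X1.measurableSet
  have hEe : ∀ ξ ∈ E, P.Escapes q χ θ ξ := fun ξ hξ => (hAp ξ hξ.1).2 hξ.2
  have hex : ∀ ξ, ∃ y, (ξ ∈ E → y ∈ P.nbhd ∧ Tendsto (fun r => θ r ξ) atTop (𝓝 y)) ∧
      (ξ ∉ E → y = 0) := fun ξ => by
    by_cases hξ : ξ ∈ E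
    · obtain ⟨y, hy, hlim⟩ := (hEe ξ hξ).exists_limit hθ hq hP hesc
      exact ⟨y, fun _ => ⟨hy, hlim⟩, fun h => absurd hξ h⟩
    · exact ⟨0, fun h => absurd h hξ, fun _ => rfl⟩
  choose y hyE hy0 using hex
  -- The limit points were chosen state by state, but y is the pointwise limit of the maps θ_N on E,
  -- extended by 0, hence measurable.
  have hym : Measurable y := by
    refine measurable_of_tendsto_metrizable (f := fun N : ℕ => E.indicator (θ N)) (fun N =>
      (hθ.measurable_uncurry.comp measurable_prodMk_left).indicator hEm)
      (tendsto_pi_nhds.2 fun ξ => ?_)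
    by_cases hξ : ξ ∈ E
    · simp only [indicator_of_mem hξ]
      exact (hyE ξ hξ).2.comp tendsto_natCast_atTop_atTop
    · simp only [indicator_of_notMem hξ, hy0 ξ hξ]
      exact tendsto_const_nhds
  refine ⟨fun t ξ => if ξ ∈ E then P.joinedPath q χ θ s ξ (y ξ) t else s t ξ,
    aemeasurable_joinedPath hP hθ hq hks hEm hEe hym (fun ξ hξ => (hyE ξ hξ).1.1)
      (fun ξ hξ t => if_pos hξ) fun ξ hξ t => if_neg hξ, ?_⟩
  filter_upwards [hA] with ξ hξ
  rcases mem_X1_or_nbhd (hAp ξ hξ).1 with h | h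
  · have hξE : ξ ∈ E := ⟨hξ, h⟩
    exact Or.inl ⟨hEe ξ hξE, y ξ, (hyE ξ hξE).1, (hyE ξ hξE).2, fun t => if_pos hξE⟩
  · exact Or.inr ⟨h, fun t => if_neg fun h' => notMem_X1_of_nbhd h h'.2⟩

/-- After the escape time the path is outside X₁ and contributes nothing; before it, dt = χρ dr. -/
theorem Escapes.lintegral_joinedPath (he : P.Escapes q χ θ ξ) (hθ : P.IsFluxFlow q χ θ)
    (hq : P.Feasible q) (hl : P.LocallyStable k s) {y : State n} (hy : y ∈ P.nbhd)
    (G : State n → ℝ≥0∞) :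
    ∫⁻ t in Ici (0 : ℝ), P.X1.indicator G (P.joinedPath q χ θ s ξ y t) =
      ∫⁻ r in Ici (0 : ℝ), ENNReal.ofReal (P.rate q χ (θ r ξ)) * G (θ r ξ) := by
  have hT := he.escapeTime_pos hθ hq
  rw [← Ico_union_Ici_eq_Ici hT.le, lintegral_union measurableSet_Ici
    (disjoint_left.2 fun t h1 h2 => absurd h1.2 (not_lt.2 h2)),
    setLIntegral_congr_fun (g := fun _ => 0) measurableSet_Ici fun t ht =>
      indicator_of_notMem (notMem_X1_of_nbhd (hl.joinedPath_mem_nbhd hy ht)) _,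
    lintegral_zero, add_zero, setLIntegral_congr_fun
      (g := fun t => G (θ (timeChangeInv (fun r => P.rate q χ (θ r ξ)) t) ξ)) measurableSet_Ico
      fun t ht => by
        rw [indicator_of_mem (he.joinedPath_mem_carrier hθ hq ht.2).1, joinedPath_of_lt ht.2]
        rfl, Ico_union_Ici_eq_Ici hT.le]
  exact lintegral_comp_timeChangeInv (he.continuous_rate hθ hq) (he.rate_pos hθ hq)
    he.integrableOn fun r => G (θ r ξ)

/-- Time integrals outside the neighbourhood of the target are bounded by integrals against the
density. -/
theorem Feasible.lintegral_followsFlux_le (hq : P.Feasible q) (hP : P.Standing)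
    (hl : P.LocallyStable k s) (hθ : P.IsFluxFlow q χ θ)
    (hx : ∀ᵐ ξ ∂P.μ0, P.FollowsFlux q χ θ s x ξ) {G : State n → ℝ≥0∞}
    (hG : Measurable (P.X1.indicator G)) :
    ∫⁻ ξ, (∫⁻ t in Ici (0 : ℝ), P.X1.indicator G (x t ξ)) ∂P.μ0 ≤
      ∫⁻ y in P.X1, ENNReal.ofReal (q.1 y) * G y := by
  have hX1 := hP.isOpen_X1.measurableSet
  have hψ : Measurable (P.X1.indicator fun y => ENNReal.ofReal (P.rate q χ y) * G y) := by
    convert (hq.measurable_rate hP hθ).ennreal_ofReal.mul hG using 1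
    funext y
    by_cases hy : y ∈ P.X1 <;> simp [hy]
  -- The occupation estimate is applied to ψ = χρ G, for which ψ/χ = ρ G. Trajectories starting in
  -- the neighbourhood contribute nothing.
  refine le_trans (lintegral_mono_ae ?_) ((hθ.lintegral_le hP hq hψ).trans_eq
    (setLIntegral_congr_fun hX1 fun y hy => ?_))
  · filter_upwards [hx] with ξ hξ
    rcases hξ with ⟨he, y, hy, -, hxy⟩ | ⟨h, hxs⟩
    · rw [indicator_of_mem he.mem]
      simp only [hxy]
      exact (he.lintegral_joinedPath hθ hq hl hy G).le
    · rw [setLIntegral_congr_fun (g := fun _ => 0) measurableSet_Ici fun t ht => by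
        rw [hxs, indicator_of_notMem (notMem_X1_of_nbhd ((hl ξ h).2.1 t ht))], lintegral_zero]
      exact zero_le
  · have hp := hθ.pos y hy
    simp only [rate, indicator_of_mem hy]
    rw [mul_right_comm, ← ENNReal.ofReal_mul (mul_nonneg hp.le (hq.nonneg y hy))]
    congr 2
    field_simp

theorem Feasible.measurable_indicator_ratio (hq : P.Feasible q) (hP : P.Standing) (j : Fin m) :
    Measurable (P.X1.indicator fun x => ratio q x j) := by
  have hX1 := hP.isOpen_X1.measurableSet
  have h := (measurable_indicator_of_continuousOn hX1
    (contDiffOn_pi.1 hq.contDiff_snd j).continuousOn).div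
    (measurable_indicator_of_continuousOn hX1 hq.contDiff_fst.continuousOn)
  convert h using 1
  funext y
  by_cases hy : y ∈ P.X1 <;> simp [hy, ratio]

theorem Feasible.cost_followsFlux_le (hq : P.Feasible q) (hP : P.Standing)
    (hl : P.LocallyStable k s) (hθ : P.IsFluxFlow q χ θ)
    (hx : ∀ᵐ ξ ∂P.μ0, P.FollowsFlux q χ θ s x ξ) :
    P.cost x (fun t ξ => P.recovered k q (x t ξ)) ≤ P.programCost q := by
  have hX1 := hP.isOpen_X1.measurableSet
  have h1 : ∀ z, P.X1.indicator
      (fun y => ENNReal.ofReal (P.runningCost y (P.recovered k q z))) z =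
      P.X1.indicator (fun y => ENNReal.ofReal (P.runningCost y (ratio q y))) z := fun z => by
    by_cases hz : z ∈ P.X1
    · simp only [indicator_of_mem hz, recovered_of_mem hz]
    · simp only [indicator_of_notMem hz]
  simp only [cost, h1]
  refine (hq.lintegral_followsFlux_le hP hl hθ hx (measurable_indicator_runningCost hP hX1
    (hq.measurable_indicator_ratio hP))).trans_eq (setLIntegral_congr_fun hX1 fun y hy => ?_)
  have h0 := hq.nonneg y hy
  have h2 : ∀ j, q.1 y * |ratio q y j| = |q.2 y j| := fun j => by
    rw [ratio, abs_div, abs_of_nonneg h0]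
    by_cases hz : q.1 y = 0
    · rw [hz, hq.snd_eq_zero hy hz]
      simp
    · field_simp
  rw [← ENNReal.ofReal_mul h0, runningCost]
  congr 1
  simp only [← h2, ← Finset.mul_sum]
  ring

theorem Feasible.traversal_followsFlux_le (hq : P.Feasible q) (hP : P.Standing)
    (hl : P.LocallyStable k s) (hθ : P.IsFluxFlow q χ θ)
    (hx : ∀ᵐ ξ ∂P.μ0, P.FollowsFlux q χ θ s x ξ) : P.traversal x ≤ ENNReal.ofReal P.γ := by
  have hX1 := hP.isOpen_X1.measurableSet
  refine ((hq.lintegral_followsFlux_le hP hl hθ hx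
    (hP.measurable_b.ennreal_ofReal.indicator hX1)).trans_eq
      (setLIntegral_congr_fun hX1 fun y hy => ?_)).trans hq.traversal_le
  rw [← ENNReal.ofReal_mul (hq.nonneg y hy), mul_comm]

namespace FollowsFlux

theorem mem (hx : P.FollowsFlux q χ θ s x ξ) (hθ : P.IsFluxFlow q χ θ) (hq : P.Feasible q)
    (hl : P.LocallyStable k s) {t : ℝ} (ht : 0 ≤ t) : x t ξ ∈ P.X := by
  rcases hx with ⟨he, y, hy, -, hxy⟩ | ⟨h, hxs⟩
  · rw [hxy]
    exact he.joinedPath_mem hθ hq hl hy t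
  · rw [hxs]
    exact ((hl ξ h).2.1 t ht).1

theorem pos (hx : P.FollowsFlux q χ θ s x ξ) (hθ : P.IsFluxFlow q χ θ) (hq : P.Feasible q)
    (hl : P.LocallyStable k s) {t : ℝ} (ht : 0 ≤ t) (h1 : x t ξ ∈ P.X1) : 0 < q.1 (x t ξ) := by
  rcases hx with ⟨he, y, hy, -, hxy⟩ | ⟨h, hxs⟩
  · rw [hxy] at h1 ⊢
    exact he.pos_of_joinedPath_mem hθ hq hl hy h1
  · rw [hxs] at h1
    exact absurd h1 (notMem_X1_of_nbhd ((hl ξ h).2.1 t ht))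

theorem abs_recovered_le (hx : P.FollowsFlux q χ θ s x ξ) (hθ : P.IsFluxFlow q χ θ)
    (hq : P.Feasible q) (hl : P.LocallyStable k s) {t : ℝ} (ht : 0 ≤ t) (j : Fin m) :
    |P.recovered k q (x t ξ) j| ≤ P.L j := by
  rcases hx with ⟨he, y, hy, -, hxy⟩ | ⟨h, hxs⟩
  · rw [hxy]
    exact he.abs_recovered_joinedPath_le hθ hq hl hy t j
  · have := (hl ξ h).2.1 t ht
    rw [hxs, recovered_of_nbhd this]
    exact (hl _ this).1 j

theorem tendsto (hx : P.FollowsFlux q χ θ s x ξ) (hl : P.LocallyStable k s) :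
    Tendsto (fun t => Metric.infDist (x t ξ) P.XT) atTop (𝓝 0) := by
  rcases hx with ⟨he, y, hy, -, hxy⟩ | ⟨h, hxs⟩
  · simp only [hxy]
    exact hl.tendsto_joinedPath hy
  · simp only [hxs]
    exact (hl ξ h).2.2

theorem continuousOn (hx : P.FollowsFlux q χ θ s x ξ) (hθ : P.IsFluxFlow q χ θ)
    (hq : P.Feasible q) (hks : P.IsFeedback k s) : ContinuousOn (fun t => x t ξ) (Ici 0) := by
  rcases hx with ⟨he, y, hy, hlim, hxy⟩ | ⟨h, hxs⟩
  · simp only [hxy]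
    exact he.continuousOn_joinedPath hθ hq hks hy hlim
  · simp only [hxs]
    exact (hks.2.continuous_left h.1).continuousOn

theorem eq_integral (hx : P.FollowsFlux q χ θ s x ξ) (hθ : P.IsFluxFlow q χ θ)
    (hq : P.Feasible q) (hP : P.Standing) (hesc : P.NoFiniteEscape) (hks : P.IsFeedback k s)
    (hl : P.LocallyStable k s) {t : ℝ} (ht : 0 ≤ t) :
    x t ξ = ξ + ∫ τ in (0 : ℝ)..t, P.field (x τ ξ) (P.recovered k q (x τ ξ)) := by
  rcases hx with ⟨he, y, hy, hlim, hxy⟩ | ⟨h, hxs⟩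
  · simp only [hxy]
    exact he.joinedPath_eq_integral hθ hq hP hesc hks hl hy hlim ht
  · simp only [hxs]
    have hF : Continuous fun τ => P.field (s τ ξ) (k (s τ ξ)) :=
      (hP.contDiffOn_field subset_rfl hks.1).continuousOn.comp_continuous
        (hks.2.continuous_left h.1) fun τ => ((hks.2 ξ h.1).2 τ).1
    have h1 := intervalIntegral.integral_eq_sub_of_hasDerivAt
      (fun τ _ => ((hks.2 ξ h.1).2 τ).2) (hF.intervalIntegrable 0 t)
    rw [(hks.2 ξ h.1).1] at h1
    rw [intervalIntegral.integral_congr (g := fun τ => P.field (s τ ξ) (k (s τ ξ)))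
      fun τ hτ => ?_, h1]
    · abel
    · rw [uIcc_of_le ht] at hτ
      simp only
      rw [recovered_of_nbhd ((hl ξ h).2.1 τ hτ.1)]

end FollowsFlux

theorem Feasible.obstacleMass_followsFlux (hq : P.Feasible q) (hP : P.Standing)
    (hl : P.LocallyStable k s) (hθ : P.IsFluxFlow q χ θ)
    (hx : ∀ᵐ ξ ∂P.μ0, P.FollowsFlux q χ θ s x ξ) {t : ℝ} (ht : 0 ≤ t) :
    P.obstacleMass x t = 0 := by
  have hae : ∀ᵐ ξ ∂P.μ0, x t ξ ∉ P.Xu := by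
    have h0 := hq.volume_obstacle_physicalPath hP hθ t
    have h1 := (μ0_absolutelyContinuous (P := P)).trans Measure.absolutelyContinuous_restrict
    filter_upwards [hx, measure_eq_zero_iff_ae_notMem.1 (h1 h0)] with ξ hξ hn
    rcases hξ with ⟨he, y, hy, -, hxy⟩ | ⟨h, hxs⟩
    · rw [hxy]
      rcases lt_or_ge t (P.escapeTime q χ θ ξ) with hT | hT
      · rw [joinedPath_of_lt hT]
        exact fun hu => hn ⟨he, ⟨ht, hT⟩, hu⟩
      · exact disjoint_right.1 hP.disjoint (hl.joinedPath_mem_nbhd hy hT)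
    · rw [hxs]
      exact disjoint_right.1 hP.disjoint ((hl ξ h).2.1 t ht)
  rw [obstacleMass, lintegral_congr_ae (g := fun _ => 0), lintegral_zero]
  filter_upwards [hae] with ξ hξ
  exact indicator_of_notMem hξ _

theorem Feasible.aemeasurable_recovered (hq : P.Feasible q) (hP : P.Standing)
    (hks : P.IsFeedback k s) (hl : P.LocallyStable k s) (hθ : P.IsFluxFlow q χ θ)
    (hxm : AEMeasurable (fun p : ℝ × State n => x p.1 p.2)
      ((volume.restrict (Ici (0 : ℝ))).prod P.μ0))
    (hx : ∀ᵐ ξ ∂P.μ0, P.FollowsFlux q χ θ s x ξ) :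
    AEMeasurable (fun p : ℝ × State n => P.recovered k q (x p.1 p.2))
      ((volume.restrict (Ici (0 : ℝ))).prod P.μ0) := by
  have := isFiniteMeasure_μ0 hP.integrableOn_h0
  have hN : MeasurableSet P.nbhd :=
    hP.isOpen_X.measurableSet.inter Metric.isClosed_cthickening.measurableSet
  have hR : Measurable fun z => fun j => P.X1.indicator (fun x => ratio q x j) z +
      P.nbhd.indicator (fun x => k x j) z :=
    measurable_pi_lambda _ fun j => (hq.measurable_indicator_ratio hP j).add
      (measurable_indicator_of_continuousOn hN
        ((contDiffOn_pi.1 hks.1 j).continuousOn.mono inter_subset_left))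
  refine (hR.comp_aemeasurable hxm).congr ?_
  filter_upwards [Measure.quasiMeasurePreserving_fst.ae (ae_restrict_mem measurableSet_Ici),
    Measure.quasiMeasurePreserving_snd.ae hx] with p hp hξ
  funext j
  rcases mem_X1_or_nbhd (hξ.mem hθ hq hl hp) with h | h
  · simp [h, h.2, recovered_of_mem h]
  · simp [h, notMem_X1_of_nbhd h, recovered_of_nbhd h]

/-- Every feasible density yields admissible trajectories at no higher cost. -/
theorem Feasible.exists_admissible (hq : P.Feasible q) (hP : P.Standing)
    (hesc : P.NoFiniteEscape) (hks : P.IsFeedback k s) (hl : P.LocallyStable k s) :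
    ∃ x, P.Admissible x (fun t ξ => P.recovered k q (x t ξ)) ∧
      P.cost x (fun t ξ => P.recovered k q (x t ξ)) ≤ P.programCost q ∧
      ∀ᵐ ξ ∂P.μ0, ∀ t, 0 ≤ t → x t ξ ∈ P.X1 → 0 < q.1 (x t ξ) := by
  obtain ⟨χ, θ, hθ⟩ := hq.exists_isFluxFlow hP
  obtain ⟨x, hxm, hx⟩ := hq.exists_followsFlux hP hesc hks hθ
  refine ⟨x, ⟨hxm, hq.aemeasurable_recovered hP hks hl hθ hxm hx, ?_,
    fun t ht => hq.obstacleMass_followsFlux hP hl hθ hx ht,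
    hq.traversal_followsFlux_le hP hl hθ hx, ?_, ?_⟩, hq.cost_followsFlux_le hP hl hθ hx, ?_⟩
  · filter_upwards [hx] with ξ hξ
    exact ⟨hξ.continuousOn hθ hq hks, fun t ht =>
      ⟨hξ.mem hθ hq hl ht, hξ.eq_integral hθ hq hP hesc hks hl ht⟩⟩
  · filter_upwards [hx] with ξ hξ t ht j using hξ.abs_recovered_le hθ hq hl ht j
  · filter_upwards [hx] with ξ hξ using hξ.tendsto hl
  · filter_upwards [hx] with ξ hξ t ht h1 using hξ.pos hθ hq hl ht h1

end NavData

/-! ### Convexity of the program -/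

theorem divergence_add_smul {n : ℕ} {V W : State n → State n} {x : State n}
    (hV : DifferentiableAt ℝ V x) (hW : DifferentiableAt ℝ W x) (a b : ℝ) :
    divergence (fun y => a • V y + b • W y) x = a * divergence V x + b * divergence W x := by
  have h : fderiv ℝ (fun y => a • V y + b • W y) x = a • fderiv ℝ V x + b • fderiv ℝ W x :=
    ((hV.hasFDerivAt.const_smul a).add (hW.hasFDerivAt.const_smul b)).fderiv
  simp only [divergence, h, Finset.mul_sum, ← Finset.sum_add_distrib]
  simp

namespace NavData

variable {n m : ℕ} {P : NavData n m} {k : State n → Fin m → ℝ} {s : ℝ → State n → State n}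
  {q r : (State n → ℝ) × (State n → Fin m → ℝ)} {ρ : State n → ℝ}

theorem Feasible.aemeasurable_fst (hq : P.Feasible q) (hP : P.Standing) :
    AEMeasurable q.1 (volume.restrict P.X1) :=
  hq.contDiff_fst.continuousOn.aemeasurable hP.isOpen_X1.measurableSet

theorem Feasible.aemeasurable_cost (hq : P.Feasible q) (hP : P.Standing) :
    AEMeasurable (fun x => ENNReal.ofReal (P.α * P.b x * q.1 x + P.β * P.b x * ∑ j, |q.2 x j|))
      (volume.restrict P.X1) := by
  have hX1 := hP.isOpen_X1.measurableSet
  refine (((hP.measurable_b.const_mul _).aemeasurable.mul (hq.aemeasurable_fst hP)).add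
    ((hP.measurable_b.const_mul _).aemeasurable.mul ?_)).ennreal_ofReal
  refine Finset.aemeasurable_fun_sum _ fun j _ => ?_
  exact (contDiffOn_pi.1 hq.contDiff_snd j).continuousOn.abs.aemeasurable hX1

theorem lintegral_ofReal_mul_add {μ : Measure (State n)} {c d : State n → ℝ≥0∞}
    (hc : AEMeasurable c μ) (a b : ℝ) :
    ∫⁻ x, (ENNReal.ofReal a * c x + ENNReal.ofReal b * d x) ∂μ =
      ENNReal.ofReal a * ∫⁻ x, c x ∂μ + ENNReal.ofReal b * ∫⁻ x, d x ∂μ := by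
  rw [lintegral_add_left' (hc.const_mul _), lintegral_const_mul' _ _ ENNReal.ofReal_ne_top,
    lintegral_const_mul' _ _ ENNReal.ofReal_ne_top]

section Convex

variable (hq : P.Feasible q) (hr : P.Feasible r) (hP : P.Standing) {a b : ℝ} (ha : 0 ≤ a)
  (hb : 0 ≤ b)
include hq hr hP ha hb

/-- The flux is linear in the pair, so the Liouville constraint is affine; a + b = 1 enters only
there and in the traversal bound. -/
theorem Feasible.add_smul (hab : a + b = 1) :
    P.Feasible (fun y => a * q.1 y + b * r.1 y, fun y j => a * q.2 y j + b * r.2 y j) := by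
  have hX1 := hP.isOpen_X1.measurableSet
  refine ⟨?_, ?_, (hq.integrable.const_mul a).add (hr.integrable.const_mul b), fun x hx =>
    add_nonneg (mul_nonneg ha (hq.nonneg x hx)) (mul_nonneg hb (hr.nonneg x hx)), ?_, ?_, ?_, ?_⟩
  · exact (contDiffOn_const.mul hq.contDiff_fst).add (contDiffOn_const.mul hr.contDiff_fst)
  · exact contDiffOn_pi.2 fun j => (contDiffOn_const.mul (contDiffOn_pi.1 hq.contDiff_snd j)).add
      (contDiffOn_const.mul (contDiffOn_pi.1 hr.contDiff_snd j))
  · refine (setLIntegral_congr_fun hX1 fun x hx => ?_).trans ((lintegral_ofReal_mul_add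
      (c := P.Xu.indicator fun y => ENNReal.ofReal (q.1 y))
      (d := P.Xu.indicator fun y => ENNReal.ofReal (r.1 y))
      ((hq.aemeasurable_fst hP).ennreal_ofReal.indicator hP.measurableSet_Xu) a b).trans ?_)
    · by_cases hu : x ∈ P.Xu
      · simp only [indicator_of_mem hu]
        rw [ENNReal.ofReal_add (mul_nonneg ha (hq.nonneg x hx)) (mul_nonneg hb (hr.nonneg x hx)),
          ENNReal.ofReal_mul ha, ENNReal.ofReal_mul hb]
      · simp [hu]
    · rw [hq.obstacle, hr.obstacle]
      simp
  · refine (le_of_eq ((setLIntegral_congr_fun hX1 fun x hx => ?_).trans (lintegral_ofReal_mul_add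
      (c := fun y => ENNReal.ofReal (P.b y * q.1 y)) (d := fun y => ENNReal.ofReal (P.b y * r.1 y))
      (hP.measurable_b.aemeasurable.mul (hq.aemeasurable_fst hP)).ennreal_ofReal a b))).trans ?_
    · have hbx := hP.b_nonneg x (X1_subset hx)
      simp only
      rw [← ENNReal.ofReal_mul ha, ← ENNReal.ofReal_mul hb, ← ENNReal.ofReal_add
        (mul_nonneg ha (mul_nonneg hbx (hq.nonneg x hx)))
        (mul_nonneg hb (mul_nonneg hbx (hr.nonneg x hx)))]
      congr 1
      ring
    · refine (add_le_add (mul_le_mul_right hq.traversal_le _)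
        (mul_le_mul_right hr.traversal_le _)).trans_eq ?_
      rw [← add_mul, ← ENNReal.ofReal_add ha hb, hab, ENNReal.ofReal_one, one_mul]
  · intro x hx j
    refine (abs_add_le _ _).trans ?_
    rw [abs_mul, abs_mul, abs_of_nonneg ha, abs_of_nonneg hb]
    have h1 := mul_le_mul_of_nonneg_left (hq.control_le x hx j) ha
    have h2 := mul_le_mul_of_nonneg_left (hr.control_le x hx j) hb
    simp only
    linarith
  · have hflux : ∀ y, (a * q.1 y + b * r.1 y) • P.f y +
        ∑ j, (a * q.2 y j + b * r.2 y j) • P.g j y = a • P.flux q y + b • P.flux r y := fun y => by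
      simp only [flux, _root_.add_smul, smul_add, Finset.smul_sum, mul_smul,
        Finset.sum_add_distrib]
      abel
    simp only [hflux]
    filter_upwards [hq.liouville, hr.liouville, ae_restrict_mem hX1] with x h1 h2 hx
    have hd : ∀ {q}, P.Feasible q → DifferentiableAt ℝ (P.flux q) x := fun hq =>
      ((hq.contDiffOn_flux hP).differentiableOn one_ne_zero).differentiableAt
        (hP.isOpen_X1.mem_nhds hx)
    rw [divergence_add_smul (hd hq) (hd hr)]
    change divergence (P.flux q) x = _ at h1
    change divergence (P.flux r) x = _ at h2
    rw [h1, h2, ← add_mul, hab, one_mul]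

theorem Feasible.programCost_add_smul_le :
    P.programCost (fun y => a * q.1 y + b * r.1 y, fun y j => a * q.2 y j + b * r.2 y j) ≤
      ENNReal.ofReal a * P.programCost q + ENNReal.ofReal b * P.programCost r := by
  rw [programCost, programCost, programCost, ← lintegral_ofReal_mul_add (hq.aemeasurable_cost hP)]
  refine setLIntegral_mono' hP.isOpen_X1.measurableSet fun x hx => ?_
  have hbx := hP.b_nonneg x (X1_subset hx)
  have hsum : ∑ j, |a * q.2 x j + b * r.2 x j| ≤
      a * ∑ j, |q.2 x j| + b * ∑ j, |r.2 x j| := by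
    rw [Finset.mul_sum, Finset.mul_sum, ← Finset.sum_add_distrib]
    refine Finset.sum_le_sum fun j _ => (abs_add_le _ _).trans_eq ?_
    rw [abs_mul, abs_mul, abs_of_nonneg ha, abs_of_nonneg hb]
  have hpos : ∀ {q}, P.Feasible q →
      0 ≤ P.α * P.b x * q.1 x + P.β * P.b x * ∑ j, |q.2 x j| := fun {q} hq =>
    add_nonneg (mul_nonneg (mul_nonneg hP.α_pos.le hbx) (hq.nonneg x hx))
      (mul_nonneg (mul_nonneg hP.β_pos.le hbx) (Finset.sum_nonneg fun _ _ => abs_nonneg _))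
  rw [← ENNReal.ofReal_mul ha, ← ENNReal.ofReal_mul hb, ← ENNReal.ofReal_add
    (mul_nonneg ha (hpos hq)) (mul_nonneg hb (hpos hr))]
  refine ENNReal.ofReal_le_ofReal ?_
  have := mul_le_mul_of_nonneg_left hsum (mul_nonneg hP.β_pos.le hbx)
  simp only
  linarith

end Convex

/-- The program is convex. -/
theorem Standing.convexOn_programCost (hP : P.Standing) :
    ConvexOn ℝ≥0 {q | P.Feasible q} P.programCost := by
  have hcomb : ∀ (q r : (State n → ℝ) × (State n → Fin m → ℝ)) (a b : ℝ≥0), a • q + b • r =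
      (fun y => (a : ℝ) * q.1 y + b * r.1 y, fun y j => (a : ℝ) * q.2 y j + b * r.2 y j) :=
    fun _ _ _ _ => rfl
  constructor
  · intro q hq r hr a b _ _ hab
    rw [hcomb]
    exact Feasible.add_smul hq hr hP a.coe_nonneg b.coe_nonneg (by exact_mod_cast hab)
  · intro q hq r hr a b _ _ _
    rw [hcomb]
    have h := Feasible.programCost_add_smul_le hq hr hP a.coe_nonneg b.coe_nonneg
    rwa [ENNReal.ofReal_coe_nnreal, ENNReal.ofReal_coe_nnreal] at h

end NavData

/-! ### Equivalence of the navigation problem and the program -/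

theorem theorem1 {n m : ℕ} (P : NavData n m)
    (hX : IsOpen P.X) (hXT : P.XT.Nonempty) (hε : 0 < P.ε)
    (hXu : MeasurableSet P.Xu) (hXuN : Disjoint P.Xu P.nbhd)
    (hf : ContDiffOn ℝ 1 P.f P.X) (hg : ∀ j, ContDiffOn ℝ 1 (P.g j) P.X)
    (hbm : Measurable P.b) (hb : ∀ x ∈ P.X, 0 ≤ P.b x)
    (hh0 : ∀ x ∈ P.X, 0 ≤ P.h0 x) (hh0i : IntegrableOn P.h0 P.X)
    (hα : 0 < P.α) (hβ : 0 < P.β) (hγ : 0 ≤ P.γ) (hL : ∀ j, 0 ≤ P.L j)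
    (hesc : P.NoFiniteEscape)
    -- the optimal control is a `C¹` feedback `k`, with closed-loop flow `s` and finite cost
    (k : State n → Fin m → ℝ) (s : ℝ → State n → State n)
    (hks : P.IsFeedback k s) (hloc : P.LocallyStable k s)
    (hopt : P.IsOptimal s (fun t ξ => k (s t ξ)))
    (hfin : P.cost s (fun t ξ => k (s t ξ)) ≠ ⊤)
    (htime : (∃ c > 0, ∀ x ∈ P.X1, c ≤ P.b x) ∨ P.meanTime s ≠ ⊤)
    -- the occupation density `ρ = ∫₀^∞ P_t h₀ dt` of `k` is of class `C¹` on `X₁`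
    (ρ : State n → ℝ) (hρ : P.IsOccupationDensity s ρ)
    (hρ0 : ∀ x ∈ P.X1, 0 ≤ ρ x) (hρ1 : ContDiffOn ℝ 1 ρ P.X1) :
    -- the program is convex (scalars in `ℝ≥0`, as the objective takes values in `[0, ∞]`)
    ConvexOn ℝ≥0 {q | P.Feasible q} P.programCost ∧
    -- the two problems have the same value, and `(ρ, ρ k)` solves the program
    P.programValue = P.value ∧
    P.IsProgramOptimal (ρ, fun x => ρ x • k x) ∧
    P.programCost (ρ, fun x => ρ x • k x) = P.cost s (fun t ξ => k (s t ξ)) ∧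
    -- every solution of the program yields an optimal feedback `ρ̄ / ρ`, under which the
    -- target is almost everywhere stable
    (∀ q, P.IsProgramOptimal q → ∃ x : ℝ → State n → State n,
      P.IsOptimal x (fun t ξ => P.recovered k q (x t ξ)) ∧ P.AEStable x ∧
      ∀ᵐ ξ ∂P.μ0, ∀ t, 0 ≤ t → x t ξ ∈ P.X1 → 0 < q.1 (x t ξ)) ∧
    -- for every feedback, optimal or not, the constraints and costs correspond
    (∀ (k' : State n → Fin m → ℝ) (s' : ℝ → State n → State n) (ρ' : State n → ℝ),
      P.IsFeedback k' s' → P.LocallyStable k' s' →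
      P.cost s' (fun t ξ => k' (s' t ξ)) ≠ ⊤ →
      ((∃ c > 0, ∀ x ∈ P.X1, c ≤ P.b x) ∨ P.meanTime s' ≠ ⊤) →
      P.IsOccupationDensity s' ρ' → (∀ x ∈ P.X1, 0 ≤ ρ' x) → ContDiffOn ℝ 1 ρ' P.X1 →
        P.AEStable s' ∧
        (P.Admissible s' (fun t ξ => k' (s' t ξ)) ↔
          P.Feasible (ρ', fun x => ρ' x • k' x)) ∧
        P.programCost (ρ', fun x => ρ' x • k' x) = P.cost s' (fun t ξ => k' (s' t ξ))) ∧
    -- zero total occupation time of the obstacle set implies zero occupation at every time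
    (∀ (k' : State n → Fin m → ℝ) (s' : ℝ → State n → State n), P.IsFeedback k' s' →
      ∫⁻ t in Ici (0 : ℝ), P.obstacleMass s' t = 0 →
        ∀ t, 0 ≤ t → P.obstacleMass s' t = 0) := by
  have hP : P.Standing := ⟨hX, hXu, hXuN, hf, hg, hbm, hb, hh0, hh0i, hα, hβ⟩
  have hr : P.IsRegular k s ρ := ⟨hks, hloc, hfin, htime, hρ, hρ0, hρ1⟩
  have hcost := hr.programCost_eq hP
  have hfeas : P.Feasible (ρ, fun x => ρ x • k x) := hr.feasible_of_admissible hP hopt.1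
  -- Weak duality, so to speak: every feasible pair is realized by admissible trajectories of no
  -- greater cost, and these compete with the optimal k. The local feedback near the target is k
  -- itself.
  have hlower : ∀ q, P.Feasible q → P.cost s (fun t ξ => k (s t ξ)) ≤ P.programCost q :=
    fun q hq => by
      obtain ⟨x, hx, hle, -⟩ := hq.exists_admissible hP hesc hks hloc
      exact (hopt.2 _ _ hx).trans hle
  have hprog : P.IsProgramOptimal (ρ, fun x => ρ x • k x) :=
    ⟨hfeas, fun q hq => hcost.trans_le (hlower q hq)⟩
  have hvalue : P.value = P.cost s (fun t ξ => k (s t ξ)) :=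
    le_antisymm (iInf₂_le_of_le _ _ (iInf_le _ hopt.1)) (le_iInf₂ fun x u => le_iInf (hopt.2 x u))
  have hpvalue : P.programValue = P.cost s (fun t ξ => k (s t ξ)) :=
    le_antisymm ((iInf₂_le _ hfeas).trans_eq hcost) (le_iInf₂ hlower)
  refine ⟨hP.convexOn_programCost, hpvalue.trans hvalue.symm, hprog, hcost, fun q hq => ?_,
    fun k' s' ρ' h1 h2 h3 h4 h5 h6 h7 => ?_, fun k' s' h1 h2 t ht =>
      NavData.obstacleMass_eq_zero hP h1 h2 ht⟩
  · obtain ⟨x, hx, hle, hpos⟩ := hq.1.exists_admissible hP hesc hks hloc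
    -- The cost of the recovered trajectories is squeezed: at most the program cost of q, which is
    -- at most that of (ρ, ρ k), which equals the optimal cost.
    exact ⟨x, ⟨hx, fun x' u' h' => (hle.trans ((hq.2 _ hfeas).trans_eq hcost)).trans
      (hopt.2 x' u' h')⟩, hx.stable, hpos⟩
  · have hr' : P.IsRegular k' s' ρ' := ⟨h1, h2, h3, h4, h5, h6, h7⟩
    exact ⟨hr'.aeStable hP, ⟨hr'.feasible_of_admissible hP, hr'.admissible_of_feasible hP⟩,
      hr'.programCost_eq hP⟩
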